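/- Let $A,B,R$ be quantum systems described by complex separable Hilbert spaces $\mathcal H_A,\mathcal H_B,\mathcal H_R$ with $\dim\mathcal H_R=\infty$; write $\mathcal H_{AR}=\mathcal H_A\otimes\mathcal H_R$. Let $\mathfrak T(\mathcal H)$ be the space of trace-class operators with the trace norm $\|\cdot\|_1$, and $\mathfrak S(\mathcal H)$ the set of states (positive trace-class operators of unit trace). A channel from $A$ to $B$ is a completely positive trace-preserving linear map $\mathfrak T(\mathcal H_A)\to\mathfrak T(\mathcal H_B)$; $\mathfrak F(A,B)$ is the set of all channels. Let $H_A$ be a densely defined positive self-adjoint (possibly unbounded) operator in $\mathcal H_A$, let $E_0^A$ be the infimum of its spectrum, and for a positive trace-class operator $\rho$ put $\operatorname{Tr}H_A\rho=\sup_n\operatorname{Tr}P_nH_A\rho\in[0,\infty]$, where $P_n$ is the spectral projector of $H_A$ for $[0,n]$. For a Hermitian-preserving linear map $\Phi:\mathfrak T(\mathcal H_A)\to\mathfrak T(\mathcal H_B)$ and a real $E>E_0^A$ put $$\|\Phi\|_\diamond=\sup_{\rho\in\mathfrak S(\mathcal H_{AR})}\|\Phi\otimes\mathrm{id}_R(\rho)\|_1,\qquad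 \|\Phi\|_\diamond^E=\sup_{\rho\in\mathfrak S(\mathcal H_{AR}),\ \operatorname{Tr}H_A\rho_A\le E}\|\Phi\otimes\mathrm{id}_R(\rho)\|_1$$ with values in $[0,\infty]$, where $\|\Phi\otimes\mathrm{id}_R(\rho)\|_1=\infty$ if $\Phi\otimes\mathrm{id}_R(\rho)$ does not exist as a trace-class operator (this cannot happen when $\Phi$ is completely bounded, in particular not for differences of channels). Strong convergence $\Phi_n\to\Phi_0$ means $\|\Phi_n(\rho)-\Phi_0(\rho)\|_1\to0$ for every $\rho\in\mathfrak S(\mathcal H_A)$; the strong convergence topology is the one defined by the seminorms $\Phi\mapsto\|\Phi(\rho)\|_1$, $\rho\in\mathfrak S(\mathcal H_A)$. Then for every $E>E_0^A$ the following hold. 0) On Hermitian-preserving linear maps $\|\cdot\|_\diamond^E$ is subadditive and absolutely homogeneous (over $\mathbb R$), it is finite whenever $\|\Phi\|_\diamond<\infty$, and $\|\Phi\|_\diamond^E=0$ implies $\Phi=0$ for every Hermitian-preserving $\Phi$ that is bounded as a map between the Banach spaces $\mathfrak T(\mathcal H_A)$ and $\mathfrak T(\mathcal H_B)$. A) For $\Phi_n,\Phi_0\in\mathfrak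 F(A,B)$, $\lim_n\|\Phi_n-\Phi_0\|_\diamond^E=0$ implies that $\Phi_n$ converges strongly to $\Phi_0$. B) If $H_A$ has discrete spectrum $\{E_k\}_{k\ge0}$ of finite multiplicity with $E_k\to+\infty$, i.e. $\mathcal H_A$ has an orthonormal basis $(\tau_k)_{k\ge 0}$ with $H_A\tau_k=E_k\tau_k$ and $E_k\to+\infty$, then the converse implication in A) also holds, and the topology generated by $\|\cdot\|_\diamond^E$ on $\mathfrak F(A,B)$ coincides with the strong convergence topology. Moreover, the implication in A) holds for Hermitian-preserving linear maps $\Phi_n,\Phi_0$ whose operator norms $\mathfrak T(\mathcal H_A)\to\mathfrak T(\mathcal H_B)$ are uniformly bounded; and under the condition of B) the equivalence and the coincidence of topologies hold on every set of Hermitian-preserving linear maps on which $\|\cdot\|_\diamond$ is bounded. -/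

import Mathlib

open scoped ENNReal InnerProductSpace TensorProduct ComplexOrder

noncomputable section

namespace ECD

universe u v w

section TraceClass

variable {H : Type u} [NormedAddCommGroup H] [InnerProductSpace ℂ H] [CompleteSpace H]
variable {K : Type v} [NormedAddCommGroup K] [InnerProductSpace ℂ K] [CompleteSpace K]

/-- The index set of a fixed Hilbert basis of `H`. -/
def basisIndex (H : Type u) [NormedAddCommGroup H] [InnerProductSpace ℂ H] [CompleteSpace H] :
    Set H :=
  (exists_hilbertBasis ℂ H).choose

/-- A fixed Hilbert (complete orthonormal) basis of `H`. -/
def stdBasis (H : Type u) [NormedAddCommGroup H] [InnerProductSpace ℂ H] [CompleteSpace H] :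
    HilbertBasis (basisIndex H) ℂ H :=
  (exists_hilbertBasis ℂ H).choose_spec.choose

/-- The trace norm `‖T‖₁ = Tr |T| ∈ [0, ∞]`, where `|T| = √(T† T)`. -/
def traceNorm (T : H →L[ℂ] H) : ℝ≥0∞ :=
  ∑' i, ENNReal.ofReal (⟪stdBasis H i, CFC.abs T (stdBasis H i)⟫_ℂ).re

/-- The trace `Tr T = ∑ᵢ ⟨eᵢ, T eᵢ⟩` (used for trace-class operators only). -/
def trace (T : H →L[ℂ] H) : ℂ :=
  ∑' i, ⟪stdBasis H i, T (stdBasis H i)⟫_ℂ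

theorem norm_abs_apply (T : H →L[ℂ] H) (x : H) : ‖CFC.abs T x‖ = ‖T x‖ := by
  have h1 : ⟪CFC.abs T x, CFC.abs T x⟫_ℂ = ⟪T x, T x⟫_ℂ := by
    have hs : IsSelfAdjoint (CFC.abs T) := (CFC.abs_nonneg T).isSelfAdjoint
    have h2 := congrArg (fun S : H →L[ℂ] H => S x) (CFC.abs_mul_abs T)
    simp only [ContinuousLinearMap.mul_def, ContinuousLinearMap.comp_apply, ContinuousLinearMap.star_eq_adjoint] at h2
    rw [← ContinuousLinearMap.adjoint_inner_right, ← ContinuousLinearMap.star_eq_adjoint,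
      hs.star_eq, h2, ContinuousLinearMap.adjoint_inner_right]
  have h3 := congrArg Complex.re h1
  rw [inner_self_eq_norm_sq_to_K, inner_self_eq_norm_sq_to_K] at h3
  norm_cast at h3
  exact (sq_eq_sq₀ (norm_nonneg _) (norm_nonneg _)).1 h3

/-- Polar decomposition: `T = U |T|` and `|T| = U† T` with a contraction `U`. -/
theorem exists_polar (T : H →L[ℂ] H) :
    ∃ U : H →L[ℂ] H, U ∘L CFC.abs T = T ∧ ContinuousLinearMap.adjoint U ∘L T = CFC.abs T := by
  classical
  obtain ⟨U, hU1, hU⟩ : ∃ U : H →L[ℂ] H, ‖U‖ ≤ 1 ∧ ∀ x, U (CFC.abs T x) = T x := by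
    set A : H →L[ℂ] H := CFC.abs T with hA
    have hker : ∀ x y : H, A x = A y → T x = T y := by
      intro x y h
      have h0 : ‖A (x - y)‖ = 0 := by rw [map_sub, h, sub_self, norm_zero]
      rw [hA, norm_abs_apply, norm_eq_zero, map_sub, sub_eq_zero] at h0
      exact h0
    let M : Submodule ℂ H := LinearMap.range A.toLinearMap
    have hpre : ∀ y : M, ∃ x, A x = y := fun y => y.2
    choose p hp using hpre
    let f₀ : M →ₗ[ℂ] H :=
      { toFun := fun y => T (p y)
        map_add' := fun y z => by
          rw [← map_add]; apply hker; simp [hp]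
        map_smul' := fun c y => by
          rw [RingHom.id_apply, ← map_smul]; apply hker; simp [hp] }
    have hf₀ : ∀ y : M, ‖f₀ y‖ = ‖y‖ := by
      intro y
      change ‖T (p y)‖ = ‖(y : H)‖
      rw [← norm_abs_apply, ← hA, hp]
    let f : M →L[ℂ] H := f₀.mkContinuous 1 (fun y => by rw [hf₀, one_mul])
    let C : Submodule ℂ H := M.topologicalClosure
    have : CompleteSpace C := M.isClosed_topologicalClosure.completeSpace_coe
    let e : M →ₗᵢ[ℂ] C :=
      { toLinearMap := Submodule.inclusion M.le_topologicalClosure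
        norm_map' := fun y => rfl }
    have hed : DenseRange e := by
      intro y
      rw [Metric.mem_closure_iff]
      intro ε hε
      obtain ⟨z, hz, hd⟩ := Metric.mem_closure_iff.1
        (show (y : H) ∈ closure (M : Set H) from y.2) ε hε
      exact ⟨e ⟨z, hz⟩, ⟨_, rfl⟩, hd⟩
    have heu : IsUniformInducing e := e.isometry.isUniformInducing
    let g : C →L[ℂ] H := f.extend e.toContinuousLinearMap
    have hg : ‖g‖ ≤ 1 := by
      refine (ContinuousLinearMap.opNorm_extend_le (N := 1) f (e := e.toContinuousLinearMap) hed
        (fun y => ?_)).trans ?_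
      · simp
      · rw [NNReal.coe_one, one_mul]
        exact f₀.mkContinuous_norm_le zero_le_one _
    refine ⟨g ∘L C.orthogonalProjectionOnto, ?_, fun x => ?_⟩
    · refine (ContinuousLinearMap.opNorm_comp_le _ _).trans ?_
      exact mul_le_one₀ hg (norm_nonneg _) (C.orthogonalProjectionOnto_norm_le)
    · have hx : C.orthogonalProjectionOnto (A x) = e ⟨A x, ⟨x, rfl⟩⟩ := by
        have := Submodule.orthogonalProjectionOnto_mem_subspace_eq_self (K := C) (e ⟨A x, ⟨x, rfl⟩⟩)
        exact this
      rw [ContinuousLinearMap.comp_apply, hx]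
      have h5 := ContinuousLinearMap.extend_eq f (e := e.toContinuousLinearMap) hed heu
        ⟨A x, ⟨x, rfl⟩⟩
      refine Eq.trans h5 ?_
      exact hker _ _ (hp _)
  refine ⟨U, ContinuousLinearMap.ext hU, ContinuousLinearMap.ext fun x => ?_⟩
  have h1 : ‖ContinuousLinearMap.adjoint U (T x)‖ ≤ ‖T x‖ := by
    refine (ContinuousLinearMap.le_of_opNorm_le (c := 1) _ ?_ _).trans_eq (one_mul _)
    rwa [LinearIsometryEquiv.norm_map]
  have h2 : ⟪ContinuousLinearMap.adjoint U (T x), CFC.abs T x⟫_ℂ = (‖T x‖ : ℂ) ^ 2 := by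
    rw [ContinuousLinearMap.adjoint_inner_left, hU, inner_self_eq_norm_sq_to_K]; rfl
  have h3 : ‖ContinuousLinearMap.adjoint U (T x) - CFC.abs T x‖ ^ 2 ≤ 0 := by
    rw [@norm_sub_sq ℂ, h2, norm_abs_apply]
    have h4 : RCLike.re ((‖T x‖ : ℂ) ^ 2) = ‖T x‖ ^ 2 := by norm_cast
    rw [h4]
    nlinarith [norm_nonneg (ContinuousLinearMap.adjoint U (T x)), norm_nonneg (T x)]
  have h5 : ‖ContinuousLinearMap.adjoint U (T x) - CFC.abs T x‖ = 0 := by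
    nlinarith [norm_nonneg (ContinuousLinearMap.adjoint U (T x) - CFC.abs T x)]
  exact sub_eq_zero.1 (norm_eq_zero.1 h5)

theorem tsum_enorm_sq_inner {G : Type*} [NormedAddCommGroup G] [InnerProductSpace ℂ G]
    {ι : Type*} (b : HilbertBasis ι ℂ G) (x : G) :
    ∑' i, ‖⟪b i, x⟫_ℂ‖ₑ ^ 2 = ‖x‖ₑ ^ 2 := by
  have h := b.hasSum_inner_mul_inner x x
  have h' : HasSum (fun i => ‖⟪b i, x⟫_ℂ‖ ^ 2) (‖x‖ ^ 2) := by
    have h1 := Complex.hasSum_re h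
    rw [inner_self_eq_norm_sq_to_K] at h1
    convert h1 using 1
    · funext i
      rw [← inner_conj_symm x (b i), RCLike.conj_mul]
      norm_cast
    · norm_cast
  have h2 := ENNReal.ofReal_tsum_of_nonneg (fun i => by positivity) h'.summable
  rw [h'.tsum_eq] at h2
  rw [← ofReal_norm, ← ENNReal.ofReal_pow (norm_nonneg _), h2]
  congr 1
  funext i
  rw [ENNReal.ofReal_pow (norm_nonneg _), ofReal_norm]

/-- The Hilbert-Schmidt sums of `S` and of `S†` agree, in any two bases. -/
theorem tsum_enorm_sq_adjoint {ι κ : Type*} (b : HilbertBasis ι ℂ H) (c : HilbertBasis κ ℂ K)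
    (S : H →L[ℂ] K) :
    ∑' i, ‖S (b i)‖ₑ ^ 2 = ∑' j, ‖ContinuousLinearMap.adjoint S (c j)‖ₑ ^ 2 := by
  have h1 : ∀ i, ‖S (b i)‖ₑ ^ 2 = ∑' j, ‖⟪c j, S (b i)⟫_ℂ‖ₑ ^ 2 :=
    fun i => (tsum_enorm_sq_inner c _).symm
  have h2 : ∀ j, ‖ContinuousLinearMap.adjoint S (c j)‖ₑ ^ 2 = ∑' i, ‖⟪c j, S (b i)⟫_ℂ‖ₑ ^ 2 := by
    intro j
    rw [← tsum_enorm_sq_inner b]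
    congr 1
    funext i
    rw [ContinuousLinearMap.adjoint_inner_right, ← inner_conj_symm, RCLike.enorm_conj]
  simp_rw [h1, h2]
  exact ENNReal.tsum_comm

theorem ofReal_inner_abs (T : H →L[ℂ] H) (x : H) :
    ENNReal.ofReal (⟪x, CFC.abs T x⟫_ℂ).re = ‖CFC.sqrt (CFC.abs T) x‖ₑ ^ 2 := by
  have hs : IsSelfAdjoint (CFC.sqrt (CFC.abs T)) := (CFC.sqrt_nonneg _).isSelfAdjoint
  have h2 := congrArg (fun S : H →L[ℂ] H => S x)
    (CFC.sqrt_mul_sqrt_self (CFC.abs T) (CFC.abs_nonneg T))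
  simp only [ContinuousLinearMap.mul_def, ContinuousLinearMap.comp_apply] at h2
  rw [← h2, ← ContinuousLinearMap.adjoint_inner_left, ← ContinuousLinearMap.star_eq_adjoint,
    hs.star_eq, inner_self_eq_norm_sq_to_K, ← ofReal_norm,
    ← ENNReal.ofReal_pow (norm_nonneg _)]
  congr 1
  norm_cast

theorem tsum_enorm_sq_comp_le {ι : Type*} (b : HilbertBasis ι ℂ K) (T : H →L[ℂ] H)
    (X : K →L[ℂ] H) :
    ∑' i, ‖CFC.sqrt (CFC.abs T) (X (b i))‖ₑ ^ 2 ≤ ‖X‖ₑ ^ 2 * traceNorm T := by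
  have hs : IsSelfAdjoint (CFC.sqrt (CFC.abs T)) := (CFC.sqrt_nonneg _).isSelfAdjoint
  have h1 := tsum_enorm_sq_adjoint b (stdBasis H) (CFC.sqrt (CFC.abs T) ∘L X)
  simp only [ContinuousLinearMap.comp_apply] at h1
  rw [h1, traceNorm, ← ENNReal.tsum_mul_left]
  refine ENNReal.tsum_le_tsum fun i => ?_
  rw [ofReal_inner_abs, ContinuousLinearMap.adjoint_comp, ContinuousLinearMap.comp_apply,
    ← ContinuousLinearMap.star_eq_adjoint (CFC.sqrt (CFC.abs T)), hs.star_eq, ← mul_pow]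
  gcongr
  refine (ContinuousLinearMap.le_opENorm _ _).trans ?_
  gcongr
  rw [← ofReal_norm, ← ofReal_norm, LinearIsometryEquiv.norm_map]

theorem tsum_enorm_inner_lt_top {ι : Type*} (b : HilbertBasis ι ℂ K) {T : H →L[ℂ] H}
    (hT : traceNorm T < ⊤) (X Y : K →L[ℂ] H) :
    ∑' i, ‖⟪X (b i), T (Y (b i))⟫_ℂ‖ₑ < ⊤ := by
  obtain ⟨U, hU, -⟩ := exists_polar T
  have hs : IsSelfAdjoint (CFC.sqrt (CFC.abs T)) := (CFC.sqrt_nonneg _).isSelfAdjoint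
  have key : ∀ i, ‖⟪X (b i), T (Y (b i))⟫_ℂ‖ₑ ≤
      ‖CFC.sqrt (CFC.abs T) ((ContinuousLinearMap.adjoint U ∘L X) (b i))‖ₑ ^ 2 +
        ‖CFC.sqrt (CFC.abs T) (Y (b i))‖ₑ ^ 2 := by
    intro i
    have h2 := congrArg (fun S : H →L[ℂ] H => S (Y (b i)))
      (CFC.sqrt_mul_sqrt_self (CFC.abs T) (CFC.abs_nonneg T))
    simp only [ContinuousLinearMap.mul_def, ContinuousLinearMap.comp_apply] at h2
    have h3 : T (Y (b i)) = U (CFC.sqrt (CFC.abs T) (CFC.sqrt (CFC.abs T) (Y (b i)))) := by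
      rw [h2, ← ContinuousLinearMap.comp_apply U, hU]
    rw [h3, ← ContinuousLinearMap.adjoint_inner_left, ← ContinuousLinearMap.adjoint_inner_left,
      ← ContinuousLinearMap.star_eq_adjoint (CFC.sqrt (CFC.abs T)), hs.star_eq,
      ContinuousLinearMap.comp_apply]
    set p := CFC.sqrt (CFC.abs T) (ContinuousLinearMap.adjoint U (X (b i)))
    set q := CFC.sqrt (CFC.abs T) (Y (b i))
    rw [← ofReal_norm, ← ofReal_norm, ← ofReal_norm,
      ← ENNReal.ofReal_pow (norm_nonneg _), ← ENNReal.ofReal_pow (norm_nonneg _),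
      ← ENNReal.ofReal_add (by positivity) (by positivity)]
    refine ENNReal.ofReal_le_ofReal ((norm_inner_le_norm p q).trans ?_)
    nlinarith [sq_nonneg (‖p‖ - ‖q‖), sq_nonneg ‖p‖, sq_nonneg ‖q‖]
  refine (ENNReal.tsum_le_tsum key).trans_lt ?_
  rw [ENNReal.tsum_add, ENNReal.add_lt_top]
  exact ⟨(tsum_enorm_sq_comp_le b T _).trans_lt
      (ENNReal.mul_lt_top (ENNReal.pow_lt_top enorm_lt_top) hT),
    (tsum_enorm_sq_comp_le b T _).trans_lt
      (ENNReal.mul_lt_top (ENNReal.pow_lt_top enorm_lt_top) hT)⟩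

theorem ofReal_re_le_enorm (z : ℂ) : ENNReal.ofReal z.re ≤ ‖z‖ₑ := by
  rw [← ofReal_norm]
  exact ENNReal.ofReal_le_ofReal (Complex.re_le_norm z)

theorem traceNorm_add_lt_top {S T : H →L[ℂ] H} (hS : traceNorm S < ⊤) (hT : traceNorm T < ⊤) :
    traceNorm (S + T) < ⊤ := by
  obtain ⟨U, -, hU⟩ := exists_polar (S + T)
  refine lt_of_le_of_lt ?_ (ENNReal.add_lt_top.2
    ⟨tsum_enorm_inner_lt_top (stdBasis H) hS U (ContinuousLinearMap.id ℂ H),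
      tsum_enorm_inner_lt_top (stdBasis H) hT U (ContinuousLinearMap.id ℂ H)⟩)
  rw [← ENNReal.tsum_add, traceNorm]
  refine ENNReal.tsum_le_tsum fun i => (ofReal_re_le_enorm _).trans ?_
  rw [← hU, ContinuousLinearMap.comp_apply, ContinuousLinearMap.adjoint_inner_right,
    _root_.add_apply, inner_add_right]
  exact enorm_add_le _ _

/-- Compressions `V† T W` of trace-class operators are trace class. -/
theorem traceNorm_compression_lt_top {T : H →L[ℂ] H} (hT : traceNorm T < ⊤) (V W : K →L[ℂ] H) :
    traceNorm (ContinuousLinearMap.adjoint V ∘L T ∘L W) < ⊤ := by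
  obtain ⟨U, -, hU⟩ := exists_polar (ContinuousLinearMap.adjoint V ∘L T ∘L W)
  refine lt_of_le_of_lt ?_ (tsum_enorm_inner_lt_top (stdBasis K) hT (V ∘L U) W)
  rw [traceNorm]
  refine ENNReal.tsum_le_tsum fun i => (ofReal_re_le_enorm _).trans ?_
  rw [← hU]
  simp only [ContinuousLinearMap.comp_apply, ContinuousLinearMap.adjoint_inner_right]
  exact le_rfl

theorem traceNorm_zero : traceNorm (0 : H →L[ℂ] H) = 0 := by
  simp [traceNorm]

/-- The space `𝔗(H)` of trace-class operators on `H`. -/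
def TraceClass (H : Type u) [NormedAddCommGroup H] [InnerProductSpace ℂ H] [CompleteSpace H] :
    Submodule ℂ (H →L[ℂ] H) where
  carrier := {T | traceNorm T < ⊤}
  add_mem' := traceNorm_add_lt_top
  zero_mem' := by
    change traceNorm (0 : H →L[ℂ] H) < ⊤
    rw [traceNorm_zero]; exact ENNReal.zero_lt_top
  smul_mem' c T hT := by
    have h := traceNorm_compression_lt_top (T := T) hT (ContinuousLinearMap.id ℂ H)
      (c • ContinuousLinearMap.id ℂ H)
    have h2 : ContinuousLinearMap.adjoint (ContinuousLinearMap.id ℂ H) ∘L T ∘L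
        (c • ContinuousLinearMap.id ℂ H) = c • T := by
      have h3 : ContinuousLinearMap.adjoint (ContinuousLinearMap.id ℂ H) =
          ContinuousLinearMap.id ℂ H := by
        rw [← ContinuousLinearMap.one_def, ← ContinuousLinearMap.star_eq_adjoint, star_one]
      rw [h3]; ext x; simp
    rwa [h2] at h

/-- `ρ` is a quantum state: a positive trace-class operator with unit trace. -/
def IsState (ρ : TraceClass H) : Prop :=
  (ρ : H →L[ℂ] H).IsPositive ∧ trace (ρ : H →L[ℂ] H) = 1

end TraceClass

section Superoperators

variable (A : Type u) [NormedAddCommGroup A] [InnerProductSpace ℂ A] [CompleteSpace A]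
variable (B : Type v) [NormedAddCommGroup B] [InnerProductSpace ℂ B] [CompleteSpace B]

/-- Linear superoperators `𝔗(A) → 𝔗(B)`. -/
abbrev Superoperator : Type (max u v) := TraceClass A →ₗ[ℂ] TraceClass B

variable {A B}

/-- `Φ` maps Hermitian operators to Hermitian operators. -/
def HermitianPreserving (Φ : Superoperator A B) : Prop :=
  ∀ T : TraceClass A, IsSelfAdjoint (T : A →L[ℂ] A) → IsSelfAdjoint (Φ T : B →L[ℂ] B)

/-- The norm of `Φ` as an operator between the Banach spaces `𝔗(A)` and `𝔗(B)` is at most `C`. -/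
def OpNormLE (Φ : Superoperator A B) (C : ℝ≥0∞) : Prop :=
  ∀ T : TraceClass A, traceNorm (Φ T : B →L[ℂ] B) ≤ C * traceNorm (T : A →L[ℂ] A)

/-- The operator on `Hⁿ` with operator entries `T i j` is positive. -/
def BlockPositive {H : Type u} [NormedAddCommGroup H] [InnerProductSpace ℂ H] {n : ℕ}
    (T : Fin n → Fin n → (H →L[ℂ] H)) : Prop :=
  ∀ x : Fin n → H, 0 ≤ ∑ i, ∑ j, ⟪x i, T i j (x j)⟫_ℂ

/-- Complete positivity: every amplification `Φ ⊗ id` on `n × n` operator matrices preserves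
positivity. -/
def CompletelyPositive (Φ : Superoperator A B) : Prop :=
  ∀ (n : ℕ) (T : Fin n → Fin n → TraceClass A),
    BlockPositive (fun i j => (T i j : A →L[ℂ] A)) →
      BlockPositive (fun i j => (Φ (T i j) : B →L[ℂ] B))

def TracePreserving (Φ : Superoperator A B) : Prop :=
  ∀ T : TraceClass A, trace (Φ T : B →L[ℂ] B) = trace (T : A →L[ℂ] A)

/-- Quantum channels: completely positive trace-preserving superoperators. -/
def IsChannel (Φ : Superoperator A B) : Prop :=
  CompletelyPositive Φ ∧ TracePreserving Φ

end Superoperators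

section Composite

variable {A : Type u} [NormedAddCommGroup A] [InnerProductSpace ℂ A] [CompleteSpace A]
variable {B : Type v} [NormedAddCommGroup B] [InnerProductSpace ℂ B] [CompleteSpace B]
variable {R : Type w} [NormedAddCommGroup R] [InnerProductSpace ℂ R] [CompleteSpace R]

/-- The Hilbert space tensor product of `A` and `R`. -/
abbrev HilbertTensor (A : Type u) [NormedAddCommGroup A] [InnerProductSpace ℂ A]
    (R : Type w) [NormedAddCommGroup R] [InnerProductSpace ℂ R] : Type (max u w) :=
  UniformSpace.Completion (A ⊗[ℂ] R)

/-- The operator `I_A ⊗ |r⟩ : a ↦ a ⊗ r`. -/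
def tensorRight (A : Type u) [NormedAddCommGroup A] [InnerProductSpace ℂ A] (r : R) :
    A →L[ℂ] HilbertTensor A R :=
  UniformSpace.Completion.toComplL ∘L (TensorProduct.mkL ℂ A R).flip r

/-- The operator `|a⟩ ⊗ I_R : r ↦ a ⊗ r`. -/
def tensorLeft (R : Type w) [NormedAddCommGroup R] [InnerProductSpace ℂ R] (a : A) :
    R →L[ℂ] HilbertTensor A R :=
  UniformSpace.Completion.toComplL ∘L TensorProduct.mkL ℂ A R a

/-- The trace-class operator `(I_A ⊗ ⟨r|) T (I_A ⊗ |s⟩)` on `A`: the `(r, s)` entry of `T`. -/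
def entry (r s : R) (T : TraceClass (HilbertTensor A R)) : TraceClass A :=
  ⟨ContinuousLinearMap.adjoint (tensorRight A r) ∘L T.1 ∘L tensorRight A s,
    traceNorm_compression_lt_top T.2 (tensorRight A r) (tensorRight A s)⟩

/-- `σ = (Φ ⊗ id_R)(ρ)`. The map `Φ ⊗ id_R` acts on `ρ` entrywise, and a trace-class operator is
determined by its entries, so there is at most one such `σ`; on `ρ = X ⊗ Y` it is `Φ(X) ⊗ Y`. -/
def IsAmpliation (Φ : Superoperator A B) (ρ : TraceClass (HilbertTensor A R))
    (σ : TraceClass (HilbertTensor B R)) : Prop :=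
  ∀ r s : R, entry r s σ = Φ (entry r s ρ)

/-- `‖(Φ ⊗ id_R)(ρ)‖₁`, with the value `∞` if `(Φ ⊗ id_R)(ρ)` does not exist as a trace-class
operator (which can only happen if `Φ` is not completely bounded). -/
def ampliationNorm (Φ : Superoperator A B) (ρ : TraceClass (HilbertTensor A R)) : ℝ≥0∞ :=
  ⨅ (σ : TraceClass (HilbertTensor B R)) (_ : IsAmpliation Φ ρ σ),
    traceNorm (σ : HilbertTensor B R →L[ℂ] HilbertTensor B R)

/-- `ω = Tr_R ρ`, i.e. `⟨a, ω b⟩ = Tr (⟨a| ⊗ I_R) ρ (|b⟩ ⊗ I_R)` for all `a, b`. -/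
def IsPartialTrace (ρ : TraceClass (HilbertTensor A R)) (ω : TraceClass A) : Prop :=
  ∀ a b : A, ⟪a, (ω : A →L[ℂ] A) b⟫_ℂ =
    trace (ContinuousLinearMap.adjoint (tensorLeft R a) ∘L
      (ρ : HilbertTensor A R →L[ℂ] HilbertTensor A R) ∘L tensorLeft R b)

end Composite

section Energy

variable {A : Type u} [NormedAddCommGroup A] [InnerProductSpace ℂ A] [CompleteSpace A]

/-- A Hamiltonian: a densely defined positive self-adjoint operator, possibly unbounded. -/
structure IsHamiltonian (H : A →ₗ.[ℂ] A) : Prop where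
  dense_domain : Dense (H.domain : Set A)
  isSelfAdjoint : IsSelfAdjoint H
  nonneg : ∀ x : H.domain, 0 ≤ ⟪(x : A), H x⟫_ℂ

/-- The spectrum of `H`: those `z` for which `H - z` has no bounded everywhere defined inverse. -/
def unboundedSpectrum (H : A →ₗ.[ℂ] A) : Set ℂ :=
  {z | ¬ ∃ S : A →L[ℂ] A, (∀ y : A, (S y, y + z • S y) ∈ H.graph) ∧
      ∀ x : H.domain, S (H x - z • (x : A)) = x}

/-- The infimum of the (real) spectrum of `H`. -/
def groundEnergy (H : A →ₗ.[ℂ] A) : EReal :=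
  sInf {e : EReal | ∃ t : ℝ, (t : ℂ) ∈ unboundedSpectrum H ∧ e = (t : EReal)}

/-- `P` is the spectral projector of the positive self-adjoint operator `H` for the interval
`[0, t]`: the orthogonal projector that reduces `H`, with `H ≤ t` on its range and `H > t` on the
complement of its range. -/
structure IsSpectralProjector (H : A →ₗ.[ℂ] A) (t : ℝ) (P : A →L[ℂ] A) : Prop where
  isStarProjection : IsStarProjection P
  commutes : ∀ x y : A, (x, y) ∈ H.graph → (P x, P y) ∈ H.graph
  le_on_range : ∀ x : A, ∃ y : A, (P x, y) ∈ H.graph ∧ (⟪P x, y⟫_ℂ).re ≤ t * ‖P x‖ ^ 2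
  lt_off_range : ∀ x y : A, (x, y) ∈ H.graph → P x = 0 → x ≠ 0 →
    t * ‖x‖ ^ 2 < (⟪x, y⟫_ℂ).re

/-- The mean energy `Tr H ω = sup_n Tr (Pₙ H ω) ∈ [0, ∞]`, where `Pₙ` is the spectral projector of
`H` for `[0, n]`; here `K` is the bounded operator `H Pₙ`. -/
def energy (H : A →ₗ.[ℂ] A) (ω : A →L[ℂ] A) : ℝ≥0∞ :=
  ⨆ (n : ℕ) (P : A →L[ℂ] A) (K : A →L[ℂ] A) (_ : IsSpectralProjector H n P)
    (_ : ∀ x, (P x, K x) ∈ H.graph), ENNReal.ofReal (trace (K ∘L ω)).re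

/-- `H` has discrete spectrum of finite multiplicity tending to `+∞`: there is an orthonormal basis
of eigenvectors whose eigenvalues, listed with multiplicity, tend to `+∞`. -/
def HasDiscreteSpectrum (H : A →ₗ.[ℂ] A) : Prop :=
  ∃ (τ : HilbertBasis ℕ ℂ A) (e : ℕ → ℝ),
    (∀ k, (τ k, (e k : ℂ) • τ k) ∈ H.graph) ∧ Filter.Tendsto e Filter.atTop Filter.atTop

end Energy

section Norms

variable {A : Type u} [NormedAddCommGroup A] [InnerProductSpace ℂ A] [CompleteSpace A]
variable {B : Type v} [NormedAddCommGroup B] [InnerProductSpace ℂ B] [CompleteSpace B]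

/-- The diamond norm, with reference system `R`. -/
def diamondNorm (R : Type w) [NormedAddCommGroup R] [InnerProductSpace ℂ R] [CompleteSpace R]
    (Φ : Superoperator A B) : ℝ≥0∞ :=
  ⨆ (ρ : TraceClass (HilbertTensor A R)) (_ : IsState ρ), ampliationNorm Φ ρ

/-- The energy-constrained diamond norm: the supremum of `‖(Φ ⊗ id_R)(ρ)‖₁` over the states `ρ` of
`AR` with `Tr H ρ_A ≤ E`. -/
def ecdNorm (R : Type w) [NormedAddCommGroup R] [InnerProductSpace ℂ R] [CompleteSpace R]
    (H : A →ₗ.[ℂ] A) (E : ℝ) (Φ : Superoperator A B) : ℝ≥0∞ :=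
  ⨆ (ρ : TraceClass (HilbertTensor A R)) (_ : IsState ρ)
    (_ : ∃ ω : TraceClass A, IsPartialTrace ρ ω ∧ energy H ω ≤ ENNReal.ofReal E),
    ampliationNorm Φ ρ

/-- Strong convergence: `Φ n (ρ) → Φ₀(ρ)` in trace norm for every state `ρ`. -/
def StrongConvergence (Φ : ℕ → Superoperator A B) (Φ₀ : Superoperator A B) : Prop :=
  ∀ ρ : TraceClass A, IsState ρ →
    Filter.Tendsto (fun n => traceNorm ((Φ n ρ - Φ₀ ρ : TraceClass B) : B →L[ℂ] B))
      Filter.atTop (nhds 0)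

/-- Convergence in the energy-constrained diamond norm. -/
def EcdConvergence (R : Type w) [NormedAddCommGroup R] [InnerProductSpace ℂ R] [CompleteSpace R]
    (H : A →ₗ.[ℂ] A) (E : ℝ) (Φ : ℕ → Superoperator A B) (Φ₀ : Superoperator A B) : Prop :=
  Filter.Tendsto (fun n => ecdNorm R H E (Φ n - Φ₀)) Filter.atTop (nhds 0)

/-- The strong convergence topology, defined by the seminorms `Φ ↦ ‖Φ(ρ)‖₁`, `ρ` a state. -/
abbrev strongTopology (A : Type u) [NormedAddCommGroup A] [InnerProductSpace ℂ A] [CompleteSpace A]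
    (B : Type v) [NormedAddCommGroup B] [InnerProductSpace ℂ B] [CompleteSpace B] :
    TopologicalSpace (Superoperator A B) :=
  TopologicalSpace.generateFrom
    {U | ∃ (ρ : TraceClass A) (Φ₀ : Superoperator A B) (ε : ℝ≥0∞), IsState ρ ∧ 0 < ε ∧
      U = {Φ | traceNorm ((Φ ρ - Φ₀ ρ : TraceClass B) : B →L[ℂ] B) < ε}}

/-- The topology generated by the energy-constrained diamond norm (by its open balls). -/
abbrev ecdTopology (B : Type v) [NormedAddCommGroup B] [InnerProductSpace ℂ B] [CompleteSpace B]
    (R : Type w) [NormedAddCommGroup R] [InnerProductSpace ℂ R] [CompleteSpace R]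
    (H : A →ₗ.[ℂ] A) (E : ℝ) : TopologicalSpace (Superoperator A B) :=
  TopologicalSpace.generateFrom
    {U | ∃ (Φ₀ : Superoperator A B) (ε : ℝ≥0∞), 0 < ε ∧ U = {Φ | ecdNorm R H E (Φ - Φ₀) < ε}}

/-- The strong convergence topology and the topology of the energy-constrained diamond norm induce
the same topology on the set `𝓢` of superoperators. -/
def SameTopologyOn (R : Type w) [NormedAddCommGroup R] [InnerProductSpace ℂ R] [CompleteSpace R]
    (H : A →ₗ.[ℂ] A) (E : ℝ) (𝓢 : Set (Superoperator A B)) : Prop :=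
  TopologicalSpace.induced ((↑) : 𝓢 → Superoperator A B) (ecdTopology B R H E) =
    TopologicalSpace.induced ((↑) : 𝓢 → Superoperator A B) (strongTopology A B)

end Norms

end ECD

end

/-!
Let `x₀` be a unit vector of the domain of `H` of energy below `E`. For any `x` in the domain, the
mixture of `|x₀⟩⟨x₀|` with a small multiple of `|x⟩⟨x|` still obeys the energy constraint, so both
`‖Φ(|x₀⟩⟨x₀|)‖₁` and `‖Φ(|x⟩⟨x|)‖₁` are controlled by the energy-constrained norm of `Φ`. Along a
filter of uniformly bounded maps, the operators `T` with `‖Φ(T)‖₁ → 0` form a closed subspace of the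
trace class, which by density of the domain contains every `|z⟩⟨z|` and hence is everything. This
gives definiteness and the first implication.

If `H` is diagonal in a basis `τ` with eigenvalues tending to infinity, a state on `A ⊗ R` of energy
at most `E` is within `O(√(E / N))` in trace norm of its compression to the eigenvectors below `N`.
That compression is a finite sum of matrix units `|τ k⟩⟨τ l|` tensored with operators of trace norm
at most one, so the energy-constrained norm of `Φ` is at most the finite sum of the
`‖Φ(|τ k⟩⟨τ l|)‖₁` plus `O(√(E / N))` times the diamond norm. Both comparisons hold along filters of
superoperators, not only along sequences, hence they compare the topologies as well.

A channel has diamond norm at most one because, by complete positivity, `(Φ ⊗ id)(ρ)` is a positive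
operator for `ρ ≥ 0`, and its trace norm is its trace, which is that of `ρ`.
-/

noncomputable section

namespace ECD

open Filter Topology
open scoped InnerProduct
open ContinuousLinearMap (adjoint_inner_left adjoint_inner_right adjoint_comp adjoint_adjoint
  comp_apply comp_assoc opENorm_comp_le le_opENorm)
open InnerProductSpace (rankOne rankOne_apply)

section ExtSeminorm

variable {V W : Type*} [AddCommGroup V] [Module ℂ V] [AddCommGroup W] [Module ℂ W]

/-- An extended seminorm: a subadditive and absolutely homogeneous functional with values in
`[0, ∞]`. Homogeneity is only required as an inequality, see `IsExtSeminorm.map_smul`. -/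
structure IsExtSeminorm (p : V → ℝ≥0∞) : Prop where
  add_le : ∀ x y, p (x + y) ≤ p x + p y
  smul_le : ∀ (c : ℂ) (x : V), p (c • x) ≤ ‖c‖ₑ * p x

namespace IsExtSeminorm

variable {p : V → ℝ≥0∞}

theorem map_zero (hp : IsExtSeminorm p) : p 0 = 0 :=
  nonpos_iff_eq_zero.1 (by simpa using hp.smul_le 0 0)

theorem map_smul (hp : IsExtSeminorm p) (c : ℂ) (x : V) : p (c • x) = ‖c‖ₑ * p x := by
  rcases eq_or_ne c 0 with rfl | hc
  · rw [zero_smul, hp.map_zero, enorm_zero, zero_mul]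
  refine le_antisymm (hp.smul_le c x) ?_
  calc ‖c‖ₑ * p x = ‖c‖ₑ * p (c⁻¹ • c • x) := by rw [inv_smul_smul₀ hc]
    _ ≤ ‖c‖ₑ * (‖c⁻¹‖ₑ * p (c • x)) := by gcongr; exact hp.smul_le _ _
    _ = p (c • x) := by rw [← mul_assoc, ← enorm_mul, mul_inv_cancel₀ hc, enorm_one, one_mul]

theorem map_neg (hp : IsExtSeminorm p) (x : V) : p (-x) = p x := by
  rw [← neg_one_smul ℂ, hp.map_smul, enorm_neg, enorm_one, one_mul]

theorem sub_le (hp : IsExtSeminorm p) (x y : V) : p (x - y) ≤ p x + p y := by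
  rw [sub_eq_add_neg, ← hp.map_neg y]
  exact hp.add_le _ _

theorem sum_le (hp : IsExtSeminorm p) {ι : Type*} (s : Finset ι) (x : ι → V) :
    p (∑ i ∈ s, x i) ≤ ∑ i ∈ s, p (x i) :=
  Finset.le_sum_of_subadditive p hp.map_zero.le hp.add_le s x

theorem comp (hp : IsExtSeminorm p) (f : W →ₗ[ℂ] V) : IsExtSeminorm (fun x => p (f x)) where
  add_le x y := by rw [_root_.map_add]; exact hp.add_le _ _
  smul_le c x := by rw [_root_.map_smul]; exact hp.smul_le _ _

theorem iSup {ι : Sort*} {q : ι → V → ℝ≥0∞} (hq : ∀ i, IsExtSeminorm (q i)) :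
    IsExtSeminorm (fun x => ⨆ i, q i x) where
  add_le x y := iSup_le fun i => ((hq i).add_le x y).trans
    (add_le_add (le_iSup (q · x) i) (le_iSup (q · y) i))
  smul_le c x := iSup_le fun i => ((hq i).smul_le c x).trans (by gcongr; exact le_iSup (q · x) i)

theorem iInf_of_linear_relation (hp : IsExtSeminorm p) {r : W → V → Prop}
    (hr_zero : r 0 0)
    (hr_add : ∀ {x x' v v'}, r x v → r x' v' → r (x + x') (v + v'))
    (hr_smul : ∀ (c : ℂ) {x v}, r x v → r (c • x) (c • v)) :
    IsExtSeminorm (fun x => ⨅ (v : V) (_ : r x v), p v) where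
  add_le x y := by
    simp only [ENNReal.iInf_add, ENNReal.add_iInf]
    exact le_iInf₂ fun v hv => le_iInf₂ fun w hw => iInf₂_le_of_le _ (hr_add hw hv) (hp.add_le _ _)
  smul_le c x := by
    rcases eq_or_ne c 0 with rfl | hc
    · rw [zero_smul, enorm_zero, zero_mul]
      exact iInf₂_le_of_le 0 hr_zero hp.map_zero.le
    · simp only [ENNReal.mul_iInf_of_ne (enorm_ne_zero.2 hc) enorm_ne_top]
      exact le_iInf₂ fun v hv => iInf₂_le_of_le _ (hr_smul c hv) (hp.smul_le _ _)

end IsExtSeminorm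

end ExtSeminorm

section HilbertSchmidt

variable {H K G : Type*} [NormedAddCommGroup H] [InnerProductSpace ℂ H]
  [NormedAddCommGroup K] [InnerProductSpace ℂ K] [NormedAddCommGroup G] [InnerProductSpace ℂ G]

theorem ofReal_re_inner_self (x : H) : ENNReal.ofReal (⟪x, x⟫_ℂ).re = ‖x‖ₑ ^ 2 := by
  rw [← ofReal_norm, ← ENNReal.ofReal_pow (norm_nonneg x)]
  exact congrArg ENNReal.ofReal (inner_self_eq_norm_sq (𝕜 := ℂ) x)

theorem tsum_enorm_inner_sq_le {ι : Type*} (x y : ι → H) :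
    (∑' i, ‖⟪x i, y i⟫_ℂ‖ₑ) ^ 2 ≤ (∑' i, ‖x i‖ₑ ^ 2) * ∑' i, ‖y i‖ₑ ^ 2 := by
  have finset_le (s : Finset ι) : (∑ i ∈ s, ‖⟪x i, y i⟫_ℂ‖ₑ) ^ 2 ≤
      (∑' i, ‖x i‖ₑ ^ 2) * ∑' i, ‖y i‖ₑ ^ 2 := by
    have cauchy_schwarz :
        (∑ i ∈ s, ‖⟪x i, y i⟫_ℂ‖₊) ^ 2 ≤ (∑ i ∈ s, ‖x i‖₊ ^ 2) * ∑ i ∈ s, ‖y i‖₊ ^ 2 := by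
      refine le_trans ?_ (Finset.sum_mul_sq_le_sq_mul_sq s _ _)
      gcongr with i
      exact nnnorm_inner_le_nnnorm _ _
    calc (∑ i ∈ s, ‖⟪x i, y i⟫_ℂ‖ₑ) ^ 2
        ≤ (∑ i ∈ s, ‖x i‖ₑ ^ 2) * ∑ i ∈ s, ‖y i‖ₑ ^ 2 := by
          simp only [enorm_eq_nnnorm]
          exact_mod_cast cauchy_schwarz
      _ ≤ (∑' i, ‖x i‖ₑ ^ 2) * ∑' i, ‖y i‖ₑ ^ 2 := by gcongr <;> exact ENNReal.sum_le_tsum s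
  exact le_of_tendsto' (((ENNReal.continuous_pow 2).tendsto _).comp ENNReal.summable.hasSum)
    finset_le

variable [CompleteSpace H]

/-- The squared Hilbert–Schmidt norm `‖S‖₂² ∈ [0, ∞]`. -/
def hsNormSq (S : H →L[ℂ] K) : ℝ≥0∞ := ∑' i, ‖S (stdBasis H i)‖ₑ ^ 2

theorem hsNormSq_rankOne (x : K) (y : H) : hsNormSq (rankOne ℂ x y) = ‖x‖ₑ ^ 2 * ‖y‖ₑ ^ 2 := by
  rw [hsNormSq, ← tsum_enorm_sq_inner (stdBasis H) y, ← ENNReal.tsum_mul_left]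
  congr 1
  funext i
  rw [rankOne_apply, enorm_smul, mul_pow, mul_comm, ← inner_conj_symm, RCLike.enorm_conj]

variable [CompleteSpace K] [CompleteSpace G]

theorem enorm_adjoint (S : H →L[ℂ] K) : ‖S†‖ₑ = ‖S‖ₑ :=
  ContinuousLinearMap.adjoint.enorm_map S

theorem hsNormSq_eq_tsum {ι : Type*} (b : HilbertBasis ι ℂ H) (S : H →L[ℂ] K) :
    hsNormSq S = ∑' i, ‖S (b i)‖ₑ ^ 2 := by
  rw [hsNormSq, tsum_enorm_sq_adjoint (stdBasis H) (stdBasis K) S,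
    tsum_enorm_sq_adjoint b (stdBasis K) S]

theorem hsNormSq_adjoint (S : H →L[ℂ] K) : hsNormSq (S†) = hsNormSq S :=
  (tsum_enorm_sq_adjoint (stdBasis H) (stdBasis K) S).symm

theorem hsNormSq_comp_le (S : K →L[ℂ] G) (X : H →L[ℂ] K) :
    hsNormSq (S ∘L X) ≤ ‖X‖ₑ ^ 2 * hsNormSq S := by
  rw [← hsNormSq_adjoint, ← hsNormSq_adjoint S, adjoint_comp, ← enorm_adjoint X, hsNormSq, hsNormSq,
    ← ENNReal.tsum_mul_left]
  refine ENNReal.tsum_le_tsum fun i => ?_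
  rw [← mul_pow]
  gcongr
  exact le_opENorm _ _

theorem hsNormSq_comp_le_of_enorm_le_one (S : K →L[ℂ] G) {X : H →L[ℂ] K} (hX : ‖X‖ₑ ≤ 1) :
    hsNormSq (S ∘L X) ≤ hsNormSq S :=
  (hsNormSq_comp_le S X).trans (mul_le_of_le_one_left' (pow_le_one' hX 2))

end HilbertSchmidt

section TraceNorm

variable {H K : Type*} [NormedAddCommGroup H] [InnerProductSpace ℂ H] [CompleteSpace H]
  [NormedAddCommGroup K] [InnerProductSpace ℂ K] [CompleteSpace K]

theorem exists_contraction_polar (T : H →L[ℂ] H) :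
    ∃ U : H →L[ℂ] H, ‖U‖ₑ ≤ 1 ∧ U ∘L CFC.abs T = T ∧ U† ∘L T = CFC.abs T := by
  obtain ⟨U, hU, hU'⟩ := exists_polar T
  -- `U` is isometric on the closed range of `|T|`; precompose it with the projector onto that.
  let M : Submodule ℂ H := (CFC.abs T).range.topologicalClosure
  have : CompleteSpace M := (Submodule.isClosed_topologicalClosure _).completeSpace_coe
  have projector_abs (x : H) : M.starProjection (CFC.abs T x) = CFC.abs T x :=
    Submodule.starProjection_eq_self_iff.2 (Submodule.le_topologicalClosure _ ⟨x, rfl⟩)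
  have norm_apply : ∀ x ∈ M, ‖U x‖ = ‖x‖ := by
    refine closure_minimal (t := {x | ‖U x‖ = ‖x‖}) ?_ (isClosed_eq (by fun_prop) (by fun_prop))
    rintro _ ⟨y, rfl⟩
    change ‖(U ∘L CFC.abs T) y‖ = ‖CFC.abs T y‖
    rw [hU, norm_abs_apply]
  refine ⟨U ∘L M.starProjection, ContinuousLinearMap.opENorm_le_bound _ fun x => ?_, ?_, ?_⟩
  · rw [one_mul, enorm_le_iff_norm_le, comp_apply, norm_apply _ (M.starProjection_apply_mem x)]
    exact M.norm_starProjection_apply_le x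
  · ext x
    rw [comp_assoc, comp_apply, comp_apply, projector_abs, ← comp_apply, hU]
  · ext x
    rw [adjoint_comp, ← ContinuousLinearMap.star_eq_adjoint M.starProjection,
      isSelfAdjoint_starProjection, comp_assoc, hU']
    exact projector_abs x

theorem traceNorm_eq_hsNormSq_sqrt_abs (T : H →L[ℂ] H) :
    traceNorm T = hsNormSq (CFC.sqrt (CFC.abs T)) := by
  simp only [traceNorm, hsNormSq, ofReal_inner_abs]

theorem adjoint_sqrt (T : H →L[ℂ] H) : (CFC.sqrt T)† = CFC.sqrt T :=
  (CFC.sqrt_nonneg T).isSelfAdjoint.star_eq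

theorem exists_hsNormSq_le_traceNorm (T : H →L[ℂ] H) :
    ∃ S₁ S₂ : H →L[ℂ] H, T = S₁† ∘L S₂ ∧ hsNormSq S₁ ≤ traceNorm T ∧ hsNormSq S₂ ≤ traceNorm T := by
  obtain ⟨U, hU, hUT, -⟩ := exists_contraction_polar T
  rw [traceNorm_eq_hsNormSq_sqrt_abs]
  refine ⟨CFC.sqrt (CFC.abs T) ∘L U†, CFC.sqrt (CFC.abs T), ?_,
    hsNormSq_comp_le_of_enorm_le_one _ ((enorm_adjoint U).trans_le hU), le_rfl⟩
  rw [adjoint_comp, adjoint_adjoint, adjoint_sqrt, comp_assoc,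
    ← ContinuousLinearMap.mul_def (CFC.sqrt _), CFC.sqrt_mul_sqrt_self _ (CFC.abs_nonneg T), hUT]

theorem tsum_enorm_inner_le_traceNorm {ι : Type*} (b : HilbertBasis ι ℂ K) (T : H →L[ℂ] H)
    (X Y : K →L[ℂ] H) :
    ∑' i, ‖⟪X (b i), T (Y (b i))⟫_ℂ‖ₑ ≤ ‖X‖ₑ * ‖Y‖ₑ * traceNorm T := by
  obtain ⟨S₁, S₂, hT, h₁, h₂⟩ := exists_hsNormSq_le_traceNorm T
  refine (ENNReal.pow_le_pow_left_iff two_ne_zero).1 ?_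
  calc (∑' i, ‖⟪X (b i), T (Y (b i))⟫_ℂ‖ₑ) ^ 2
      = (∑' i, ‖⟪(S₁ ∘L X) (b i), (S₂ ∘L Y) (b i)⟫_ℂ‖ₑ) ^ 2 := by
        simp only [hT, comp_apply, adjoint_inner_right]
    _ ≤ hsNormSq (S₁ ∘L X) * hsNormSq (S₂ ∘L Y) := by
        rw [hsNormSq_eq_tsum b, hsNormSq_eq_tsum b]
        exact tsum_enorm_inner_sq_le _ _
    _ ≤ (‖X‖ₑ ^ 2 * traceNorm T) * (‖Y‖ₑ ^ 2 * traceNorm T) := by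
        gcongr <;> exact (hsNormSq_comp_le _ _).trans (by gcongr)
    _ = (‖X‖ₑ * ‖Y‖ₑ * traceNorm T) ^ 2 := by ring

theorem traceNorm_le_of_forall_contraction {T : H →L[ℂ] H} {c : ℝ≥0∞}
    (h : ∀ U : H →L[ℂ] H, ‖U‖ₑ ≤ 1 → ∑' i, ‖⟪U (stdBasis H i), T (stdBasis H i)⟫_ℂ‖ₑ ≤ c) :
    traceNorm T ≤ c := by
  obtain ⟨U, hU, -, hUT⟩ := exists_contraction_polar T
  refine le_trans (ENNReal.tsum_le_tsum fun i => (ofReal_re_le_enorm _).trans_eq ?_) (h U hU)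
  rw [← hUT, comp_apply, adjoint_inner_right]

theorem tsum_enorm_inner_contraction_le (T : H →L[ℂ] H) {U : H →L[ℂ] H} (hU : ‖U‖ₑ ≤ 1) :
    ∑' i, ‖⟪U (stdBasis H i), T (stdBasis H i)⟫_ℂ‖ₑ ≤ traceNorm T := by
  have enorm_id_le : ‖ContinuousLinearMap.id ℂ H‖ₑ ≤ 1 :=
    ContinuousLinearMap.opENorm_le_bound _ fun x => by simp
  exact (tsum_enorm_inner_le_traceNorm (stdBasis H) T U (ContinuousLinearMap.id ℂ H)).trans
    (mul_le_of_le_one_left' (mul_le_one' hU enorm_id_le))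

theorem traceNorm_adjoint_comp_sq_le (S T : H →L[ℂ] K) :
    traceNorm (S† ∘L T) ^ 2 ≤ hsNormSq S * hsNormSq T := by
  obtain ⟨U, hU, -, hUT⟩ := exists_contraction_polar (S† ∘L T)
  have traceNorm_le :
      traceNorm (S† ∘L T) ≤ ∑' i, ‖⟪(S ∘L U) (stdBasis H i), T (stdBasis H i)⟫_ℂ‖ₑ := by
    refine ENNReal.tsum_le_tsum fun i => (ofReal_re_le_enorm _).trans_eq ?_
    simp only [← hUT, comp_apply, adjoint_inner_right]
  calc traceNorm (S† ∘L T) ^ 2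
      ≤ (∑' i, ‖⟪(S ∘L U) (stdBasis H i), T (stdBasis H i)⟫_ℂ‖ₑ) ^ 2 := by gcongr
    _ ≤ hsNormSq (S ∘L U) * hsNormSq T := tsum_enorm_inner_sq_le _ _
    _ ≤ hsNormSq S * hsNormSq T := by
        gcongr
        exact hsNormSq_comp_le_of_enorm_le_one S hU

theorem traceNorm_adjoint_comp_comp_le (T : H →L[ℂ] H) (V W : K →L[ℂ] H) :
    traceNorm (V† ∘L T ∘L W) ≤ ‖V‖ₑ * ‖W‖ₑ * traceNorm T := by
  refine traceNorm_le_of_forall_contraction fun U hU => ?_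
  calc ∑' i, ‖⟪U (stdBasis K i), (V† ∘L T ∘L W) (stdBasis K i)⟫_ℂ‖ₑ
      = ∑' i, ‖⟪(V ∘L U) (stdBasis K i), T (W (stdBasis K i))⟫_ℂ‖ₑ := by
        simp only [comp_apply, adjoint_inner_right]
    _ ≤ ‖V ∘L U‖ₑ * ‖W‖ₑ * traceNorm T := tsum_enorm_inner_le_traceNorm _ _ _ _
    _ ≤ ‖V‖ₑ * ‖W‖ₑ * traceNorm T := by
        gcongr
        exact (opENorm_comp_le _ _).trans (mul_le_of_le_one_right' hU)

theorem traceNorm_add_le (S T : H →L[ℂ] H) : traceNorm (S + T) ≤ traceNorm S + traceNorm T := by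
  refine traceNorm_le_of_forall_contraction fun U hU => le_trans ?_
    (add_le_add (tsum_enorm_inner_contraction_le S hU) (tsum_enorm_inner_contraction_le T hU))
  rw [← ENNReal.tsum_add]
  refine ENNReal.tsum_le_tsum fun i => ?_
  rw [_root_.add_apply, inner_add_right]
  exact enorm_add_le _ _

theorem traceNorm_smul_le (c : ℂ) (T : H →L[ℂ] H) : traceNorm (c • T) ≤ ‖c‖ₑ * traceNorm T := by
  refine traceNorm_le_of_forall_contraction fun U hU => le_trans ?_
    (mul_le_mul_right (tsum_enorm_inner_contraction_le T hU) _)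
  rw [← ENNReal.tsum_mul_left]
  refine ENNReal.tsum_le_tsum fun i => ?_
  rw [_root_.smul_apply, inner_smul_right, enorm_mul]

theorem isExtSeminorm_traceNorm : IsExtSeminorm (traceNorm (H := H)) :=
  ⟨traceNorm_add_le, traceNorm_smul_le⟩

theorem enorm_inner_le_traceNorm (T : H →L[ℂ] H) (x y : H) :
    ‖⟪x, T y⟫_ℂ‖ₑ ≤ ‖x‖ₑ * ‖y‖ₑ * traceNorm T := by
  have enorm_span (z : H) : ‖ContinuousLinearMap.toSpanSingleton ℂ z‖ₑ = ‖z‖ₑ := by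
    simp only [enorm_eq_nnnorm, ContinuousLinearMap.nnnorm_toSpanSingleton]
  calc ‖⟪x, T y⟫_ℂ‖ₑ = ∑' i, ‖⟪stdBasis ℂ i, 1⟫_ℂ‖ₑ ^ 2 * ‖⟪x, T y⟫_ℂ‖ₑ := by
        rw [ENNReal.tsum_mul_right, tsum_enorm_sq_inner, enorm_one, one_pow, one_mul]
    _ = ∑' i, ‖⟪ContinuousLinearMap.toSpanSingleton ℂ x (stdBasis ℂ i),
          T (ContinuousLinearMap.toSpanSingleton ℂ y (stdBasis ℂ i))⟫_ℂ‖ₑ := by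
        congr 1
        funext i
        simp only [ContinuousLinearMap.toSpanSingleton_apply, map_smul, inner_smul_left,
          inner_smul_right, enorm_mul, RCLike.enorm_conj, RCLike.inner_apply, one_mul]
        ring
    _ ≤ ‖x‖ₑ * ‖y‖ₑ * traceNorm T := by
        rw [← enorm_span x, ← enorm_span y]
        exact tsum_enorm_inner_le_traceNorm _ _ _ _

theorem eq_zero_of_traceNorm_eq_zero {T : H →L[ℂ] H} (hT : traceNorm T = 0) : T = 0 := by
  ext x
  have h := enorm_inner_le_traceNorm T (T x) x
  rw [hT, mul_zero, nonpos_iff_eq_zero, enorm_eq_zero] at h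
  exact inner_self_eq_zero.1 h

theorem traceNorm_adjoint_comp_self (S : H →L[ℂ] K) : traceNorm (S† ∘L S) = hsNormSq S := by
  have nonneg : 0 ≤ S† ∘L S := (ContinuousLinearMap.nonneg_iff_isPositive _).2
    (ContinuousLinearMap.isPositive_adjoint_comp_self S)
  simp only [traceNorm, CFC.abs_of_nonneg _ nonneg, hsNormSq, comp_apply, adjoint_inner_right,
    ofReal_re_inner_self]

theorem exists_isSelfAdjoint_comp_self {T : H →L[ℂ] H} (hT : T.IsPositive) :
    ∃ S : H →L[ℂ] H, S† = S ∧ S ∘L S = T :=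
  ⟨CFC.sqrt T, adjoint_sqrt T, CFC.sqrt_mul_sqrt_self T
    ((ContinuousLinearMap.nonneg_iff_isPositive _).2 hT)⟩

theorem traceNorm_of_isPositive {T : H →L[ℂ] H} (hT : T.IsPositive) {ι : Type*}
    (b : HilbertBasis ι ℂ H) : traceNorm T = ∑' i, ENNReal.ofReal (⟪b i, T (b i)⟫_ℂ).re := by
  obtain ⟨S, hS, rfl⟩ := exists_isSelfAdjoint_comp_self hT
  have inner_eq (x : H) : ⟪x, (S ∘L S) x⟫_ℂ = ⟪S x, S x⟫_ℂ := by
    rw [comp_apply, ← adjoint_inner_left, hS]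
  simp only [inner_eq, ofReal_re_inner_self]
  rw [← hsNormSq_eq_tsum b, ← traceNorm_adjoint_comp_self, hS]

theorem traceNorm_rankOne_le (x y : H) : traceNorm (rankOne ℂ x y) ≤ ‖x‖ₑ * ‖y‖ₑ := by
  rcases eq_or_ne x 0 with rfl | hx
  · simp [traceNorm_zero]
  let e : H := (‖x‖⁻¹ : ℂ) • x
  have norm_e : ‖e‖ = 1 := norm_smul_inv_norm hx
  have enorm_e : ‖e‖ₑ = 1 := by rw [← ofReal_norm, norm_e, ENNReal.ofReal_one]
  have factorization : rankOne ℂ x y = (rankOne ℂ e x)† ∘L rankOne ℂ e y := by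
    rw [InnerProductSpace.adjoint_rankOne, InnerProductSpace.rankOne_comp_rankOne,
      inner_self_eq_one_of_norm_eq_one norm_e, one_smul]
  refine (ENNReal.pow_le_pow_left_iff two_ne_zero).1 ?_
  rw [factorization]
  refine (traceNorm_adjoint_comp_sq_le _ _).trans_eq ?_
  rw [hsNormSq_rankOne, hsNormSq_rankOne, enorm_e]
  ring

theorem hasSum_trace {T : H →L[ℂ] H} (hT : traceNorm T < ⊤) :
    HasSum (fun i => ⟪stdBasis H i, T (stdBasis H i)⟫_ℂ) (trace T) :=
  (Summable.of_enorm (tsum_enorm_inner_lt_top (stdBasis H) hT (ContinuousLinearMap.id ℂ H)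
    (ContinuousLinearMap.id ℂ H)).ne).hasSum

theorem trace_add {S T : H →L[ℂ] H} (hS : traceNorm S < ⊤) (hT : traceNorm T < ⊤) :
    trace (S + T) = trace S + trace T := by
  rw [← ((hasSum_trace hS).add (hasSum_trace hT)).tsum_eq]
  simp only [trace, _root_.add_apply, inner_add_right]

theorem trace_smul (c : ℂ) (T : H →L[ℂ] H) : trace (c • T) = c * trace T := by
  simp [trace, tsum_mul_left]

theorem trace_of_isPositive {T : H →L[ℂ] H} (hT : T.IsPositive) :
    trace T = ((traceNorm T).toReal : ℂ) := by
  have inner_eq_re (i) : ⟪stdBasis H i, T (stdBasis H i)⟫_ℂ =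
      ((⟪stdBasis H i, T (stdBasis H i)⟫_ℂ).re : ℂ) :=
    Complex.eq_re_of_ofReal_le (r := 0) (by simpa using hT.inner_nonneg_right (stdBasis H i))
  have re_nonneg (i) : 0 ≤ (⟪stdBasis H i, T (stdBasis H i)⟫_ℂ).re :=
    hT.re_inner_nonneg_right (stdBasis H i)
  rw [traceNorm_of_isPositive hT (stdBasis H), ENNReal.tsum_toReal_eq (fun i => by simp), trace,
    Complex.ofReal_tsum]
  refine tsum_congr fun i => ?_
  rw [ENNReal.toReal_ofReal (re_nonneg i), ← inner_eq_re]

theorem trace_rankOne (x y : H) : trace (rankOne ℂ x y) = ⟪y, x⟫_ℂ := by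
  rw [trace, ← ((stdBasis H).hasSum_inner_mul_inner y x).tsum_eq]
  simp

end TraceNorm

section TraceClass

variable {H K : Type*} [NormedAddCommGroup H] [InnerProductSpace ℂ H] [CompleteSpace H]
  [NormedAddCommGroup K] [InnerProductSpace ℂ K] [CompleteSpace K]

/-- The compression `T ↦ V† T W` of trace-class operators. -/
def TraceClass.compression (V W : K →L[ℂ] H) : TraceClass H →ₗ[ℂ] TraceClass K where
  toFun T := ⟨V† ∘L T.1 ∘L W, traceNorm_compression_lt_top T.2 V W⟩
  map_add' S T := Subtype.ext (by
    simp only [Submodule.coe_add, ContinuousLinearMap.add_comp, ContinuousLinearMap.comp_add])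
  map_smul' c T := Subtype.ext (by
    simp only [Submodule.coe_smul, ContinuousLinearMap.smul_comp, ContinuousLinearMap.comp_smul,
      RingHom.id_apply])

/-- The rank-one operator `|x⟩⟨y|` as a trace-class operator. -/
def TraceClass.rankOne (x y : H) : TraceClass H :=
  ⟨InnerProductSpace.rankOne ℂ x y,
    (traceNorm_rankOne_le x y).trans_lt (ENNReal.mul_lt_top enorm_lt_top enorm_lt_top)⟩

end TraceClass

section Tensor

variable {A B R Q : Type*} [NormedAddCommGroup A] [InnerProductSpace ℂ A]
  [NormedAddCommGroup B] [InnerProductSpace ℂ B] [NormedAddCommGroup R] [InnerProductSpace ℂ R]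
  [NormedAddCommGroup Q] [InnerProductSpace ℂ Q]

/-- The simple tensor `a ⊗ r` in the Hilbert space tensor product. -/
def simple (a : A) (r : R) : HilbertTensor A R := ((a ⊗ₜ[ℂ] r : A ⊗[ℂ] R) : HilbertTensor A R)

theorem tensorRight_apply (a : A) (r : R) : tensorRight A r a = simple a r := rfl

theorem tensorLeft_apply (a : A) (r : R) : tensorLeft R a r = simple a r := rfl

theorem inner_simple (a b : A) (r s : R) :
    ⟪simple a r, simple b s⟫_ℂ = ⟪a, b⟫_ℂ * ⟪r, s⟫_ℂ := by
  rw [simple, simple, UniformSpace.Completion.inner_coe, TensorProduct.inner_tmul]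

theorem enorm_simple (a : A) (r : R) : ‖simple a r‖ₑ = ‖a‖ₑ * ‖r‖ₑ := by
  rw [simple, UniformSpace.Completion.enorm_coe, TensorProduct.enorm_tmul]

theorem enorm_tensorRight_le (r : R) : ‖tensorRight A r‖ₑ ≤ ‖r‖ₑ :=
  ContinuousLinearMap.opENorm_le_bound _ fun a => by
    rw [tensorRight_apply, enorm_simple, mul_comm]

theorem enorm_tensorLeft_le (a : A) : ‖tensorLeft R a‖ₑ ≤ ‖a‖ₑ :=
  ContinuousLinearMap.opENorm_le_bound _ fun r => by rw [tensorLeft_apply, enorm_simple]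

theorem ext_simple {X : Type*} [NormedAddCommGroup X] [NormedSpace ℂ X]
    {S T : HilbertTensor A R →L[ℂ] X} (h : ∀ a r, S (simple a r) = T (simple a r)) : S = T := by
  have algebraic : (S ∘L (UniformSpace.Completion.toComplL : (A ⊗[ℂ] R) →L[ℂ] _)).toLinearMap =
      (T ∘L (UniformSpace.Completion.toComplL : (A ⊗[ℂ] R) →L[ℂ] _)).toLinearMap :=
    TensorProduct.ext' h
  ext x
  exact UniformSpace.Completion.induction_on x (isClosed_eq (by fun_prop) (by fun_prop))
    (LinearMap.congr_fun algebraic)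

theorem eq_of_forall_inner_simple {v w : HilbertTensor A R}
    (h : ∀ a r, ⟪simple a r, v⟫_ℂ = ⟪simple a r, w⟫_ℂ) : v = w := by
  have functional_eq : innerSL ℂ v = innerSL ℂ w := ext_simple fun a r => by
    rw [innerSL_apply_apply, innerSL_apply_apply, ← inner_conj_symm, h, inner_conj_symm]
  exact ext_inner_right ℂ fun u => DFunLike.congr_fun functional_eq u

theorem ext_inner_simple {S T : HilbertTensor A R →L[ℂ] HilbertTensor B Q}
    (h : ∀ a r b s, ⟪simple b s, S (simple a r)⟫_ℂ = ⟪simple b s, T (simple a r)⟫_ℂ) : S = T :=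
  ext_simple fun a r => eq_of_forall_inner_simple (h a r)

/-- The bounded operator `X ⊗ Y`. -/
def opTensor (X : A →L[ℂ] B) (Y : R →L[ℂ] Q) : HilbertTensor A R →L[ℂ] HilbertTensor B Q :=
  (UniformSpace.Completion.toComplL ∘L TensorProduct.mapL X Y).extend
    UniformSpace.Completion.toComplL

theorem opTensor_simple (X : A →L[ℂ] B) (Y : R →L[ℂ] Q) (a : A) (r : R) :
    opTensor X Y (simple a r) = simple (X a) (Y r) :=
  ContinuousLinearMap.extend_eq (UniformSpace.Completion.toComplL ∘L TensorProduct.mapL X Y)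
    (e := (UniformSpace.Completion.toComplL : (A ⊗[ℂ] R) →L[ℂ] HilbertTensor A R))
    UniformSpace.Completion.denseRange_coe (UniformSpace.Completion.isUniformInducing_coe _)
    (a ⊗ₜ r)

theorem orthonormal_simple {ι κ : Type*} {b : ι → A} {c : κ → R} (hb : Orthonormal ℂ b)
    (hc : Orthonormal ℂ c) : Orthonormal ℂ (fun p : ι × κ => simple (b p.1) (c p.2)) := by
  classical
  rw [orthonormal_iff_ite] at hb hc ⊢
  intro p q
  simp only [inner_simple, hb, hc, Prod.ext_iff, ite_and, ite_mul, one_mul, zero_mul]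

theorem eq_zero_of_forall_inner_hilbertBasis {ι : Type*} (b : HilbertBasis ι ℂ A) {x : A}
    (hx : ∀ i, ⟪b i, x⟫_ℂ = 0) : x = 0 := by
  simpa [hx] using (tsum_enorm_sq_inner b x).symm

variable [CompleteSpace R]

variable [CompleteSpace A]

section ProductBasis

variable {ι κ : Type*} (b : HilbertBasis ι ℂ A) (c : HilbertBasis κ ℂ R)

theorem eq_zero_of_forall_inner_simple_hilbertBasis {v : HilbertTensor A R}
    (hv : ∀ i j, ⟪simple (b i) (c j), v⟫_ℂ = 0) : v = 0 := by
  have right_zero (j) : ((tensorRight A (c j))†) v = 0 :=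
    eq_zero_of_forall_inner_hilbertBasis b fun i => by
      rw [adjoint_inner_right, tensorRight_apply, hv]
  have left_zero (a) : ((tensorLeft R a)†) v = 0 :=
    eq_zero_of_forall_inner_hilbertBasis c fun j => by
      rw [adjoint_inner_right, tensorLeft_apply, ← tensorRight_apply, ← adjoint_inner_right,
        right_zero, inner_zero_right]
  refine eq_of_forall_inner_simple fun a r => ?_
  rw [← tensorLeft_apply, ← adjoint_inner_right, left_zero, inner_zero_right, inner_zero_right]

/-- The Hilbert basis `(b i ⊗ c j)` of the Hilbert space tensor product. -/
def productBasis : HilbertBasis (ι × κ) ℂ (HilbertTensor A R) :=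
  HilbertBasis.mkOfOrthogonalEqBot (orthonormal_simple b.orthonormal c.orthonormal)
    ((Submodule.eq_bot_iff _).2 fun v hv =>
      eq_zero_of_forall_inner_simple_hilbertBasis b c fun i j =>
        (Submodule.mem_orthogonal _ v).1 hv _ (Submodule.subset_span ⟨(i, j), rfl⟩))

theorem productBasis_apply (p : ι × κ) : productBasis b c p = simple (b p.1) (c p.2) := by
  rw [productBasis, HilbertBasis.coe_mkOfOrthogonalEqBot]

end ProductBasis

theorem hsNormSq_opTensor (X : A →L[ℂ] B) (Y : R →L[ℂ] Q) :
    hsNormSq (opTensor X Y) = hsNormSq X * hsNormSq Y := by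
  rw [hsNormSq_eq_tsum (productBasis (stdBasis A) (stdBasis R)), hsNormSq, hsNormSq]
  simp only [ENNReal.tsum_prod', productBasis_apply, opTensor_simple, enorm_simple, mul_pow,
    ENNReal.tsum_mul_left, ENNReal.tsum_mul_right]

variable [CompleteSpace B] [CompleteSpace Q]

theorem adjoint_opTensor_comp (S₁ S₂ : A →L[ℂ] B) (T₁ T₂ : R →L[ℂ] Q) :
    (opTensor S₁ T₁)† ∘L opTensor S₂ T₂ = opTensor (S₁† ∘L S₂) (T₁† ∘L T₂) := by
  refine ext_inner_simple fun a r b s => ?_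
  simp only [comp_apply, adjoint_inner_right, opTensor_simple, inner_simple]

theorem traceNorm_opTensor_le (X : A →L[ℂ] A) (Y : R →L[ℂ] R) :
    traceNorm (opTensor X Y) ≤ traceNorm X * traceNorm Y := by
  obtain ⟨S₁, S₂, hX, hS₁, hS₂⟩ := exists_hsNormSq_le_traceNorm X
  obtain ⟨T₁, T₂, hY, hT₁, hT₂⟩ := exists_hsNormSq_le_traceNorm Y
  refine (ENNReal.pow_le_pow_left_iff two_ne_zero).1 ?_
  calc traceNorm (opTensor X Y) ^ 2
      ≤ hsNormSq (opTensor S₁ T₁) * hsNormSq (opTensor S₂ T₂) := by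
        conv_lhs => rw [hX, hY, ← adjoint_opTensor_comp]
        exact traceNorm_adjoint_comp_sq_le _ _
    _ ≤ (traceNorm X * traceNorm Y) * (traceNorm X * traceNorm Y) := by
        rw [hsNormSq_opTensor, hsNormSq_opTensor]
        gcongr
    _ = (traceNorm X * traceNorm Y) ^ 2 := (sq _).symm

/-- The trace-class operator `X ⊗ Y`. -/
def TraceClass.tensor (X : TraceClass A) (Y : TraceClass R) : TraceClass (HilbertTensor A R) :=
  ⟨opTensor X.1 Y.1, (traceNorm_opTensor_le _ _).trans_lt (ENNReal.mul_lt_top X.2 Y.2)⟩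

end Tensor

section Entry

variable {A R : Type*} [NormedAddCommGroup A] [InnerProductSpace ℂ A] [CompleteSpace A]
  [NormedAddCommGroup R] [InnerProductSpace ℂ R]

theorem adjoint_tensorRight_comp_opTensor_comp_tensorRight (X : A →L[ℂ] A) (Y : R →L[ℂ] R)
    (r s : R) : (tensorRight A r)† ∘L opTensor X Y ∘L tensorRight A s = ⟪r, Y s⟫_ℂ • X := by
  refine ContinuousLinearMap.ext fun a => ext_inner_left ℂ fun b => ?_
  rw [comp_apply, adjoint_inner_right, tensorRight_apply, comp_apply, tensorRight_apply,
    opTensor_simple, inner_simple, _root_.smul_apply, inner_smul_right, mul_comm]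

theorem entry_zero (r s : R) : entry r s (0 : TraceClass (HilbertTensor A R)) = 0 :=
  map_zero (TraceClass.compression _ _)

theorem entry_add (r s : R) (S T : TraceClass (HilbertTensor A R)) :
    entry r s (S + T) = entry r s S + entry r s T :=
  map_add (TraceClass.compression _ _) S T

theorem entry_smul (r s : R) (c : ℂ) (T : TraceClass (HilbertTensor A R)) :
    entry r s (c • T) = c • entry r s T :=
  map_smul (TraceClass.compression _ _) c T

theorem entry_add_right (r s s' : R) (T : TraceClass (HilbertTensor A R)) :
    entry r (s + s') T = entry r s T + entry r s' T :=
  Subtype.ext (by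
    simp only [entry, tensorRight, map_add, Submodule.coe_add, ContinuousLinearMap.comp_add])

theorem entry_smul_right (r s : R) (c : ℂ) (T : TraceClass (HilbertTensor A R)) :
    entry r (c • s) T = c • entry r s T :=
  Subtype.ext (by
    simp only [entry, tensorRight, map_smul, Submodule.coe_smul, ContinuousLinearMap.comp_smul])

theorem traceNorm_entry_le (r s : R) (T : TraceClass (HilbertTensor A R)) :
    traceNorm (entry r s T : A →L[ℂ] A) ≤
      ‖r‖ₑ * ‖s‖ₑ * traceNorm (T : HilbertTensor A R →L[ℂ] HilbertTensor A R) := by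
  refine (traceNorm_adjoint_comp_comp_le _ _ _).trans ?_
  gcongr <;> exact enorm_tensorRight_le _

theorem entry_tensor [CompleteSpace R] (X : TraceClass A) (Y : TraceClass R) (r s : R) :
    entry r s (TraceClass.tensor X Y) = ⟪r, (Y : R →L[ℂ] R) s⟫_ℂ • X :=
  Subtype.ext (adjoint_tensorRight_comp_opTensor_comp_tensorRight _ _ _ _)

end Entry

section Ampliation

variable {A B R : Type*} [NormedAddCommGroup A] [InnerProductSpace ℂ A] [CompleteSpace A]
  [NormedAddCommGroup B] [InnerProductSpace ℂ B] [CompleteSpace B]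
  [NormedAddCommGroup R] [InnerProductSpace ℂ R]

theorem isExtSeminorm_traceNorm_map (Φ : Superoperator A B) :
    IsExtSeminorm (fun T : TraceClass A => traceNorm (Φ T : B →L[ℂ] B)) :=
  isExtSeminorm_traceNorm.comp ((TraceClass B).subtype ∘ₗ Φ)

theorem isExtSeminorm_traceNorm_eval (T : TraceClass A) :
    IsExtSeminorm (fun Φ : Superoperator A B => traceNorm (Φ T : B →L[ℂ] B)) :=
  ⟨fun _ _ => traceNorm_add_le _ _, fun _ _ => traceNorm_smul_le _ _⟩

theorem isExtSeminorm_ampliationNorm (Φ : Superoperator A B) :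
    IsExtSeminorm (fun ρ : TraceClass (HilbertTensor A R) => ampliationNorm Φ ρ) :=
  (isExtSeminorm_traceNorm.comp (TraceClass (HilbertTensor B R)).subtype).iInf_of_linear_relation
    (fun r s => by rw [entry_zero, entry_zero, map_zero])
    (fun h h' r s => by rw [entry_add, entry_add, map_add, h, h'])
    (fun c _ _ h r s => by rw [entry_smul, entry_smul, map_smul, h])

theorem isExtSeminorm_ampliationNorm_eval (ρ : TraceClass (HilbertTensor A R)) :
    IsExtSeminorm (fun Φ : Superoperator A B => ampliationNorm Φ ρ) :=
  (isExtSeminorm_traceNorm.comp (TraceClass (HilbertTensor B R)).subtype).iInf_of_linear_relation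
    (fun r s => by rw [entry_zero, LinearMap.zero_apply])
    (fun h h' r s => by rw [entry_add, h, h', LinearMap.add_apply])
    (fun c _ _ h r s => by rw [entry_smul, h, LinearMap.smul_apply])

theorem traceNorm_map_entry_le (Φ : Superoperator A B) (ρ : TraceClass (HilbertTensor A R)) {r : R}
    (hr : ‖r‖ = 1) : traceNorm (Φ (entry r r ρ) : B →L[ℂ] B) ≤ ampliationNorm Φ ρ := by
  refine le_iInf₂ fun σ hσ => ?_
  rw [← hσ]
  refine (traceNorm_entry_le _ _ _).trans_eq ?_
  rw [← ofReal_norm, hr, ENNReal.ofReal_one, one_mul, one_mul]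

variable [CompleteSpace R]

theorem ampliationNorm_tensor_le (Φ : Superoperator A B) (X : TraceClass A) (Y : TraceClass R) :
    ampliationNorm Φ (TraceClass.tensor X Y) ≤
      traceNorm (Φ X : B →L[ℂ] B) * traceNorm (Y : R →L[ℂ] R) :=
  iInf₂_le_of_le (TraceClass.tensor (Φ X) Y)
    (fun r s => by rw [entry_tensor, entry_tensor, map_smul]) (traceNorm_opTensor_le _ _)

theorem isExtSeminorm_diamondNorm :
    IsExtSeminorm (fun Φ : Superoperator A B => diamondNorm R Φ) :=
  .iSup fun ρ => .iSup fun _ => isExtSeminorm_ampliationNorm_eval ρ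

theorem isExtSeminorm_ecdNorm (H : A →ₗ.[ℂ] A) (E : ℝ) :
    IsExtSeminorm (fun Φ : Superoperator A B => ecdNorm R H E Φ) :=
  .iSup fun ρ => .iSup fun _ => .iSup fun _ => isExtSeminorm_ampliationNorm_eval ρ

theorem ecdNorm_le_diamondNorm (H : A →ₗ.[ℂ] A) (E : ℝ) (Φ : Superoperator A B) :
    ecdNorm R H E Φ ≤ diamondNorm R Φ :=
  iSup₂_le fun ρ hρ => iSup_le fun _ => le_iSup₂_of_le ρ hρ le_rfl

theorem ampliationNorm_le_ecdNorm {H : A →ₗ.[ℂ] A} {E : ℝ} (Φ : Superoperator A B)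
    {ρ : TraceClass (HilbertTensor A R)} (hρ : IsState ρ) {ω : TraceClass A}
    (hω : IsPartialTrace ρ ω) (hE : energy H ω ≤ ENNReal.ofReal E) :
    ampliationNorm Φ ρ ≤ ecdNorm R H E Φ :=
  le_iSup₂_of_le ρ hρ (le_iSup_of_le ⟨ω, hω, hE⟩ le_rfl)

end Ampliation

section Decomposition

variable {H : Type*} [NormedAddCommGroup H] [InnerProductSpace ℂ H] [CompleteSpace H]

theorem traceNorm_adjoint_le (T : H →L[ℂ] H) : traceNorm (T†) ≤ traceNorm T := by
  obtain ⟨S₁, S₂, hT, hS₁, hS₂⟩ := exists_hsNormSq_le_traceNorm T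
  refine (ENNReal.pow_le_pow_left_iff two_ne_zero).1 ?_
  calc traceNorm (T†) ^ 2 ≤ hsNormSq S₂ * hsNormSq S₁ := by
        conv_lhs => rw [hT, adjoint_comp, adjoint_adjoint]
        exact traceNorm_adjoint_comp_sq_le S₂ S₁
    _ ≤ traceNorm T ^ 2 := by rw [sq]; gcongr

theorem exists_isSelfAdjoint_decomposition (T : TraceClass H) :
    ∃ T₁ T₂ : TraceClass H, IsSelfAdjoint (T₁ : H →L[ℂ] H) ∧ IsSelfAdjoint (T₂ : H →L[ℂ] H) ∧
      T = T₁ + Complex.I • T₂ ∧ traceNorm (T₁ : H →L[ℂ] H) ≤ traceNorm (T : H →L[ℂ] H) ∧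
      traceNorm (T₂ : H →L[ℂ] H) ≤ traceNorm (T : H →L[ℂ] H) := by
  have average_le {c : ℂ} (hc : ‖c‖ₑ = 2⁻¹) {S : H →L[ℂ] H}
      (hS : traceNorm S ≤ traceNorm T.1 + traceNorm (T.1†)) :
      traceNorm (c • S) ≤ traceNorm T.1 := by
    refine (traceNorm_smul_le c S).trans ?_
    rw [hc, ENNReal.inv_mul_le_iff two_ne_zero ENNReal.ofNat_ne_top, two_mul]
    exact hS.trans (add_le_add_right (traceNorm_adjoint_le T.1) _)
  have enorm_half : ‖(2⁻¹ : ℂ)‖ₑ = 2⁻¹ := by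
    rw [enorm_inv two_ne_zero]
    simp [enorm_eq_nnnorm]
  have real_le : traceNorm (realPart T.1 : H →L[ℂ] H) ≤ traceNorm T.1 := by
    rw [realPart_apply_coe, ← Complex.coe_smul]
    refine average_le (by simpa using enorm_half) (traceNorm_add_le _ _)
  have imaginary_le : traceNorm (imaginaryPart T.1 : H →L[ℂ] H) ≤ traceNorm T.1 := by
    rw [imaginaryPart_apply_coe, ← Complex.coe_smul, smul_smul]
    refine average_le ?_ (isExtSeminorm_traceNorm.sub_le _ _)
    rw [enorm_mul, enorm_neg, ← ofReal_norm Complex.I, Complex.norm_I]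
    simpa using enorm_half
  exact ⟨⟨_, real_le.trans_lt T.2⟩, ⟨_, imaginary_le.trans_lt T.2⟩, (realPart T.1).2,
    (imaginaryPart T.1).2, Subtype.ext (realPart_add_I_smul_imaginaryPart T.1).symm, real_le,
    imaginary_le⟩

theorem exists_isPositive_decomposition (T : TraceClass H) (hT : IsSelfAdjoint (T : H →L[ℂ] H)) :
    ∃ T₁ T₂ : TraceClass H, (T₁ : H →L[ℂ] H).IsPositive ∧ (T₂ : H →L[ℂ] H).IsPositive ∧
      T = T₁ - T₂ ∧
      traceNorm (T₁ : H →L[ℂ] H) + traceNorm (T₂ : H →L[ℂ] H) = traceNorm (T : H →L[ℂ] H) := by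
  have pos : (T.1⁺).IsPositive :=
    (ContinuousLinearMap.nonneg_iff_isPositive _).1 (CFC.posPart_nonneg T.1)
  have neg : (T.1⁻).IsPositive :=
    (ContinuousLinearMap.nonneg_iff_isPositive _).1 (CFC.negPart_nonneg T.1)
  have add_eq : traceNorm T.1⁺ + traceNorm T.1⁻ = traceNorm T.1 := by
    rw [traceNorm_of_isPositive pos (stdBasis H), traceNorm_of_isPositive neg (stdBasis H),
      ← ENNReal.tsum_add, traceNorm, ← CFC.posPart_add_negPart T.1 hT]
    refine tsum_congr fun i => ?_
    have pos_i : 0 ≤ (⟪stdBasis H i, T.1⁺ (stdBasis H i)⟫_ℂ).re := pos.re_inner_nonneg_right _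
    have neg_i : 0 ≤ (⟪stdBasis H i, T.1⁻ (stdBasis H i)⟫_ℂ).re := neg.re_inner_nonneg_right _
    rw [← ENNReal.ofReal_add pos_i neg_i, _root_.add_apply, inner_add_right, Complex.add_re]
  have lt_top : traceNorm T.1⁺ < ⊤ ∧ traceNorm T.1⁻ < ⊤ := ENNReal.add_lt_top.1 (add_eq ▸ T.2)
  exact ⟨⟨T.1⁺, lt_top.1⟩, ⟨T.1⁻, lt_top.2⟩, pos, neg,
    Subtype.ext (CFC.posPart_sub_negPart T.1 hT).symm, add_eq⟩

theorem isState_iff {ρ : TraceClass H} :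
    IsState ρ ↔ (ρ : H →L[ℂ] H).IsPositive ∧ traceNorm (ρ : H →L[ℂ] H) = 1 := by
  refine and_congr_right fun hρ => ?_
  rw [trace_of_isPositive hρ, Complex.ofReal_eq_one, ENNReal.toReal_eq_one_iff]

theorem exists_isState_smul {ρ : TraceClass H} (hρ : (ρ : H →L[ℂ] H).IsPositive) (hne : ρ ≠ 0) :
    ∃ ρ₀ : TraceClass H, IsState ρ₀ ∧
      ρ = ((traceNorm (ρ : H →L[ℂ] H)).toReal : ℂ) • ρ₀ := by
  set t := (traceNorm (ρ : H →L[ℂ] H)).toReal with ht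
  have t_pos : 0 < t := ENNReal.toReal_pos
    (fun h => hne (Subtype.ext (eq_zero_of_traceNorm_eq_zero h))) (ne_of_lt ρ.2)
  have t_ne : (t : ℂ) ≠ 0 := Complex.ofReal_ne_zero.2 t_pos.ne'
  refine ⟨(t : ℂ)⁻¹ • ρ, ⟨hρ.smul_of_nonneg ?_, ?_⟩, (smul_inv_smul₀ t_ne ρ).symm⟩
  · exact_mod_cast (inv_pos.2 t_pos).le
  · rw [Submodule.coe_smul, trace_smul, trace_of_isPositive hρ, ← ht, inv_mul_cancel₀ t_ne]

theorem span_isState_eq_top : Submodule.span ℂ {ρ : TraceClass H | IsState ρ} = ⊤ := by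
  have positive_mem (T : TraceClass H) (hT : (T : H →L[ℂ] H).IsPositive) :
      T ∈ Submodule.span ℂ {ρ : TraceClass H | IsState ρ} := by
    rcases eq_or_ne T 0 with rfl | hne
    · exact Submodule.zero_mem _
    · obtain ⟨ρ, hρ, hT⟩ := exists_isState_smul hT hne
      rw [hT]
      exact Submodule.smul_mem _ _ (Submodule.subset_span hρ)
  have selfAdjoint_mem (T : TraceClass H) (hT : IsSelfAdjoint (T : H →L[ℂ] H)) :
      T ∈ Submodule.span ℂ {ρ : TraceClass H | IsState ρ} := by
    obtain ⟨T₁, T₂, hT₁, hT₂, rfl, -⟩ := exists_isPositive_decomposition T hT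
    exact Submodule.sub_mem _ (positive_mem _ hT₁) (positive_mem _ hT₂)
  refine Submodule.eq_top_iff'.2 fun T => ?_
  obtain ⟨T₁, T₂, hT₁, hT₂, rfl, -⟩ := exists_isSelfAdjoint_decomposition T
  exact Submodule.add_mem _ (selfAdjoint_mem _ hT₁)
    (Submodule.smul_mem _ _ (selfAdjoint_mem _ hT₂))

namespace IsExtSeminorm

variable {p : TraceClass H → ℝ≥0∞} {C : ℝ≥0∞}

theorem le_mul_traceNorm_of_isPositive (hp : IsExtSeminorm p) (hC : ∀ ρ, IsState ρ → p ρ ≤ C)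
    {T : TraceClass H} (hT : (T : H →L[ℂ] H).IsPositive) :
    p T ≤ C * traceNorm (T : H →L[ℂ] H) := by
  rcases eq_or_ne T 0 with rfl | hne
  · rw [hp.map_zero]
    exact zero_le
  obtain ⟨ρ, hρ, T_eq⟩ := exists_isState_smul hT hne
  calc p T = ‖((traceNorm (T : H →L[ℂ] H)).toReal : ℂ)‖ₑ * p ρ := by
        conv_lhs => rw [T_eq, hp.map_smul]
    _ = traceNorm (T : H →L[ℂ] H) * p ρ := by
        rw [← ofReal_norm, Complex.norm_real, Real.norm_of_nonneg ENNReal.toReal_nonneg,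
          ENNReal.ofReal_toReal (ne_of_lt T.2)]
    _ ≤ C * traceNorm (T : H →L[ℂ] H) := by
        rw [mul_comm]
        gcongr
        exact hC ρ hρ

theorem le_mul_traceNorm_of_isSelfAdjoint (hp : IsExtSeminorm p)
    (hC : ∀ ρ, IsState ρ → p ρ ≤ C) {T : TraceClass H} (hT : IsSelfAdjoint (T : H →L[ℂ] H)) :
    p T ≤ C * traceNorm (T : H →L[ℂ] H) := by
  obtain ⟨T₁, T₂, hT₁, hT₂, rfl, traceNorm_eq⟩ := exists_isPositive_decomposition T hT
  rw [← traceNorm_eq, mul_add]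
  exact (hp.sub_le T₁ T₂).trans (add_le_add (hp.le_mul_traceNorm_of_isPositive hC hT₁)
    (hp.le_mul_traceNorm_of_isPositive hC hT₂))

theorem le_two_mul_traceNorm (hp : IsExtSeminorm p) (hC : ∀ ρ, IsState ρ → p ρ ≤ C)
    (T : TraceClass H) : p T ≤ 2 * C * traceNorm (T : H →L[ℂ] H) := by
  obtain ⟨T₁, T₂, hT₁, hT₂, T_eq, hle₁, hle₂⟩ := exists_isSelfAdjoint_decomposition T
  have I_smul : p (Complex.I • T₂) = p T₂ := by
    rw [hp.map_smul, ← ofReal_norm, Complex.norm_I, ENNReal.ofReal_one, one_mul]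
  calc p T ≤ p T₁ + p T₂ := by
        rw [T_eq, ← I_smul]
        exact hp.add_le _ _
    _ ≤ C * traceNorm T.1 + C * traceNorm T.1 := by
        refine add_le_add ((hp.le_mul_traceNorm_of_isSelfAdjoint hC hT₁).trans ?_)
          ((hp.le_mul_traceNorm_of_isSelfAdjoint hC hT₂).trans ?_) <;> gcongr
    _ = 2 * C * traceNorm T.1 := by ring

end IsExtSeminorm

end Decomposition

section ProductState

variable {A B R : Type*} [NormedAddCommGroup A] [InnerProductSpace ℂ A]
  [NormedAddCommGroup B] [InnerProductSpace ℂ B] [CompleteSpace B]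
  [NormedAddCommGroup R] [InnerProductSpace ℂ R] [CompleteSpace R]

theorem adjoint_tensorLeft_comp_opTensor_comp_tensorLeft (X : A →L[ℂ] A) (Y : R →L[ℂ] R)
    (a b : A) : (tensorLeft R a)† ∘L opTensor X Y ∘L tensorLeft R b = ⟪a, X b⟫_ℂ • Y := by
  refine ContinuousLinearMap.ext fun s => ext_inner_left ℂ fun r => ?_
  rw [comp_apply, adjoint_inner_right, tensorLeft_apply, comp_apply, tensorLeft_apply,
    opTensor_simple, inner_simple, _root_.smul_apply, inner_smul_right]

variable [CompleteSpace A]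

theorem isPartialTrace_tensor (ω : TraceClass A) {σ : TraceClass R} (hσ : IsState σ) :
    IsPartialTrace (TraceClass.tensor ω σ) ω := fun a b => by
  rw [TraceClass.tensor, adjoint_tensorLeft_comp_opTensor_comp_tensorLeft, trace_smul, hσ.2,
    mul_one]

theorem IsState.tensor {ω : TraceClass A} {σ : TraceClass R} (hω : IsState ω) (hσ : IsState σ) :
    IsState (TraceClass.tensor ω σ) := by
  obtain ⟨hω, ω_norm⟩ := isState_iff.1 hω
  obtain ⟨hσ, σ_norm⟩ := isState_iff.1 hσ
  obtain ⟨S, S_adjoint, hS⟩ := exists_isSelfAdjoint_comp_self hω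
  obtain ⟨T, T_adjoint, hT⟩ := exists_isSelfAdjoint_comp_self hσ
  have tensor_eq : (TraceClass.tensor ω σ).1 = (opTensor S T)† ∘L opTensor S T := by
    rw [adjoint_opTensor_comp, S_adjoint, T_adjoint, hS, hT, TraceClass.tensor]
  refine isState_iff.2 ⟨?_, ?_⟩
  · rw [tensor_eq]
    exact ContinuousLinearMap.isPositive_adjoint_comp_self _
  · rw [tensor_eq, traceNorm_adjoint_comp_self, hsNormSq_opTensor, ← traceNorm_adjoint_comp_self,
      ← traceNorm_adjoint_comp_self, S_adjoint, T_adjoint, hS, hT, ω_norm, σ_norm, one_mul]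

theorem isState_rankOne_self {r : R} (hr : ‖r‖ = 1) : IsState (TraceClass.rankOne r r) :=
  ⟨InnerProductSpace.isPositive_rankOne_self r, by
    rw [TraceClass.rankOne, trace_rankOne, inner_self_eq_one_of_norm_eq_one hr]⟩

theorem traceNorm_map_le_ampliationNorm (Φ : Superoperator A B) {r : R} (hr : ‖r‖ = 1)
    (ω : TraceClass A) : traceNorm (Φ ω : B →L[ℂ] B) ≤
      ampliationNorm Φ (TraceClass.tensor ω (TraceClass.rankOne r r)) := by
  have entry_eq : entry r r (TraceClass.tensor ω (TraceClass.rankOne r r)) = ω := by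
    rw [entry_tensor, TraceClass.rankOne, rankOne_apply, inner_smul_right,
      inner_self_eq_one_of_norm_eq_one hr, one_mul, one_smul]
  conv_lhs => rw [← entry_eq]
  exact traceNorm_map_entry_le Φ _ hr

theorem traceNorm_map_le_diamondNorm [Nontrivial R] (Φ : Superoperator A B) {ω : TraceClass A}
    (hω : IsState ω) : traceNorm (Φ ω : B →L[ℂ] B) ≤ diamondNorm R Φ := by
  obtain ⟨r, hr⟩ := exists_norm_eq R zero_le_one
  exact (traceNorm_map_le_ampliationNorm Φ hr ω).trans
    (le_iSup₂_of_le _ (hω.tensor (isState_rankOne_self hr)) le_rfl)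

theorem traceNorm_map_le_ecdNorm [Nontrivial R] (Φ : Superoperator A B) (H : A →ₗ.[ℂ] A) {E : ℝ}
    {ω : TraceClass A} (hω : IsState ω) (hE : energy H ω ≤ ENNReal.ofReal E) :
    traceNorm (Φ ω : B →L[ℂ] B) ≤ ecdNorm R H E Φ := by
  obtain ⟨r, hr⟩ := exists_norm_eq R zero_le_one
  have hσ := isState_rankOne_self hr
  exact (traceNorm_map_le_ampliationNorm Φ hr ω).trans
    (ampliationNorm_le_ecdNorm Φ (hω.tensor hσ) (isPartialTrace_tensor ω hσ) hE)

theorem opNormLE_two_mul_diamondNorm [Nontrivial R] (Φ : Superoperator A B) :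
    OpNormLE Φ (2 * diamondNorm R Φ) :=
  (isExtSeminorm_traceNorm_map Φ).le_two_mul_traceNorm fun _ => traceNorm_map_le_diamondNorm Φ

theorem ampliationNorm_le_two_mul_diamondNorm_mul_traceNorm (Φ : Superoperator A B)
    (T : TraceClass (HilbertTensor A R)) : ampliationNorm Φ T ≤ 2 * diamondNorm R Φ *
      traceNorm (T : HilbertTensor A R →L[ℂ] HilbertTensor A R) :=
  (isExtSeminorm_ampliationNorm Φ).le_two_mul_traceNorm
    (fun ρ hρ => le_iSup₂_of_le ρ hρ le_rfl) T

end ProductState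

section BasisProj

variable {H ι : Type*} [NormedAddCommGroup H] [InnerProductSpace ℂ H]
  (b : HilbertBasis ι ℂ H) (F : Finset ι)

/-- The orthogonal projection onto the span of the basis vectors `b i` with `i ∈ F`. -/
def basisProj : H →L[ℂ] H := ∑ i ∈ F, rankOne ℂ (b i) (b i)

theorem basisProj_apply (x : H) : basisProj b F x = ∑ i ∈ F, ⟪b i, x⟫_ℂ • b i := by
  simp only [basisProj, _root_.sum_apply, rankOne_apply]

open scoped Classical in
theorem basisProj_self (i : ι) : basisProj b F (b i) = if i ∈ F then b i else 0 := by
  simp only [basisProj_apply, orthonormal_iff_ite.1 b.orthonormal, ite_smul, one_smul, zero_smul,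
    Finset.sum_ite_eq']

theorem inner_basisProj_apply_eq_zero {i : ι} (hi : i ∉ F) (x : H) :
    ⟪b i, basisProj b F x⟫_ℂ = 0 := by
  rw [basisProj_apply, inner_sum]
  refine Finset.sum_eq_zero fun j hj => ?_
  rw [inner_smul_right, b.orthonormal.2 (ne_of_mem_of_not_mem hj hi).symm, mul_zero]

variable [CompleteSpace H]

theorem adjoint_basisProj : (basisProj b F)† = basisProj b F := by
  simp only [basisProj, map_sum, InnerProductSpace.adjoint_rankOne]

theorem isStarProjection_basisProj : IsStarProjection (basisProj b F) := by
  classical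
  refine ⟨ContinuousLinearMap.ext fun x => ?_, adjoint_basisProj b F⟩
  change basisProj b F (basisProj b F x) = basisProj b F x
  rw [basisProj_apply b F x, map_sum]
  refine Finset.sum_congr rfl fun i hi => ?_
  rw [map_smul, basisProj_self, if_pos hi]

theorem comp_basisProj_comp (S T : H →L[ℂ] H) :
    S† ∘L basisProj b F ∘L T = ∑ i ∈ F, rankOne ℂ ((S†) (b i)) ((T†) (b i)) := by
  ext x
  simp only [comp_apply, basisProj_apply, map_sum, map_smul, _root_.sum_apply, rankOne_apply,
    adjoint_inner_left]

theorem hsNormSq_comp_one_sub_basisProj (S : H →L[ℂ] H) :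
    hsNormSq (S ∘L (1 - basisProj b F)) = ∑' i : {i // i ∉ F}, ‖S (b i)‖ₑ ^ 2 := by
  classical
  rw [hsNormSq_eq_tsum b]
  refine Eq.trans ?_ (tsum_subtype {i | i ∉ F} fun i => ‖S (b i)‖ₑ ^ 2).symm
  refine tsum_congr fun i => ?_
  by_cases hi : i ∈ F <;>
    simp [basisProj_self, hi]

theorem traceNorm_sub_sum_rankOne_sq_le {S : H →L[ℂ] H} (hS : S† = S) :
    traceNorm (S ∘L S - ∑ i ∈ F, rankOne ℂ (S (b i)) (S (b i))) ^ 2 ≤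
      hsNormSq S * ∑' i : {i // i ∉ F}, ‖S (b i)‖ₑ ^ 2 := by
  have remainder_eq : S ∘L S - ∑ i ∈ F, rankOne ℂ (S (b i)) (S (b i)) =
      S† ∘L ((1 - basisProj b F) ∘L S) := by
    have sum_eq := comp_basisProj_comp b F S S
    rw [hS] at sum_eq
    rw [ContinuousLinearMap.sub_comp, ContinuousLinearMap.comp_sub, hS, sum_eq]
    rfl
  have adjoint_eq : ((1 - basisProj b F) ∘L S)† = S ∘L (1 - basisProj b F) := by
    rw [adjoint_comp, hS]
    exact congrArg (S ∘L ·) (isStarProjection_basisProj b F).one_sub.isSelfAdjoint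
  rw [remainder_eq]
  refine (traceNorm_adjoint_comp_sq_le _ _).trans_eq ?_
  rw [← hsNormSq_adjoint (_ ∘L S), adjoint_eq, hsNormSq_comp_one_sub_basisProj]

theorem tendsto_traceNorm_sub_sum_rankOne {S : H →L[ℂ] H} (hS : S† = S)
    (hfin : traceNorm (S ∘L S) < ⊤) :
    Tendsto (fun F => traceNorm (S ∘L S - ∑ i ∈ F, rankOne ℂ (S (b i)) (S (b i)))) atTop
      (𝓝 0) := by
  have hsNormSq_ne_top : hsNormSq S ≠ ⊤ := by
    rw [← traceNorm_adjoint_comp_self, hS]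
    exact hfin.ne
  have tail_tendsto : Tendsto
      (fun F : Finset ι => hsNormSq S * ∑' i : {i // i ∉ F}, ‖S (b i)‖ₑ ^ 2) atTop (𝓝 0) := by
    simpa only [mul_zero] using ENNReal.Tendsto.const_mul
      (ENNReal.tendsto_tsum_compl_atTop_zero (hsNormSq_eq_tsum b S ▸ hsNormSq_ne_top))
      (Or.inr hsNormSq_ne_top)
  refine ENNReal.tendsto_nhds_zero.2 fun ε hε => ?_
  filter_upwards [ENNReal.tendsto_nhds_zero.1 tail_tendsto (ε ^ 2) (ENNReal.pow_pos hε 2)] with F hF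
  exact (ENNReal.pow_le_pow_left_iff two_ne_zero).1
    ((traceNorm_sub_sum_rankOne_sq_le b F hS).trans hF)

end BasisProj

section NullFilter

variable {V κ : Type*} {α : Type*}

/-- The filter of smallness for the gauges `q k` on the set `D`: a family tends to it when it is
eventually in `D` and every `q k` tends to zero along it. -/
def nullFilter (D : Set V) (q : κ → V → ℝ≥0∞) : Filter V := 𝓟 D ⊓ ⨅ k, comap (q k) (𝓝 0)

variable {D : Set V} {q : κ → V → ℝ≥0∞}

theorem tendsto_nullFilter {l : Filter α} {v : α → V} :
    Tendsto v l (nullFilter D q) ↔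
      (∀ᶠ a in l, v a ∈ D) ∧ ∀ k, Tendsto (fun a => q k (v a)) l (𝓝 0) := by
  simp only [nullFilter, tendsto_inf, tendsto_principal, tendsto_iInf, tendsto_comap_iff,
    Function.comp_def]

theorem eventually_mem_nullFilter : ∀ᶠ v in nullFilter D q, v ∈ D :=
  (tendsto_nullFilter.1 tendsto_id).1

theorem tendsto_gauge_nullFilter (k : κ) : Tendsto (q k) (nullFilter D q) (𝓝 0) :=
  (tendsto_nullFilter.1 tendsto_id).2 k

theorem eq_zero_of_tendsto_nullFilter {p : V → ℝ≥0∞} (hp : Tendsto p (nullFilter D q) (𝓝 0))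
    {v : V} (hv : v ∈ D) (hq : ∀ k, q k v = 0) : p v = 0 := by
  have pure_tendsto : Tendsto (fun _ : Unit => v) (pure ()) (nullFilter D q) :=
    tendsto_nullFilter.2 ⟨hv, fun k => by simp only [hq]; exact tendsto_const_nhds⟩
  exact tendsto_nhds_unique tendsto_const_nhds (hp.comp pure_tendsto)

theorem tendsto_zero_of_forall_eventually_le_add {l : Filter α} {p : α → ℝ≥0∞} {K : ℝ≥0∞}
    (hK : K ≠ ⊤)
    (h : ∀ δ : ℝ≥0∞, δ ≠ 0 → ∃ f : α → ℝ≥0∞, Tendsto f l (𝓝 0) ∧ ∀ᶠ a in l, p a ≤ f a + K * δ) :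
    Tendsto p l (𝓝 0) := by
  refine ENNReal.tendsto_nhds_zero.2 fun ε hε => ?_
  obtain ⟨δ, δ_pos, hδ⟩ : ∃ δ : ℝ≥0∞, δ ≠ 0 ∧ K * δ ≤ ε / 2 :=
    ⟨ε / 2 / (K + 1), ENNReal.div_ne_zero.2 ⟨(ENNReal.half_pos hε.ne').ne', by simpa using hK⟩, by
      rw [← mul_div_assoc]
      refine ENNReal.div_le_of_le_mul ?_
      rw [mul_comm]
      gcongr
      exact le_self_add⟩
  obtain ⟨f, hf, hle⟩ := h δ δ_pos
  filter_upwards [hle, ENNReal.tendsto_nhds_zero.1 hf _ (ENNReal.half_pos hε.ne')] with a ha hfa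
  calc p a ≤ ε / 2 + ε / 2 := ha.trans (add_le_add hfa hδ)
    _ = ε := ENNReal.add_halves ε

end NullFilter

section ConvergenceSubmodule

variable {A B : Type*} [NormedAddCommGroup A] [InnerProductSpace ℂ A] [CompleteSpace A]
  [NormedAddCommGroup B] [InnerProductSpace ℂ B] [CompleteSpace B]
  (𝓕 : Filter (Superoperator A B))

/-- The trace-class operators `T` on which the superoperators tend to zero along the filter `𝓕`,
that is `‖Φ(T)‖₁ → 0`. -/
def nullSubmodule : Submodule ℂ (TraceClass A) where
  carrier := {T | Tendsto (fun Φ : Superoperator A B => traceNorm (Φ T : B →L[ℂ] B)) 𝓕 (𝓝 0)}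
  add_mem' {S T} hS hT := by
    refine tendsto_of_tendsto_of_tendsto_of_le_of_le tendsto_const_nhds
      (by simpa only [add_zero] using hS.add hT) (fun _ => zero_le)
      fun Φ => (isExtSeminorm_traceNorm_map Φ).add_le S T
  zero_mem' := by
    simp only [Set.mem_ofPred_eq, map_zero, Submodule.coe_zero, traceNorm_zero]
    exact tendsto_const_nhds
  smul_mem' c T hT := by
    refine tendsto_of_tendsto_of_tendsto_of_le_of_le tendsto_const_nhds
      (by simpa only [mul_zero] using ENNReal.Tendsto.const_mul hT (Or.inr enorm_ne_top))
      (fun _ => zero_le) fun Φ => (isExtSeminorm_traceNorm_map Φ).smul_le c T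

variable {𝓕}

theorem mem_nullSubmodule {T : TraceClass A} : T ∈ nullSubmodule 𝓕 ↔
    Tendsto (fun Φ : Superoperator A B => traceNorm (Φ T : B →L[ℂ] B)) 𝓕 (𝓝 0) := Iff.rfl

theorem mem_nullSubmodule_of_tendsto {α : Type*} {l : Filter α} [l.NeBot] {C : ℝ≥0∞} (hC : C ≠ ⊤)
    (h𝓕 : ∀ᶠ Φ in 𝓕, OpNormLE Φ C) {S : α → TraceClass A} {T : TraceClass A}
    (hS : ∀ᶠ a in l, S a ∈ nullSubmodule 𝓕)
    (hST : Tendsto (fun a => traceNorm ((T - S a : TraceClass A) : A →L[ℂ] A)) l (𝓝 0)) :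
    T ∈ nullSubmodule 𝓕 := by
  refine tendsto_zero_of_forall_eventually_le_add hC fun δ hδ => ?_
  obtain ⟨a, ha, hle⟩ :=
    (hS.and (ENNReal.tendsto_nhds_zero.1 hST δ (pos_iff_ne_zero.2 hδ))).exists
  refine ⟨_, ha, ?_⟩
  filter_upwards [h𝓕] with Φ hΦ
  calc traceNorm (Φ T : B →L[ℂ] B) = traceNorm (Φ (S a + (T - S a)) : B →L[ℂ] B) := by
        rw [add_sub_cancel]
    _ ≤ traceNorm (Φ (S a) : B →L[ℂ] B) + traceNorm (Φ (T - S a) : B →L[ℂ] B) :=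
        (isExtSeminorm_traceNorm_map Φ).add_le _ _
    _ ≤ traceNorm (Φ (S a) : B →L[ℂ] B) + C * δ := by
        gcongr
        exact (hΦ _).trans (by gcongr)

theorem tendsto_traceNorm_rankOne_sub {α : Type*} {l : Filter α} {x : α → A} {z : A}
    (hx : Tendsto x l (𝓝 z)) :
    Tendsto (fun a => traceNorm ((TraceClass.rankOne z z - TraceClass.rankOne (x a) (x a) :
      TraceClass A) : A →L[ℂ] A)) l (𝓝 0) := by
  have diff_tendsto : Tendsto (fun a => ‖z - x a‖ₑ) l (𝓝 0) := by
    simpa using ((tendsto_const_nhds (x := z)).sub hx).enorm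
  have bound_tendsto : Tendsto (fun a => ‖z - x a‖ₑ * ‖z‖ₑ + ‖x a‖ₑ * ‖z - x a‖ₑ) l (𝓝 0) := by
    simpa using (ENNReal.Tendsto.mul_const diff_tendsto (Or.inr enorm_ne_top)).add
      (ENNReal.Tendsto.mul hx.enorm (Or.inr ENNReal.zero_ne_top) diff_tendsto
        (Or.inr enorm_ne_top))
  refine tendsto_of_tendsto_of_tendsto_of_le_of_le tendsto_const_nhds bound_tendsto
    (fun _ => zero_le) fun a => ?_
  have rankOne_sub : ((TraceClass.rankOne z z - TraceClass.rankOne (x a) (x a) : TraceClass A) :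
      A →L[ℂ] A) = rankOne ℂ (z - x a) z + rankOne ℂ (x a) (z - x a) := by
    simp only [TraceClass.rankOne, Submodule.coe_sub, map_sub, _root_.sub_apply]
    abel
  rw [rankOne_sub]
  exact (traceNorm_add_le _ _).trans
    (add_le_add (traceNorm_rankOne_le _ _) (traceNorm_rankOne_le _ _))

theorem nullSubmodule_eq_top_of_dense {C : ℝ≥0∞} (hC : C ≠ ⊤) (h𝓕 : ∀ᶠ Φ in 𝓕, OpNormLE Φ C)
    {D : Set A} (hD : Dense D) (hx : ∀ x ∈ D, TraceClass.rankOne x x ∈ nullSubmodule 𝓕) :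
    nullSubmodule 𝓕 = ⊤ := by
  have rankOne_mem (z : A) : TraceClass.rankOne z z ∈ nullSubmodule 𝓕 := by
    have : (𝓝[D] z).NeBot := mem_closure_iff_nhdsWithin_neBot.1 (hD z)
    exact mem_nullSubmodule_of_tendsto hC h𝓕 (eventually_nhdsWithin_of_forall hx)
      (tendsto_traceNorm_rankOne_sub nhdsWithin_le_nhds)
  rw [eq_top_iff, ← span_isState_eq_top, Submodule.span_le]
  intro ρ hρ
  obtain ⟨S, hS, hSρ⟩ := exists_isSelfAdjoint_comp_self hρ.1
  refine mem_nullSubmodule_of_tendsto (l := atTop) hC h𝓕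
    (S := fun F => ∑ i ∈ F, TraceClass.rankOne (S (stdBasis A i)) (S (stdBasis A i)))
    (.of_forall fun F => Submodule.sum_mem _ fun i _ => rankOne_mem _) ?_
  simpa only [Submodule.coe_sub, Submodule.coe_sum, TraceClass.rankOne, hSρ] using
    tendsto_traceNorm_sub_sum_rankOne (stdBasis A) hS (hSρ ▸ ρ.2)

end ConvergenceSubmodule

section GroundEnergy

variable {A : Type*} [NormedAddCommGroup A] [InnerProductSpace ℂ A] {H : A →ₗ.[ℂ] A}

/-- The map `(x, H x) ↦ H x - z x` on the graph of `H`. It is bounded for the graph norm, so that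
resolvents of the unbounded operator `H` become inverses of bounded operators. -/
def graphSub (H : A →ₗ.[ℂ] A) (z : ℂ) : H.graph →L[ℂ] A :=
  (ContinuousLinearMap.snd ℂ A A - z • ContinuousLinearMap.fst ℂ A A) ∘L H.graph.subtypeL

theorem graphSub_apply (z : ℂ) (g : H.graph) : graphSub H z g = g.1.2 - z • g.1.1 := rfl

theorem antilipschitzWith_graphSub {t δ : ℝ} (hδ : 0 < δ)
    (hb : ∀ x y : A, (x, y) ∈ H.graph → δ * ‖x‖ ≤ ‖y - (t : ℂ) • x‖) :
    AntilipschitzWith ⟨1 + (|t| + 1) * δ⁻¹, by positivity⟩ (graphSub H t) := by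
  refine AddMonoidHomClass.antilipschitz_of_bound _ fun g => ?_
  have norm_fst_le : ‖g.1.1‖ ≤ δ⁻¹ * ‖graphSub H t g‖ := by
    rw [inv_mul_eq_div, le_div_iff₀' hδ]
    exact hb _ _ g.2
  have norm_snd_le : ‖g.1.2‖ ≤ ‖graphSub H t g‖ + |t| * (δ⁻¹ * ‖graphSub H t g‖) :=
    calc ‖g.1.2‖ = ‖graphSub H t g + (t : ℂ) • g.1.1‖ := by rw [graphSub_apply, sub_add_cancel]
      _ ≤ ‖graphSub H t g‖ + |t| * ‖g.1.1‖ := by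
          refine (norm_add_le _ _).trans_eq ?_
          rw [norm_smul, Complex.norm_real, Real.norm_eq_abs]
      _ ≤ ‖graphSub H t g‖ + |t| * (δ⁻¹ * ‖graphSub H t g‖) := by gcongr
  have nonneg : 0 ≤ δ⁻¹ * ‖graphSub H t g‖ := by positivity
  have t_mul_nonneg : 0 ≤ |t| * (δ⁻¹ * ‖graphSub H t g‖) := by positivity
  change max ‖g.1.1‖ ‖g.1.2‖ ≤ (1 + (|t| + 1) * δ⁻¹) * ‖graphSub H t g‖
  refine max_le ?_ ?_ <;> linarith [norm_nonneg (graphSub H t g)]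

variable [CompleteSpace A]

theorem notMem_unboundedSpectrum_of_bijective (hH : IsClosed (H.graph : Set (A × A))) {z : ℂ}
    (hz : Function.Bijective (graphSub H z)) : z ∉ unboundedSpectrum H := by
  have : CompleteSpace H.graph := hH.completeSpace_coe
  let e : H.graph ≃L[ℂ] A := ContinuousLinearEquiv.ofBijective (graphSub H z)
    (LinearMap.ker_eq_bot.2 hz.1) (LinearMap.range_eq_top.2 hz.2)
  have e_apply (g : H.graph) : e g = g.1.2 - z • g.1.1 := rfl
  refine not_not.2 ⟨ContinuousLinearMap.fst ℂ A A ∘L H.graph.subtypeL ∘L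
    e.symm.toContinuousLinearMap, fun y => ?_, fun x => ?_⟩
  · have snd_eq : y + z • (e.symm y).1.1 = (e.symm y).1.2 := by
      rw [← eq_sub_iff_add_eq, ← e_apply, e.apply_symm_apply]
    change ((e.symm y).1.1, y + z • (e.symm y).1.1) ∈ H.graph
    rw [snd_eq]
    exact (e.symm y).2
  · change (e.symm (e ⟨_, H.mem_graph x⟩)).1.1 = x
    rw [e.symm_apply_apply]

namespace IsHamiltonian

theorem mem_graph_of_forall (hH : IsHamiltonian H) {y w : A}
    (h : ∀ x : H.domain, ⟪w, (x : A)⟫_ℂ = ⟪y, H x⟫_ℂ) : (y, w) ∈ H.graph := by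
  rw [← LinearPMap.isSelfAdjoint_def.1 hH.isSelfAdjoint, LinearPMap.mem_graph_iff]
  exact ⟨⟨y, LinearPMap.mem_adjoint_domain_of_exists y ⟨w, h⟩⟩, rfl,
    LinearPMap.adjoint_apply_eq hH.dense_domain _ h⟩

theorem inner_graph_comm (hH : IsHamiltonian H) {x x' y y' : A} (hx : (x, x') ∈ H.graph)
    (hy : (y, y') ∈ H.graph) : ⟪x', y⟫_ℂ = ⟪x, y'⟫_ℂ := by
  have formal_adjoint := LinearPMap.adjoint_isFormalAdjoint hH.dense_domain
  rw [LinearPMap.isSelfAdjoint_def.1 hH.isSelfAdjoint] at formal_adjoint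
  obtain ⟨p, rfl, rfl⟩ := H.mem_graph_iff.1 hx
  obtain ⟨q, rfl, rfl⟩ := H.mem_graph_iff.1 hy
  exact formal_adjoint p q

theorem re_inner_graph_nonneg (hH : IsHamiltonian H) {x y : A} (hxy : (x, y) ∈ H.graph) :
    0 ≤ (⟪x, y⟫_ℂ).re := by
  obtain ⟨p, rfl, rfl⟩ := H.mem_graph_iff.1 hxy
  exact (Complex.le_def.1 (hH.nonneg p)).1

theorem bijective_graphSub (hH : IsHamiltonian H) {t δ : ℝ} (hδ : 0 < δ)
    (hb : ∀ x y : A, (x, y) ∈ H.graph → δ * ‖x‖ ≤ ‖y - (t : ℂ) • x‖) :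
    Function.Bijective (graphSub H t) := by
  have : CompleteSpace H.graph := hH.isSelfAdjoint.isClosed.completeSpace_coe
  have antilipschitz := antilipschitzWith_graphSub hδ hb
  have : CompleteSpace (graphSub H t).range :=
    (antilipschitz.isClosed_range (graphSub H t).uniformContinuous).completeSpace_coe
  refine ⟨antilipschitz.injective, LinearMap.range_eq_top.1 ?_⟩
  rw [← Submodule.orthogonal_eq_bot_iff, Submodule.eq_bot_iff]
  intro y hy
  have mem_graph : (y, (t : ℂ) • y) ∈ H.graph := hH.mem_graph_of_forall fun x => by
    have orthogonal := (Submodule.mem_orthogonal' _ _).1 hy _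
      (LinearMap.mem_range_self _ (⟨_, H.mem_graph x⟩ : H.graph))
    rw [ContinuousLinearMap.coe_coe, graphSub_apply, inner_sub_right, inner_smul_right,
      sub_eq_zero] at orthogonal
    rw [orthogonal, inner_smul_left, Complex.conj_ofReal]
  have norm_le := hb _ _ mem_graph
  rw [sub_self, norm_zero] at norm_le
  exact norm_le_zero_iff.1 (nonpos_of_mul_nonpos_right norm_le hδ)

theorem notMem_unboundedSpectrum (hH : IsHamiltonian H) {t δ : ℝ} (hδ : 0 < δ)
    (hb : ∀ x y : A, (x, y) ∈ H.graph → (t + δ) * ‖x‖ ^ 2 ≤ (⟪x, y⟫_ℂ).re) :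
    (t : ℂ) ∉ unboundedSpectrum H := by
  refine notMem_unboundedSpectrum_of_bijective hH.isSelfAdjoint.isClosed
    (hH.bijective_graphSub hδ fun x y hxy => ?_)
  rcases (norm_nonneg x).eq_or_lt with hx | hx
  · rw [← hx, mul_zero]
    exact norm_nonneg _
  refine le_of_mul_le_mul_left ?_ hx
  have re_inner_self : (⟪x, x⟫_ℂ).re = ‖x‖ ^ 2 := inner_self_eq_norm_sq (𝕜 := ℂ) x
  calc ‖x‖ * (δ * ‖x‖) ≤ (⟪x, y⟫_ℂ).re - t * ‖x‖ ^ 2 := by linarith [hb x y hxy]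
    _ = (⟪x, y - (t : ℂ) • x⟫_ℂ).re := by
        rw [inner_sub_right, inner_smul_right, Complex.sub_re, Complex.re_ofReal_mul, re_inner_self]
    _ ≤ ‖x‖ * ‖y - (t : ℂ) • x‖ := (Complex.re_le_norm _).trans (norm_inner_le_norm _ _)

theorem exists_re_inner_lt (hH : IsHamiltonian H) {E : ℝ} (hE : groundEnergy H < (E : EReal)) :
    ∃ x y : A, (x, y) ∈ H.graph ∧ ‖x‖ = 1 ∧ (⟪x, y⟫_ℂ).re < E := by
  obtain ⟨_, ⟨t, ht, rfl⟩, htE⟩ := sInf_lt_iff.1 hE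
  have t_lt : t < E := EReal.coe_lt_coe_iff.1 htE
  by_contra! energy_ge
  refine hH.notMem_unboundedSpectrum (δ := E - t) (sub_pos.2 t_lt) (fun x y hxy => ?_) ht
  rcases eq_or_ne x 0 with rfl | hx
  · simp
  have normalized_ge := energy_ge ((‖x‖⁻¹ : ℂ) • x) ((‖x‖⁻¹ : ℂ) • y) (H.graph.smul_mem _ hxy)
    (norm_smul_inv_norm hx)
  rw [inner_smul_left, inner_smul_right, ← Complex.ofReal_inv, Complex.conj_ofReal,
    Complex.re_ofReal_mul, Complex.re_ofReal_mul, ← mul_assoc, ← sq, inv_pow, inv_mul_eq_div,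
    le_div_iff₀ (by positivity)] at normalized_ge
  rwa [add_sub_cancel]

end IsHamiltonian

end GroundEnergy

section Mixture

variable {A : Type*} [NormedAddCommGroup A] [InnerProductSpace ℂ A] [CompleteSpace A]
  {H : A →ₗ.[ℂ] A}

/-- The mixture `(1 - p‖x‖²)|x₀⟩⟨x₀| + p|x⟩⟨x|`, a state for a unit vector `x₀` and `p ≥ 0` with
`p‖x‖² ≤ 1`. It serves to reach `|x⟩⟨x|` from states of low energy. -/
def mixture (p : ℝ) (x₀ x : A) : TraceClass A :=
  ((1 - p * ‖x‖ ^ 2 : ℝ) : ℂ) • TraceClass.rankOne x₀ x₀ + (p : ℂ) • TraceClass.rankOne x x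

theorem re_trace_comp_mixture (K : A →L[ℂ] A) (p : ℝ) (x₀ x : A) :
    (trace (K ∘L (mixture p x₀ x : A →L[ℂ] A))).re =
      (1 - p * ‖x‖ ^ 2) * (⟪x₀, K x₀⟫_ℂ).re + p * (⟪x, K x⟫_ℂ).re := by
  have comp_eq : K ∘L (mixture p x₀ x : A →L[ℂ] A) =
      (((1 - p * ‖x‖ ^ 2 : ℝ) : ℂ) • TraceClass.rankOne (K x₀) x₀ +
        (p : ℂ) • TraceClass.rankOne (K x) x : TraceClass A) := by
    simp only [mixture, TraceClass.rankOne, Submodule.coe_add, Submodule.coe_smul,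
      ContinuousLinearMap.comp_add, ContinuousLinearMap.comp_smul, InnerProductSpace.comp_rankOne]
  rw [comp_eq, Submodule.coe_add, trace_add (_ • TraceClass.rankOne (K x₀) x₀).2
    (_ • TraceClass.rankOne (K x) x).2, Submodule.coe_smul, Submodule.coe_smul, trace_smul,
    trace_smul, TraceClass.rankOne, TraceClass.rankOne, trace_rankOne, trace_rankOne,
    Complex.add_re, Complex.re_ofReal_mul, Complex.re_ofReal_mul]

theorem isState_mixture {p : ℝ} (hp : 0 ≤ p) {x₀ x : A} (hx₀ : ‖x₀‖ = 1) (hx : p * ‖x‖ ^ 2 ≤ 1) :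
    IsState (mixture p x₀ x) := by
  have pos : (mixture p x₀ x : A →L[ℂ] A).IsPositive :=
    .add (.smul_of_nonneg (InnerProductSpace.isPositive_rankOne_self x₀)
        (Complex.zero_le_real.2 (sub_nonneg.2 hx)))
      (.smul_of_nonneg (InnerProductSpace.isPositive_rankOne_self x) (Complex.zero_le_real.2 hp))
  have re_inner_self (x : A) : (⟪x, x⟫_ℂ).re = ‖x‖ ^ 2 := inner_self_eq_norm_sq (𝕜 := ℂ) x
  have re_trace := re_trace_comp_mixture (.id ℂ A) p x₀ x
  rw [ContinuousLinearMap.id_comp, ContinuousLinearMap.id_apply, ContinuousLinearMap.id_apply,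
    re_inner_self, re_inner_self, hx₀, one_pow, mul_one, sub_add_cancel, trace_of_isPositive pos,
    Complex.ofReal_re] at re_trace
  exact ⟨pos, by rw [trace_of_isPositive pos, re_trace, Complex.ofReal_one]⟩

theorem IsHamiltonian.re_inner_spectral_le (hH : IsHamiltonian H) {t : ℝ} {P K : A →L[ℂ] A}
    (hP : IsSpectralProjector H t P) (hK : ∀ x, (P x, K x) ∈ H.graph) {x y : A}
    (hxy : (x, y) ∈ H.graph) : (⟪x, K x⟫_ℂ).re ≤ (⟪x, y⟫_ℂ).re := by
  have K_apply : K x = P y := LinearPMap.mem_graph_snd_inj H (hK x) (hP.commutes x y hxy) rfl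
  have P_adjoint : P† = P := hP.isStarProjection.isSelfAdjoint.star_eq
  have P_apply_apply (z : A) : P (P z) = P z :=
    DFunLike.congr_fun hP.isStarProjection.isIdempotentElem z
  have range_orthogonal : ⟪P x, y - P y⟫_ℂ = 0 := by
    rw [← adjoint_inner_right, P_adjoint, map_sub, P_apply_apply, sub_self, inner_zero_right]
  have complement_nonneg : 0 ≤ (⟪x - P x, y - P y⟫_ℂ).re :=
    hH.re_inner_graph_nonneg (H.graph.sub_mem hxy (hP.commutes x y hxy))
  rw [inner_sub_left, range_orthogonal, sub_zero, inner_sub_right,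
    Complex.sub_re, sub_nonneg] at complement_nonneg
  rwa [K_apply]

theorem IsHamiltonian.energy_mixture_le (hH : IsHamiltonian H) {p : ℝ} (hp : 0 ≤ p)
    {x₀ y₀ x y : A} (hx₁ : p * ‖x‖ ^ 2 ≤ 1) (hx₀ : (x₀, y₀) ∈ H.graph) (hx : (x, y) ∈ H.graph)
    {E : ℝ} (hE : (1 - p * ‖x‖ ^ 2) * (⟪x₀, y₀⟫_ℂ).re + p * (⟪x, y⟫_ℂ).re ≤ E) :
    energy H (mixture p x₀ x) ≤ ENNReal.ofReal E := by
  refine iSup_le fun n => iSup₂_le fun P K => iSup₂_le fun hP hK =>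
    ENNReal.ofReal_le_ofReal (le_trans ?_ hE)
  rw [re_trace_comp_mixture]
  exact add_le_add
    (mul_le_mul_of_nonneg_left (hH.re_inner_spectral_le hP hK hx₀) (sub_nonneg.2 hx₁))
    (mul_le_mul_of_nonneg_left (hH.re_inner_spectral_le hP hK hx) hp)

theorem exists_pos_mixture_weight {e₀ E : ℝ} (h : e₀ < E) (n e : ℝ) :
    ∃ p : ℝ, 0 < p ∧ p * n ≤ 1 ∧ (1 - p * n) * e₀ + p * e ≤ E := by
  have weight_tendsto : Tendsto (fun p : ℝ => p * n) (𝓝[>] 0) (𝓝 0) :=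
    tendsto_nhdsWithin_of_tendsto_nhds (Continuous.tendsto' (by fun_prop) _ _ (zero_mul n))
  have energy_tendsto : Tendsto (fun p : ℝ => (1 - p * n) * e₀ + p * e) (𝓝[>] 0) (𝓝 e₀) :=
    tendsto_nhdsWithin_of_tendsto_nhds (Continuous.tendsto' (by fun_prop) _ _ (by simp))
  obtain ⟨p, ⟨hp, hpn⟩, hpe⟩ := ((eventually_mem_nhdsWithin.and
    (weight_tendsto.eventually_le_const one_pos)).and (energy_tendsto.eventually_le_const h)).exists
  exact ⟨p, hp, hpn, hpe⟩

end Mixture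

section EcdDominatesStrong

variable {A B R : Type*} [NormedAddCommGroup A] [InnerProductSpace ℂ A] [CompleteSpace A]
  [NormedAddCommGroup B] [InnerProductSpace ℂ B] [CompleteSpace B]
  [NormedAddCommGroup R] [InnerProductSpace ℂ R] [CompleteSpace R] [Nontrivial R]
  {H : A →ₗ.[ℂ] A} {E : ℝ} {𝓕 : Filter (Superoperator A B)}

theorem mem_nullSubmodule_of_energy_le (h𝓕 : Tendsto (ecdNorm R H E) 𝓕 (𝓝 0)) {ω : TraceClass A}
    (hω : IsState ω) (hE : energy H ω ≤ ENNReal.ofReal E) : ω ∈ nullSubmodule 𝓕 :=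
  tendsto_of_tendsto_of_tendsto_of_le_of_le tendsto_const_nhds h𝓕 (fun _ => zero_le)
    fun Φ => traceNorm_map_le_ecdNorm Φ H hω hE

theorem IsHamiltonian.rankOne_mem_nullSubmodule (hH : IsHamiltonian H)
    (hE : groundEnergy H < (E : EReal)) (h𝓕 : Tendsto (ecdNorm R H E) 𝓕 (𝓝 0)) {x : A}
    (hx : x ∈ H.domain) : TraceClass.rankOne x x ∈ nullSubmodule 𝓕 := by
  obtain ⟨x₀, y₀, hx₀, norm_x₀, energy_x₀⟩ := hH.exists_re_inner_lt hE
  have mixture_mem {p : ℝ} (hp : 0 ≤ p) {z y : A} (hz : p * ‖z‖ ^ 2 ≤ 1) (hzy : (z, y) ∈ H.graph)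
      (hle : (1 - p * ‖z‖ ^ 2) * (⟪x₀, y₀⟫_ℂ).re + p * (⟪z, y⟫_ℂ).re ≤ E) :
      mixture p x₀ z ∈ nullSubmodule 𝓕 :=
    mem_nullSubmodule_of_energy_le h𝓕 (isState_mixture hp norm_x₀ hz)
      (hH.energy_mixture_le hp hz hx₀ hzy hle)
  have rankOne_x₀_mem : TraceClass.rankOne x₀ x₀ ∈ nullSubmodule 𝓕 := by
    simpa [mixture] using mixture_mem le_rfl (by simp) hx₀ (by simpa using energy_x₀.le)
  have mem_graph : (x, H ⟨x, hx⟩) ∈ H.graph := H.mem_graph ⟨x, hx⟩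
  obtain ⟨p, hp, hpx, hpE⟩ :=
    exists_pos_mixture_weight energy_x₀ (‖x‖ ^ 2) (⟪x, H ⟨x, hx⟩⟫_ℂ).re
  have p_smul_mem : (p : ℂ) • TraceClass.rankOne x x ∈ nullSubmodule 𝓕 :=
    (Submodule.add_mem_iff_right _ (Submodule.smul_mem _ _ rankOne_x₀_mem)).1
      (mixture_mem hp.le hpx mem_graph hpE)
  exact (Submodule.smul_mem_iff _ (Complex.ofReal_ne_zero.2 hp.ne')).1 p_smul_mem

theorem IsHamiltonian.nullSubmodule_eq_top (hH : IsHamiltonian H)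
    (hE : groundEnergy H < (E : EReal)) {C : ℝ≥0∞} (hC : C ≠ ⊤) (hΦ : ∀ᶠ Φ in 𝓕, OpNormLE Φ C)
    (h𝓕 : Tendsto (ecdNorm R H E) 𝓕 (𝓝 0)) : nullSubmodule 𝓕 = ⊤ :=
  nullSubmodule_eq_top_of_dense hC hΦ hH.dense_domain
    fun _ hx => hH.rankOne_mem_nullSubmodule hE h𝓕 hx

end EcdDominatesStrong

section DiscreteEnergy

theorem hasSum_norm_inner_sq {H ι : Type*} [NormedAddCommGroup H] [InnerProductSpace ℂ H]
    (b : HilbertBasis ι ℂ H) (x : H) : HasSum (fun i => ‖⟪b i, x⟫_ℂ‖ ^ 2) (‖x‖ ^ 2) := by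
  convert Complex.hasSum_re (b.hasSum_inner_mul_inner x x) using 1
  · funext i
    rw [← inner_conj_symm x (b i), mul_comm, Complex.mul_conj, Complex.ofReal_re,
      Complex.normSq_eq_norm_sq]
  · exact (inner_self_eq_norm_sq (𝕜 := ℂ) x).symm

variable {A ι : Type*} [NormedAddCommGroup A] [InnerProductSpace ℂ A]
  {H : A →ₗ.[ℂ] A} {τ : HilbertBasis ι ℂ A} {e : ι → ℝ}

theorem exists_finset_le (he : Tendsto e cofinite atTop) (t : ℝ) :
    ∃ F : Finset ι, ∀ k, k ∈ F ↔ e k ≤ t := by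
  have finite_le := eventually_cofinite.1 (he.eventually_gt_atTop t)
  refine ⟨finite_le.toFinset, fun k => ?_⟩
  rw [Set.Finite.mem_toFinset, Set.mem_ofPred_eq, not_lt]

variable (τ e) in
/-- The operator `∑ₖ eₖ|τₖ⟩⟨τₖ|` with `k` ranging over `F`: the bounded operator `H P` for the
Hamiltonian `H` with eigenvectors `τₖ` and the projection `P` onto the span of `τₖ`, `k ∈ F`. -/
def truncatedHamiltonian (F : Finset ι) : A →L[ℂ] A :=
  ∑ k ∈ F, (e k : ℂ) • rankOne ℂ (τ k) (τ k)

theorem basisProj_truncatedHamiltonian_mem_graph (hτ : ∀ k, (τ k, (e k : ℂ) • τ k) ∈ H.graph)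
    (F : Finset ι) (x : A) : (basisProj τ F x, truncatedHamiltonian τ e F x) ∈ H.graph := by
  have pair_eq : (basisProj τ F x, truncatedHamiltonian τ e F x) =
      ∑ k ∈ F, ⟪τ k, x⟫_ℂ • (τ k, (e k : ℂ) • τ k) := by
    ext
    · simp [basisProj_apply, Prod.fst_sum]
    · simp [truncatedHamiltonian, Prod.snd_sum, smul_comm (e _)]
  rw [pair_eq]
  exact H.graph.sum_mem fun k _ => H.graph.smul_mem _ (hτ k)

variable [CompleteSpace A]

theorem trace_sum (F : Finset ι) (T : ι → TraceClass A) :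
    trace (∑ i ∈ F, (T i : A →L[ℂ] A)) = ∑ i ∈ F, trace (T i : A →L[ℂ] A) := by
  rw [← (hasSum_sum fun i _ => hasSum_trace (T i).2).tsum_eq]
  simp only [trace, _root_.sum_apply, inner_sum]

theorem trace_truncatedHamiltonian_comp (F : Finset ι) (T : A →L[ℂ] A) :
    trace (truncatedHamiltonian τ e F ∘L T) = ∑ k ∈ F, e k * ⟪τ k, T (τ k)⟫_ℂ := by
  have comp_eq : truncatedHamiltonian τ e F ∘L T =
      ∑ k ∈ F, (((e k : ℂ) • TraceClass.rankOne (τ k) ((T†) (τ k)) : TraceClass A) :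
        A →L[ℂ] A) := by
    ext x
    simp [truncatedHamiltonian, TraceClass.rankOne, adjoint_inner_left]
  rw [comp_eq, trace_sum]
  refine Finset.sum_congr rfl fun k _ => ?_
  rw [Submodule.coe_smul, trace_smul, TraceClass.rankOne, trace_rankOne, adjoint_inner_left]

namespace IsHamiltonian

theorem inner_eigenvector (hH : IsHamiltonian H) {u x y : A} {t : ℝ}
    (hu : (u, (t : ℂ) • u) ∈ H.graph) (hxy : (x, y) ∈ H.graph) : ⟪u, y⟫_ℂ = t * ⟪u, x⟫_ℂ := by
  rw [← hH.inner_graph_comm hu hxy, inner_smul_left, Complex.conj_ofReal]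

theorem eigenvalue_nonneg (hH : IsHamiltonian H) {u : A} {t : ℝ} (hu : (u, (t : ℂ) • u) ∈ H.graph)
    (norm_u : ‖u‖ = 1) : 0 ≤ t := by
  have nonneg := hH.re_inner_graph_nonneg hu
  rwa [inner_smul_right, inner_self_eq_one_of_norm_eq_one norm_u, mul_one,
    Complex.ofReal_re] at nonneg

theorem hasSum_energy (hH : IsHamiltonian H) (hτ : ∀ k, (τ k, (e k : ℂ) • τ k) ∈ H.graph)
    {x y : A} (hxy : (x, y) ∈ H.graph) :
    HasSum (fun k => e k * ‖⟪τ k, x⟫_ℂ‖ ^ 2) (⟪x, y⟫_ℂ).re := by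
  convert Complex.hasSum_re (τ.hasSum_inner_mul_inner x y) using 1
  funext k
  rw [hH.inner_eigenvector (hτ k) hxy, ← inner_conj_symm x (τ k), mul_left_comm,
    Complex.re_ofReal_mul, mul_comm (starRingEnd ℂ _), Complex.mul_conj, Complex.ofReal_re,
    Complex.normSq_eq_norm_sq]

theorem basisProj_eq_truncatedHamiltonian (hH : IsHamiltonian H)
    (hτ : ∀ k, (τ k, (e k : ℂ) • τ k) ∈ H.graph) (F : Finset ι) {x y : A}
    (hxy : (x, y) ∈ H.graph) : basisProj τ F y = truncatedHamiltonian τ e F x := by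
  rw [basisProj_apply, truncatedHamiltonian, _root_.sum_apply]
  refine Finset.sum_congr rfl fun k _ => ?_
  rw [hH.inner_eigenvector (hτ k) hxy, mul_smul, _root_.smul_apply, rankOne_apply]

theorem lt_re_inner_of_basisProj_eq_zero (hH : IsHamiltonian H)
    (hτ : ∀ k, (τ k, (e k : ℂ) • τ k) ∈ H.graph) {t : ℝ} {F : Finset ι}
    (hF : ∀ k, k ∈ F ↔ e k ≤ t) {x y : A} (hxy : (x, y) ∈ H.graph) (hPx : basisProj τ F x = 0)
    (hx : x ≠ 0) : t * ‖x‖ ^ 2 < (⟪x, y⟫_ℂ).re := by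
  classical
  have inner_eq_zero {k : ι} (hk : k ∈ F) : ⟪τ k, x⟫_ℂ = 0 := by
    have inner_eq := adjoint_inner_left (basisProj τ F) x (τ k)
    rwa [adjoint_basisProj, basisProj_self, if_pos hk, hPx, inner_zero_right] at inner_eq
  have lt_of_inner_ne_zero {k : ι} (hk : ⟪τ k, x⟫_ℂ ≠ 0) : t < e k :=
    not_le.1 fun hle => hk (inner_eq_zero ((hF k).2 hle))
  obtain ⟨k, hk⟩ : ∃ k, ⟪τ k, x⟫_ℂ ≠ 0 := by
    contrapose! hx
    exact eq_zero_of_forall_inner_hilbertBasis τ hx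
  refine hasSum_lt (i := k) (fun j => ?_)
    (mul_lt_mul_of_pos_right (lt_of_inner_ne_zero hk) (by positivity))
    ((hasSum_norm_inner_sq τ x).mul_left t) (hH.hasSum_energy hτ hxy)
  by_cases hj : ⟪τ j, x⟫_ℂ = 0
  · simp [hj]
  · exact mul_le_mul_of_nonneg_right (lt_of_inner_ne_zero hj).le (sq_nonneg _)

theorem isSpectralProjector_basisProj (hH : IsHamiltonian H)
    (hτ : ∀ k, (τ k, (e k : ℂ) • τ k) ∈ H.graph) {t : ℝ} {F : Finset ι}
    (hF : ∀ k, k ∈ F ↔ e k ≤ t) : IsSpectralProjector H t (basisProj τ F) where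
  isStarProjection := isStarProjection_basisProj τ F
  commutes x y hxy := by
    rw [hH.basisProj_eq_truncatedHamiltonian hτ F hxy]
    exact basisProj_truncatedHamiltonian_mem_graph hτ F x
  le_on_range x := by
    have mem_graph := basisProj_truncatedHamiltonian_mem_graph hτ F x
    refine ⟨_, mem_graph, hasSum_le (fun k => ?_) (hH.hasSum_energy hτ mem_graph)
      ((hasSum_norm_inner_sq τ _).mul_left t)⟩
    by_cases hk : k ∈ F
    · exact mul_le_mul_of_nonneg_right ((hF k).1 hk) (sq_nonneg _)
    · simp [inner_basisProj_apply_eq_zero τ F hk]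
  lt_off_range _ _ hxy hPx hx := hH.lt_re_inner_of_basisProj_eq_zero hτ hF hxy hPx hx

theorem tsum_ofReal_mul_le_energy (hH : IsHamiltonian H)
    (hτ : ∀ k, (τ k, (e k : ℂ) • τ k) ∈ H.graph) (he : Tendsto e cofinite atTop)
    {ω : A →L[ℂ] A} (hω : ω.IsPositive) :
    ∑' k, ENNReal.ofReal (e k * (⟪τ k, ω (τ k)⟫_ℂ).re) ≤ energy H ω := by
  have e_nonneg (k : ι) : 0 ≤ e k := hH.eigenvalue_nonneg (hτ k) (τ.orthonormal.1 k)
  have term_nonneg (k : ι) : 0 ≤ e k * (⟪τ k, ω (τ k)⟫_ℂ).re :=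
    mul_nonneg (e_nonneg k) (hω.re_inner_nonneg_right (τ k))
  rw [ENNReal.tsum_eq_iSup_sum]
  refine iSup_le fun G => ?_
  obtain ⟨n, hn⟩ := exists_nat_ge (∑ k ∈ G, e k)
  obtain ⟨F, hF⟩ := exists_finset_le he n
  have G_subset : G ⊆ F := fun k hk =>
    (hF k).2 ((Finset.single_le_sum (fun j _ => e_nonneg j) hk).trans hn)
  calc ∑ k ∈ G, ENNReal.ofReal (e k * (⟪τ k, ω (τ k)⟫_ℂ).re)
      ≤ ∑ k ∈ F, ENNReal.ofReal (e k * (⟪τ k, ω (τ k)⟫_ℂ).re) :=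
        Finset.sum_le_sum_of_subset G_subset
    _ = ENNReal.ofReal (trace (truncatedHamiltonian τ e F ∘L ω)).re := by
        rw [trace_truncatedHamiltonian_comp, Complex.re_sum,
          ← ENNReal.ofReal_sum_of_nonneg fun k _ => term_nonneg k]
        simp only [Complex.re_ofReal_mul]
    _ ≤ energy H ω :=
        le_iSup_of_le n <| le_iSup₂_of_le (basisProj τ F) (truncatedHamiltonian τ e F) <|
          le_iSup₂_of_le (hH.isSpectralProjector_basisProj hτ hF)
            (basisProj_truncatedHamiltonian_mem_graph hτ F) le_rfl

theorem mul_tsum_notMem_le_energy (hH : IsHamiltonian H)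
    (hτ : ∀ k, (τ k, (e k : ℂ) • τ k) ∈ H.graph) (he : Tendsto e cofinite atTop)
    {ω : A →L[ℂ] A} (hω : ω.IsPositive) {N : ℝ} {F : Finset ι}
    (hF : ∀ k ∉ F, N ≤ e k) :
    ENNReal.ofReal N * ∑' k : {k // k ∉ F}, ENNReal.ofReal (⟪τ k, ω (τ k)⟫_ℂ).re ≤ energy H ω := by
  rw [← ENNReal.tsum_mul_left]
  calc ∑' k : {k // k ∉ F}, ENNReal.ofReal N * ENNReal.ofReal (⟪τ k, ω (τ k)⟫_ℂ).re
      ≤ ∑' k : {k // k ∉ F}, ENNReal.ofReal (e k * (⟪τ k, ω (τ k)⟫_ℂ).re) := by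
        refine ENNReal.tsum_le_tsum fun k => ?_
        have diag_nonneg : 0 ≤ (⟪τ k, ω (τ k)⟫_ℂ).re := hω.re_inner_nonneg_right (τ k)
        rw [← ENNReal.ofReal_mul' diag_nonneg]
        exact ENNReal.ofReal_le_ofReal (mul_le_mul_of_nonneg_right (hF k k.2) diag_nonneg)
    _ ≤ ∑' k, ENNReal.ofReal (e k * (⟪τ k, ω (τ k)⟫_ℂ).re) :=
        ENNReal.tsum_comp_le_tsum_of_injective Subtype.val_injective _
    _ ≤ energy H ω := hH.tsum_ofReal_mul_le_energy hτ he hω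

end IsHamiltonian

end DiscreteEnergy

section PartialTrace

theorem isPositive_of_forall_inner_nonneg {H : Type*} [NormedAddCommGroup H]
    [InnerProductSpace ℂ H] {T : H →L[ℂ] H} (hT : ∀ x, 0 ≤ ⟪x, T x⟫_ℂ) : T.IsPositive := by
  refine (ContinuousLinearMap.isPositive_iff_complex _).2 fun x => ?_
  have conj_nonneg : 0 ≤ ⟪T x, x⟫_ℂ := by
    rw [← inner_conj_symm]
    exact star_nonneg_iff.2 (hT x)
  exact ⟨(Complex.eq_re_of_ofReal_le (r := 0) (by simpa using conj_nonneg)).symm,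
    (Complex.nonneg_iff.1 conj_nonneg).1⟩

variable {A K R : Type*} [NormedAddCommGroup A] [InnerProductSpace ℂ A] [CompleteSpace A]
  [NormedAddCommGroup K] [InnerProductSpace ℂ K] [CompleteSpace K]
  [NormedAddCommGroup R] [InnerProductSpace ℂ R] [CompleteSpace R]
  {ρ : TraceClass (HilbertTensor A R)} {ω : TraceClass A}

namespace IsPartialTrace

theorem inner_eq_traceNorm (hρω : IsPartialTrace ρ ω)
    (hρ : (ρ : HilbertTensor A R →L[ℂ] HilbertTensor A R).IsPositive) (a : A) :
    ⟪a, (ω : A →L[ℂ] A) a⟫_ℂ =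
      (traceNorm ((tensorLeft R a)† ∘L
        (ρ : HilbertTensor A R →L[ℂ] HilbertTensor A R) ∘L tensorLeft R a)).toReal := by
  rw [hρω a a, trace_of_isPositive (hρ.adjoint_conj _)]

theorem ofReal_re_inner (hρω : IsPartialTrace ρ ω)
    (hρ : (ρ : HilbertTensor A R →L[ℂ] HilbertTensor A R).IsPositive) (a : A) :
    ENNReal.ofReal (⟪a, (ω : A →L[ℂ] A) a⟫_ℂ).re =
      traceNorm ((tensorLeft R a)† ∘L
        (ρ : HilbertTensor A R →L[ℂ] HilbertTensor A R) ∘L tensorLeft R a) := by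
  rw [hρω.inner_eq_traceNorm hρ, Complex.ofReal_re,
    ENNReal.ofReal_toReal (traceNorm_compression_lt_top ρ.2 _ _).ne]

theorem isPositive (hρω : IsPartialTrace ρ ω)
    (hρ : (ρ : HilbertTensor A R →L[ℂ] HilbertTensor A R).IsPositive) :
    (ω : A →L[ℂ] A).IsPositive :=
  isPositive_of_forall_inner_nonneg fun a => by
    rw [hρω.inner_eq_traceNorm hρ]
    exact Complex.zero_le_real.2 ENNReal.toReal_nonneg

theorem traceNorm_adjoint_conj (hρω : IsPartialTrace ρ ω)
    (hρ : (ρ : HilbertTensor A R →L[ℂ] HilbertTensor A R).IsPositive) (X : K →L[ℂ] A) :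
    traceNorm ((opTensor X (1 : R →L[ℂ] R))† ∘L
      (ρ : HilbertTensor A R →L[ℂ] HilbertTensor A R) ∘L opTensor X (1 : R →L[ℂ] R)) =
      traceNorm (X† ∘L (ω : A →L[ℂ] A) ∘L X) := by
  rw [traceNorm_of_isPositive (hρ.adjoint_conj _) (productBasis (stdBasis K) (stdBasis R)),
    traceNorm_of_isPositive ((hρω.isPositive hρ).adjoint_conj X) (stdBasis K),
    ENNReal.tsum_prod']
  refine tsum_congr fun i => ?_
  simp only [productBasis_apply, comp_apply, adjoint_inner_right, opTensor_simple,
    one_apply_eq_self]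
  rw [hρω.ofReal_re_inner hρ, traceNorm_of_isPositive (hρ.adjoint_conj _) (stdBasis R)]
  simp only [comp_apply, adjoint_inner_right, tensorLeft_apply]

end IsPartialTrace

end PartialTrace

section Truncation

theorem traceNorm_sub_conj_le {H : Type*} [NormedAddCommGroup H] [InnerProductSpace ℂ H]
    [CompleteSpace H] {ρ P : H →L[ℂ] H} (hρ : ρ.IsPositive) (norm_ρ : traceNorm ρ ≤ 1)
    (hP : IsStarProjection P) {δ : ℝ≥0∞}
    (hδ : traceNorm ((1 - P) ∘L ρ ∘L (1 - P)) ≤ δ ^ 2) :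
    traceNorm (ρ - P ∘L ρ ∘L P) ≤ 2 * δ := by
  obtain ⟨S, adjoint_S, rfl⟩ := exists_isSelfAdjoint_comp_self hρ
  have adjoint_P : P† = P := hP.isSelfAdjoint
  have adjoint_Q : (1 - P)† = 1 - P := hP.one_sub.isSelfAdjoint
  have hsNormSq_S : hsNormSq S ≤ 1 := by
    rwa [← traceNorm_adjoint_comp_self, adjoint_S]
  have hsNormSq_SP : hsNormSq (S ∘L P) ≤ 1 :=
    (hsNormSq_comp_le_of_enorm_le_one S (by
      rw [← ofReal_norm]; exact ENNReal.ofReal_le_one.2 hP.norm_le)).trans hsNormSq_S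
  have hsNormSq_SQ : hsNormSq (S ∘L (1 - P)) ≤ δ ^ 2 := by
    rwa [← traceNorm_adjoint_comp_self, adjoint_comp, adjoint_S, adjoint_Q]
  have split : S ∘L S - P ∘L (S ∘L S) ∘L P =
      (S ∘L (1 - P))† ∘L S + (S ∘L P)† ∘L (S ∘L (1 - P)) := by
    rw [adjoint_comp, adjoint_comp, adjoint_S, adjoint_P, adjoint_Q]
    ext x
    simp
  have left_le : traceNorm ((S ∘L (1 - P))† ∘L S) ≤ δ :=
    (ENNReal.pow_le_pow_left_iff two_ne_zero).1 <|
      (traceNorm_adjoint_comp_sq_le _ _).trans ((mul_le_mul' hsNormSq_SQ hsNormSq_S).trans_eq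
        (mul_one _))
  have right_le : traceNorm ((S ∘L P)† ∘L (S ∘L (1 - P))) ≤ δ :=
    (ENNReal.pow_le_pow_left_iff two_ne_zero).1 <|
      (traceNorm_adjoint_comp_sq_le _ _).trans ((mul_le_mul' hsNormSq_SP hsNormSq_SQ).trans_eq
        (one_mul _))
  rw [split, two_mul]
  exact (traceNorm_add_le _ _).trans (add_le_add left_le right_le)

variable {A B R ι : Type*} [NormedAddCommGroup A] [InnerProductSpace ℂ A]
  [NormedAddCommGroup B] [InnerProductSpace ℂ B]
  [NormedAddCommGroup R] [InnerProductSpace ℂ R] [CompleteSpace R]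
  (τ : HilbertBasis ι ℂ A) (F : Finset ι)

theorem adjoint_tensorLeft_simple (a b : A) (r : R) :
    ((tensorLeft R a)†) (simple b r) = ⟪a, b⟫_ℂ • r :=
  ext_inner_left ℂ fun s => by
    rw [adjoint_inner_right, tensorLeft_apply, inner_simple, inner_smul_right]

theorem opTensor_rankOne (a b : A) (Y : R →L[ℂ] R) :
    opTensor (rankOne ℂ a b) Y = tensorLeft R a ∘L Y ∘L (tensorLeft R b)† :=
  ext_simple fun c r => by
    rw [opTensor_simple, comp_apply, comp_apply, adjoint_tensorLeft_simple, map_smul, map_smul,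
      rankOne_apply, ← tensorRight_apply, map_smul, tensorRight_apply, tensorLeft_apply]

theorem opTensor_basisProj :
    opTensor (basisProj τ F) (1 : R →L[ℂ] R) =
      ∑ k ∈ F, tensorLeft R (τ k) ∘L (tensorLeft R (τ k))† :=
  ext_simple fun a r => by
    simp only [opTensor_simple, basisProj_apply, _root_.sum_apply, one_apply_eq_self, comp_apply,
      adjoint_tensorLeft_simple, map_smul, tensorLeft_apply]
    simp only [← tensorRight_apply, map_sum, map_smul]

variable [CompleteSpace A]

theorem isStarProjection_opTensor {P : A →L[ℂ] A} (hP : IsStarProjection P) :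
    IsStarProjection (opTensor P (1 : R →L[ℂ] R)) := by
  have adjoint_comp_self : (opTensor P (1 : R →L[ℂ] R))† ∘L opTensor P (1 : R →L[ℂ] R) =
      opTensor P (1 : R →L[ℂ] R) := by
    rw [adjoint_opTensor_comp, ← ContinuousLinearMap.star_eq_adjoint,
      ← ContinuousLinearMap.star_eq_adjoint, hP.isSelfAdjoint.star_eq, star_one]
    exact congrArg₂ opTensor hP.isIdempotentElem.eq (one_mul 1)
  have isSelfAdjoint : IsSelfAdjoint (opTensor P (1 : R →L[ℂ] R)) := by
    rw [← adjoint_comp_self]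
    exact (ContinuousLinearMap.isPositive_adjoint_comp_self _).isSelfAdjoint
  refine ⟨?_, isSelfAdjoint⟩
  rwa [← ContinuousLinearMap.star_eq_adjoint, isSelfAdjoint.star_eq] at adjoint_comp_self

theorem opTensor_basisProj_conj (ρ : TraceClass (HilbertTensor A R)) :
    opTensor (basisProj τ F) (1 : R →L[ℂ] R) ∘L
        (ρ : HilbertTensor A R →L[ℂ] HilbertTensor A R) ∘L opTensor (basisProj τ F) 1 =
      ((∑ k ∈ F, ∑ l ∈ F, TraceClass.tensor (TraceClass.rankOne (τ k) (τ l))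
        (TraceClass.compression (tensorLeft R (τ k)) (tensorLeft R (τ l)) ρ) :
          TraceClass (HilbertTensor A R)) : HilbertTensor A R →L[ℂ] HilbertTensor A R) := by
  simp only [opTensor_basisProj, ContinuousLinearMap.finsetSum_comp,
    ContinuousLinearMap.comp_finsetSum, AddSubmonoidClass.coe_finsetSum]
  rw [Finset.sum_comm]
  refine Finset.sum_congr rfl fun k _ => Finset.sum_congr rfl fun l _ => ?_
  change _ = opTensor (rankOne ℂ (τ k) (τ l)) ((tensorLeft R (τ k))† ∘L
    (ρ : HilbertTensor A R →L[ℂ] HilbertTensor A R) ∘L tensorLeft R (τ l))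
  simp only [opTensor_rankOne, comp_assoc]

variable [CompleteSpace B] {H : A →ₗ.[ℂ] A} {τ F} {e : ι → ℝ}
  {ρ : TraceClass (HilbertTensor A R)} {ω : TraceClass A}

theorem ampliationNorm_basisProj_conj_le (Φ : Superoperator A B)
    {ρ' : TraceClass (HilbertTensor A R)}
    (norm_ρ : traceNorm (ρ : HilbertTensor A R →L[ℂ] HilbertTensor A R) ≤ 1)
    (hρ' : (ρ' : HilbertTensor A R →L[ℂ] HilbertTensor A R) = opTensor (basisProj τ F) 1 ∘L
      (ρ : HilbertTensor A R →L[ℂ] HilbertTensor A R) ∘L opTensor (basisProj τ F) 1) :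
    ampliationNorm Φ ρ' ≤
      ∑ k ∈ F, ∑ l ∈ F, traceNorm (Φ (TraceClass.rankOne (τ k) (τ l)) : B →L[ℂ] B) := by
  have enorm_le (k : ι) : ‖tensorLeft R (τ k)‖ₑ ≤ 1 := (enorm_tensorLeft_le _).trans_eq <| by
    rw [← ofReal_norm, τ.orthonormal.1 k, ENNReal.ofReal_one]
  have compression_le (k l : ι) : traceNorm ((tensorLeft R (τ k))† ∘L
      (ρ : HilbertTensor A R →L[ℂ] HilbertTensor A R) ∘L tensorLeft R (τ l)) ≤ 1 :=
    (traceNorm_adjoint_comp_comp_le _ _ _).trans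
      (mul_le_one' (mul_le_one' (enorm_le k) (enorm_le l)) norm_ρ)
  rw [Subtype.ext (hρ'.trans (opTensor_basisProj_conj τ F ρ))]
  refine ((isExtSeminorm_ampliationNorm Φ).sum_le _ _).trans (Finset.sum_le_sum fun k _ => ?_)
  refine ((isExtSeminorm_ampliationNorm Φ).sum_le _ _).trans (Finset.sum_le_sum fun l _ => ?_)
  exact (ampliationNorm_tensor_le Φ _ _).trans (mul_le_of_le_one_right' (compression_le k l))

theorem IsPartialTrace.traceNorm_one_sub_basisProj_conj (hρω : IsPartialTrace ρ ω)
    (hρ : (ρ : HilbertTensor A R →L[ℂ] HilbertTensor A R).IsPositive) :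
    traceNorm ((1 - opTensor (basisProj τ F) (1 : R →L[ℂ] R)) ∘L
      (ρ : HilbertTensor A R →L[ℂ] HilbertTensor A R) ∘L (1 - opTensor (basisProj τ F) 1)) =
      ∑' k : {k // k ∉ F}, ENNReal.ofReal (⟪τ k, (ω : A →L[ℂ] A) (τ k)⟫_ℂ).re := by
  classical
  have one_sub_opTensor : 1 - opTensor (basisProj τ F) (1 : R →L[ℂ] R) =
      opTensor (1 - basisProj τ F) 1 := ext_simple fun a r => by
    simp only [_root_.sub_apply, one_apply_eq_self, opTensor_simple]
    simp only [← tensorRight_apply, map_sub]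
  have adjoint_Q : (1 - opTensor (basisProj τ F) (1 : R →L[ℂ] R))† =
      1 - opTensor (basisProj τ F) 1 :=
    (isStarProjection_opTensor (isStarProjection_basisProj τ F)).one_sub.isSelfAdjoint
  have diagonal (k : ι) : ENNReal.ofReal (⟪τ k, ((1 - basisProj τ F)† ∘L (ω : A →L[ℂ] A) ∘L
      (1 - basisProj τ F)) (τ k)⟫_ℂ).re = {k | k ∉ F}.indicator
        (fun k => ENNReal.ofReal (⟪τ k, (ω : A →L[ℂ] A) (τ k)⟫_ℂ).re) k := by
    rw [comp_apply, comp_apply, adjoint_inner_right, _root_.sub_apply, one_apply_eq_self,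
      basisProj_self]
    by_cases hk : k ∈ F <;> simp [hk]
  nth_rw 1 [← adjoint_Q]
  rw [one_sub_opTensor, hρω.traceNorm_adjoint_conj hρ,
    traceNorm_of_isPositive ((hρω.isPositive hρ).adjoint_conj _) τ, tsum_congr diagonal]
  exact (tsum_subtype {k | k ∉ F} _).symm

theorem IsHamiltonian.traceNorm_sub_basisProj_conj_le (hH : IsHamiltonian H)
    (hτ : ∀ k, (τ k, (e k : ℂ) • τ k) ∈ H.graph) (he : Tendsto e cofinite atTop)
    (hρ : IsState ρ) (hρω : IsPartialTrace ρ ω) {E N : ℝ} (hN : 0 < N)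
    (hω : energy H (ω : A →L[ℂ] A) ≤ ENNReal.ofReal E) (hF : ∀ k ∉ F, N ≤ e k)
    {δ : ℝ≥0∞} (hδ : ENNReal.ofReal (E / N) ≤ δ ^ 2) :
    traceNorm ((ρ : HilbertTensor A R →L[ℂ] HilbertTensor A R) - opTensor (basisProj τ F) 1 ∘L
      (ρ : HilbertTensor A R →L[ℂ] HilbertTensor A R) ∘L opTensor (basisProj τ F) 1) ≤ 2 * δ := by
  have tail_le : ∑' k : {k // k ∉ F}, ENNReal.ofReal (⟪τ k, (ω : A →L[ℂ] A) (τ k)⟫_ℂ).re ≤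
      ENNReal.ofReal (E / N) := by
    rw [ENNReal.ofReal_div_of_pos hN, ENNReal.le_div_iff_mul_le (.inl (by simpa using hN))
      (.inl ENNReal.ofReal_ne_top), mul_comm]
    exact (hH.mul_tsum_notMem_le_energy hτ he (hρω.isPositive hρ.1) hF).trans hω
  refine traceNorm_sub_conj_le hρ.1 (isState_iff.1 hρ).2.le
    (isStarProjection_opTensor (isStarProjection_basisProj τ F)) ?_
  rw [hρω.traceNorm_one_sub_basisProj_conj hρ.1]
  exact tail_le.trans hδ

theorem IsHamiltonian.ecdNorm_le_sum_matrixUnit_add (hH : IsHamiltonian H)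
    (hτ : ∀ k, (τ k, (e k : ℂ) • τ k) ∈ H.graph) (he : Tendsto e cofinite atTop)
    {E N : ℝ} (hN : 0 < N) (hF : ∀ k ∉ F, N ≤ e k) {δ : ℝ≥0∞}
    (hδ : ENNReal.ofReal (E / N) ≤ δ ^ 2) (Φ : Superoperator A B) :
    ecdNorm R H E Φ ≤
      ∑ k ∈ F, ∑ l ∈ F, traceNorm (Φ (TraceClass.rankOne (τ k) (τ l)) : B →L[ℂ] B) +
        4 * diamondNorm R Φ * δ := by
  refine iSup₂_le fun ρ hρ => iSup_le fun ⟨ω, hρω, hω⟩ => ?_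
  obtain ⟨ρ', hρ'⟩ : ∃ ρ' : TraceClass (HilbertTensor A R),
      (ρ' : HilbertTensor A R →L[ℂ] HilbertTensor A R) = opTensor (basisProj τ F) 1 ∘L
        (ρ : HilbertTensor A R →L[ℂ] HilbertTensor A R) ∘L opTensor (basisProj τ F) 1 :=
    ⟨_, (opTensor_basisProj_conj τ F ρ).symm⟩
  have truncation_le : traceNorm ((ρ - ρ' : TraceClass (HilbertTensor A R)) :
      HilbertTensor A R →L[ℂ] HilbertTensor A R) ≤ 2 * δ := by
    rw [Submodule.coe_sub, hρ']
    exact hH.traceNorm_sub_basisProj_conj_le hτ he hρ hρω hN hω hF hδ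
  calc ampliationNorm Φ ρ = ampliationNorm Φ (ρ' + (ρ - ρ')) := by rw [add_sub_cancel]
    _ ≤ ampliationNorm Φ ρ' + ampliationNorm Φ (ρ - ρ') :=
      (isExtSeminorm_ampliationNorm Φ).add_le _ _
    _ ≤ _ + 2 * diamondNorm R Φ * (2 * δ) :=
      add_le_add (ampliationNorm_basisProj_conj_le Φ (isState_iff.1 hρ).2.le hρ')
        ((ampliationNorm_le_two_mul_diamondNorm_mul_traceNorm Φ _).trans (by gcongr))
    _ = _ := by ring

end Truncation

section PositiveForm

variable {V : Type*} [AddCommGroup V] [Module ℂ V]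

theorem conj_form_eq (q : V →ₗ⋆[ℂ] V →ₗ[ℂ] ℂ) (hq : ∀ u, 0 ≤ q u u) (u v : V) :
    (starRingEnd ℂ) (q v u) = q u v := by
  have im_eq_zero (x : V) : (q x x).im = 0 := (Complex.nonneg_iff.1 (hq x)).2.symm
  have im_add := im_eq_zero (u + v)
  have im_add_I_smul := im_eq_zero (u + Complex.I • v)
  simp only [map_add, LinearMap.add_apply, map_smulₛₗ, LinearMap.smul_apply, smul_eq_mul,
    Complex.add_im, im_eq_zero, Complex.mul_im, Complex.conj_I, Complex.neg_re, Complex.neg_im,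
    Complex.I_re, Complex.I_im, RingHom.id_apply, Complex.add_re, Complex.mul_re]
    at im_add im_add_I_smul
  apply Complex.ext
  · rw [Complex.conj_re]
    linarith
  · rw [Complex.conj_im]
    linarith

theorem exists_linearMap_inner_eq {V : Type u} [AddCommGroup V] [Module ℂ V]
    (q : V →ₗ⋆[ℂ] V →ₗ[ℂ] ℂ) (hq : ∀ u, 0 ≤ q u u) :
    ∃ (W : Type u) (_ : NormedAddCommGroup W) (_ : InnerProductSpace ℂ W) (_ : CompleteSpace W)
      (J : V →ₗ[ℂ] W), ∀ u v, ⟪J u, J v⟫_ℂ = q u v := by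
  let core : PreInnerProductSpace.Core ℂ V :=
    { inner := fun u v => q u v
      conj_inner_symm := conj_form_eq q hq
      re_inner_nonneg := fun u => (Complex.nonneg_iff.1 (hq u)).1
      add_left := fun x y z => by rw [map_add, LinearMap.add_apply]
      smul_left := fun x y r => by rw [map_smulₛₗ, LinearMap.smul_apply, smul_eq_mul] }
  let _ : SeminormedAddCommGroup V :=
    @InnerProductSpace.Core.toSeminormedAddCommGroup ℂ V _ _ _ core
  let _ : InnerProductSpace ℂ V := InnerProductSpace.ofCore core
  exact ⟨UniformSpace.Completion V, inferInstance, inferInstance, inferInstance,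
    (UniformSpace.Completion.toComplL : V →L[ℂ] UniformSpace.Completion V).toLinearMap,
    fun u v => UniformSpace.Completion.inner_coe u v⟩

theorem exists_isPositive_inner_completion_eq {V W : Type*} [NormedAddCommGroup V]
    [InnerProductSpace ℂ V] [NormedAddCommGroup W] [InnerProductSpace ℂ W] [CompleteSpace W]
    (J : V →L[ℂ] W) :
    ∃ σ : UniformSpace.Completion V →L[ℂ] UniformSpace.Completion V, σ.IsPositive ∧
      ∀ u v : V, ⟪(u : UniformSpace.Completion V), σ v⟫_ℂ = ⟪J u, J v⟫_ℂ := by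
  let S : UniformSpace.Completion V →L[ℂ] W := J.extend UniformSpace.Completion.toComplL
  have S_coe (v : V) : S v = J v := J.extend_eq (e := UniformSpace.Completion.toComplL)
    UniformSpace.Completion.denseRange_coe (UniformSpace.Completion.isUniformInducing_coe _) v
  refine ⟨S† ∘L S, ContinuousLinearMap.isPositive_adjoint_comp_self S, fun u v => ?_⟩
  rw [comp_apply, adjoint_inner_right, S_coe, S_coe]

end PositiveForm

section TensorRepresentation

variable {B R : Type*} [NormedAddCommGroup B] [InnerProductSpace ℂ B]
  [NormedAddCommGroup R] [InnerProductSpace ℂ R]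

theorem exists_orthonormal_sum_tmul (u : B ⊗[ℂ] R) :
    ∃ (n : ℕ) (r : Fin n → R) (b : Fin n → B), Orthonormal ℂ r ∧ u = ∑ i, b i ⊗ₜ[ℂ] r i := by
  classical
  obtain ⟨s, rfl⟩ := TensorProduct.exists_finset u
  let N : Submodule ℂ R := Submodule.span ℂ (s.image Prod.snd)
  let f := stdOrthonormalBasis ℂ N
  have expand (p : B × R) (hp : p ∈ s) : p.2 = ∑ i, ⟪(f i : R), p.2⟫_ℂ • (f i : R) := by
    have mem : p.2 ∈ N := Submodule.subset_span (Finset.mem_image_of_mem _ hp)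
    simpa using congrArg Subtype.val (f.sum_repr' ⟨p.2, mem⟩).symm
  refine ⟨_, fun i => (f i : R), fun i => ∑ p ∈ s, ⟪(f i : R), p.2⟫_ℂ • p.1,
    f.orthonormal.comp_linearIsometry N.subtypeₗᵢ, ?_⟩
  simp only [TensorProduct.sum_tmul, TensorProduct.smul_tmul]
  rw [Finset.sum_comm]
  refine Finset.sum_congr rfl fun p hp => ?_
  rw [← TensorProduct.tmul_sum, ← expand p hp]

theorem norm_sum_tmul_sq {n : ℕ} {r : Fin n → R} (hr : Orthonormal ℂ r) (b : Fin n → B) :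
    ‖∑ i, b i ⊗ₜ[ℂ] r i‖ ^ 2 = ∑ i, ‖b i‖ ^ 2 := by
  have inner_self : ⟪∑ i, b i ⊗ₜ[ℂ] r i, ∑ i, b i ⊗ₜ[ℂ] r i⟫_ℂ = ∑ i, ⟪b i, b i⟫_ℂ := by
    simp [sum_inner, inner_sum, TensorProduct.inner_tmul, orthonormal_iff_ite.1 hr]
  have re_eq := congrArg Complex.re inner_self
  rw [Complex.re_sum] at re_eq
  rw [← inner_self_eq_norm_sq (𝕜 := ℂ)]
  exact re_eq.trans (Finset.sum_congr rfl fun i _ => inner_self_eq_norm_sq (𝕜 := ℂ) (b i))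

end TensorRepresentation

section AmpliationForm

variable {A B R : Type*} [NormedAddCommGroup A] [InnerProductSpace ℂ A] [CompleteSpace A]
  [NormedAddCommGroup B] [InnerProductSpace ℂ B]
  [NormedAddCommGroup R] [InnerProductSpace ℂ R]

theorem entry_add_left (r r' s : R) (T : TraceClass (HilbertTensor A R)) :
    entry (r + r') s T = entry r s T + entry r' s T :=
  Subtype.ext (by
    simp only [entry, tensorRight, map_add, Submodule.coe_add, ContinuousLinearMap.comp_add,
      ContinuousLinearMap.add_comp])

theorem entry_smul_left (r s : R) (c : ℂ) (T : TraceClass (HilbertTensor A R)) :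
    entry (c • r) s T = (starRingEnd ℂ c) • entry r s T :=
  Subtype.ext (by
    simp only [entry, tensorRight, map_smul, map_smulₛₗ, Submodule.coe_smul,
      ContinuousLinearMap.comp_smul, ContinuousLinearMap.smul_comp])

variable [CompleteSpace B]

/-- The sesquilinear form `(b ⊗ r, c ⊗ s) ↦ ⟨b, Φ(ρ_rs) c⟩` on the algebraic tensor product, where
`ρ_rs` is the `(r, s)` entry of `ρ`: the form of the operator `(Φ ⊗ id_R)(ρ)`, if that exists. -/
def ampliationForm (Φ : Superoperator A B) (ρ : TraceClass (HilbertTensor A R)) :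
    (B ⊗[ℂ] R) →ₗ⋆[ℂ] (B ⊗[ℂ] R) →ₗ[ℂ] ℂ :=
  TensorProduct.lift (LinearMap.mk₂'ₛₗ (starRingEnd ℂ) (starRingEnd ℂ)
    (fun b r => TensorProduct.lift (LinearMap.mk₂ ℂ
      (fun c s => ⟪b, (Φ (entry r s ρ) : B →L[ℂ] B) c⟫_ℂ)
      (fun c c' s => by rw [map_add, inner_add_right])
      (fun z c s => by rw [map_smul, inner_smul_right]; rfl)
      (fun c s s' => by
        rw [entry_add_right, map_add, Submodule.coe_add, _root_.add_apply, inner_add_right])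
      (fun z c s => by
        rw [entry_smul_right, map_smul, Submodule.coe_smul, _root_.smul_apply, inner_smul_right]
        rfl)))
    (fun b b' r => TensorProduct.ext' fun c s => by simp)
    (fun z b r => TensorProduct.ext' fun c s => by simp [mul_comm])
    (fun b r r' => TensorProduct.ext' fun c s => by simp [entry_add_left])
    (fun z b r => TensorProduct.ext' fun c s => by simp [entry_smul_left]))

theorem ampliationForm_tmul (Φ : Superoperator A B) (ρ : TraceClass (HilbertTensor A R))
    (b c : B) (r s : R) :
    ampliationForm Φ ρ (b ⊗ₜ r) (c ⊗ₜ s) = ⟪b, (Φ (entry r s ρ) : B →L[ℂ] B) c⟫_ℂ := rfl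

end AmpliationForm

section Blocks

theorem isPositive_iff_blockPositive {K : Type*} [NormedAddCommGroup K] [InnerProductSpace ℂ K]
    (T : K →L[ℂ] K) :
    T.IsPositive ↔ BlockPositive fun _ _ : Fin 1 => T :=
  ⟨fun hT x => by simpa using hT.inner_nonneg_right (x 0),
    fun hT => isPositive_of_forall_inner_nonneg fun x => by simpa using hT fun _ => x⟩

variable {A R : Type*} [NormedAddCommGroup A] [InnerProductSpace ℂ A] [CompleteSpace A]
  [NormedAddCommGroup R] [InnerProductSpace ℂ R]
  {ρ : TraceClass (HilbertTensor A R)}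

theorem blockPositive_entry
    (hρ : (ρ : HilbertTensor A R →L[ℂ] HilbertTensor A R).IsPositive) {n : ℕ} (r : Fin n → R) :
    BlockPositive fun i j => (entry (r i) (r j) ρ : A →L[ℂ] A) := by
  intro x
  have sum_eq : ∑ i, ∑ j, ⟪x i, (entry (r i) (r j) ρ : A →L[ℂ] A) (x j)⟫_ℂ =
      ⟪∑ i, tensorRight A (r i) (x i), (ρ : HilbertTensor A R →L[ℂ] HilbertTensor A R)
        (∑ j, tensorRight A (r j) (x j))⟫_ℂ := by
    simp only [map_sum, sum_inner, inner_sum, ← adjoint_inner_right (tensorRight A _)]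
    exact Finset.sum_comm
  rw [sum_eq]
  exact hρ.inner_nonneg_right _

theorem isPositive_entry (hρ : (ρ : HilbertTensor A R →L[ℂ] HilbertTensor A R).IsPositive)
    (r : R) : (entry r r ρ : A →L[ℂ] A).IsPositive :=
  hρ.adjoint_conj (tensorRight A r)

variable [CompleteSpace R]

theorem traceNorm_eq_tsum_block {T : HilbertTensor A R →L[ℂ] HilbertTensor A R}
    (hT : T.IsPositive) {κ : Type*} (c : HilbertBasis κ ℂ R) :
    traceNorm T =
      ∑' j, traceNorm ((tensorRight A (c j))† ∘L T ∘L tensorRight A (c j)) := by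
  rw [traceNorm_of_isPositive hT (productBasis (stdBasis A) c), ENNReal.tsum_prod',
    ENNReal.tsum_comm]
  refine tsum_congr fun j => ?_
  rw [traceNorm_of_isPositive (hT.adjoint_conj (tensorRight A (c j))) (stdBasis A)]
  refine tsum_congr fun i => ?_
  rw [productBasis_apply, comp_apply, adjoint_inner_right]
  rfl

theorem sum_traceNorm_entry_le
    (hρ : (ρ : HilbertTensor A R →L[ℂ] HilbertTensor A R).IsPositive) {n : ℕ} {r : Fin n → R}
    (hr : Orthonormal ℂ r) : ∑ i, traceNorm (entry (r i) (r i) ρ : A →L[ℂ] A) ≤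
      traceNorm (ρ : HilbertTensor A R →L[ℂ] HilbertTensor A R) := by
  obtain ⟨W, c, hW, hc⟩ := hr.toSubtypeRange.exists_hilbertBasis_extension
  have injective : Function.Injective fun i => (⟨r i, hW ⟨i, rfl⟩⟩ : W) := fun i j h =>
    hr.linearIndependent.injective (congrArg Subtype.val h)
  calc ∑ i, traceNorm (entry (r i) (r i) ρ : A →L[ℂ] A)
      = ∑' i, traceNorm (entry (c ⟨r i, hW ⟨i, rfl⟩⟩) (c ⟨r i, hW ⟨i, rfl⟩⟩) ρ : A →L[ℂ] A) := by
        simp only [hc, tsum_fintype]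
    _ ≤ ∑' w, traceNorm (entry (c w) (c w) ρ : A →L[ℂ] A) :=
        ENNReal.tsum_comp_le_tsum_of_injective injective _
    _ = traceNorm (ρ : HilbertTensor A R →L[ℂ] HilbertTensor A R) :=
        (traceNorm_eq_tsum_block hρ c).symm

end Blocks

section Channel

variable {A B : Type*} [NormedAddCommGroup A] [InnerProductSpace ℂ A] [CompleteSpace A]
  [NormedAddCommGroup B] [InnerProductSpace ℂ B] [CompleteSpace B]
  {Φ : Superoperator A B}

namespace IsChannel

theorem isPositive_map (hΦ : IsChannel Φ) {T : TraceClass A} (hT : (T : A →L[ℂ] A).IsPositive) :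
    (Φ T : B →L[ℂ] B).IsPositive :=
  (isPositive_iff_blockPositive _).2
    (hΦ.1 1 (fun _ _ => T) ((isPositive_iff_blockPositive _).1 hT))

theorem traceNorm_map (hΦ : IsChannel Φ) {T : TraceClass A} (hT : (T : A →L[ℂ] A).IsPositive) :
    traceNorm (Φ T : B →L[ℂ] B) = traceNorm (T : A →L[ℂ] A) := by
  have trace_eq := hΦ.2 T
  rw [trace_of_isPositive hT, trace_of_isPositive (hΦ.isPositive_map hT)] at trace_eq
  exact (ENNReal.toReal_eq_toReal_iff' (ne_of_lt (Φ T).2) (ne_of_lt T.2)).1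
    (Complex.ofReal_injective trace_eq)

theorem norm_inner_map_self_le (hΦ : IsChannel Φ) {T : TraceClass A}
    (hT : (T : A →L[ℂ] A).IsPositive) (b : B) :
    ‖⟪b, (Φ T : B →L[ℂ] B) b⟫_ℂ‖ ≤ (traceNorm (T : A →L[ℂ] A)).toReal * ‖b‖ ^ 2 := by
  have enorm_le := enorm_inner_le_traceNorm (Φ T : B →L[ℂ] B) b b
  rw [hΦ.traceNorm_map hT] at enorm_le
  have norm_le := ENNReal.toReal_mono
    (ENNReal.mul_ne_top (ENNReal.mul_ne_top enorm_ne_top enorm_ne_top) (ne_of_lt T.2)) enorm_le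
  rw [ENNReal.toReal_mul, ENNReal.toReal_mul, toReal_enorm, toReal_enorm] at norm_le
  linarith

variable {R : Type*} [NormedAddCommGroup R] [InnerProductSpace ℂ R]
  {ρ : TraceClass (HilbertTensor A R)}

theorem ampliationForm_self_nonneg (hΦ : IsChannel Φ)
    (hρ : (ρ : HilbertTensor A R →L[ℂ] HilbertTensor A R).IsPositive) (u : B ⊗[ℂ] R) :
    0 ≤ ampliationForm Φ ρ u u := by
  obtain ⟨n, r, b, -, rfl⟩ := exists_orthonormal_sum_tmul u
  refine (hΦ.1 n (fun i j => entry (r i) (r j) ρ) (blockPositive_entry hρ r) b).trans_eq ?_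
  simp only [map_sum, LinearMap.sum_apply, ampliationForm_tmul]
  exact Finset.sum_comm

variable [CompleteSpace R]

theorem norm_le_sqrt_traceNorm_mul (hΦ : IsChannel Φ)
    (hρ : (ρ : HilbertTensor A R →L[ℂ] HilbertTensor A R).IsPositive)
    {W : Type*} [NormedAddCommGroup W] [InnerProductSpace ℂ W] (J : B ⊗[ℂ] R →ₗ[ℂ] W)
    (hJ : ∀ u v, ⟪J u, J v⟫_ℂ = ampliationForm Φ ρ u v) (u : B ⊗[ℂ] R) :
    ‖J u‖ ≤ √(traceNorm (ρ : HilbertTensor A R →L[ℂ] HilbertTensor A R)).toReal * ‖u‖ := by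
  obtain ⟨n, r, b, hr, rfl⟩ := exists_orthonormal_sum_tmul u
  let t : Fin n → ℝ := fun i => (traceNorm (entry (r i) (r i) ρ : A →L[ℂ] A)).toReal
  have norm_tmul_le (i : Fin n) : ‖J (b i ⊗ₜ r i)‖ ≤ √(t i) * √(‖b i‖ ^ 2) := by
    rw [← Real.sqrt_mul ENNReal.toReal_nonneg]
    refine Real.le_sqrt_of_sq_le ?_
    rw [@norm_sq_eq_re_inner ℂ, hJ, ampliationForm_tmul]
    exact (Complex.re_le_norm _).trans <| hΦ.norm_inner_map_self_le (isPositive_entry hρ _) (b i)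
  have sum_le : ∑ i, t i ≤
      (traceNorm (ρ : HilbertTensor A R →L[ℂ] HilbertTensor A R)).toReal := by
    rw [← ENNReal.toReal_sum fun i _ => (entry (r i) (r i) ρ).2.ne]
    exact ENNReal.toReal_mono (ne_of_lt ρ.2) (sum_traceNorm_entry_le hρ hr)
  calc ‖J (∑ i, b i ⊗ₜ[ℂ] r i)‖
      ≤ ∑ i, √(t i) * √(‖b i‖ ^ 2) := by
        rw [map_sum]
        exact norm_sum_le_of_le _ fun i _ => norm_tmul_le i
    _ ≤ √(∑ i, t i) * √(∑ i, ‖b i‖ ^ 2) :=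
        Real.sum_sqrt_mul_sqrt_le _ (fun _ => ENNReal.toReal_nonneg) fun _ => sq_nonneg _
    _ ≤ √(traceNorm (ρ : HilbertTensor A R →L[ℂ] HilbertTensor A R)).toReal *
          ‖∑ i, b i ⊗ₜ[ℂ] r i‖ := by
        rw [← norm_sum_tmul_sq hr, Real.sqrt_sq (norm_nonneg _)]
        gcongr

theorem exists_isPositive_block_eq (hΦ : IsChannel Φ)
    (hρ : (ρ : HilbertTensor A R →L[ℂ] HilbertTensor A R).IsPositive) :
    ∃ σ : HilbertTensor B R →L[ℂ] HilbertTensor B R, σ.IsPositive ∧ ∀ r s : R,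
      (tensorRight B r)† ∘L σ ∘L tensorRight B s = (Φ (entry r s ρ) : B →L[ℂ] B) := by
  obtain ⟨W, _, _, _, J, hJ⟩ :=
    exists_linearMap_inner_eq (ampliationForm Φ ρ) (hΦ.ampliationForm_self_nonneg hρ)
  obtain ⟨σ, hσ, inner_eq⟩ := exists_isPositive_inner_completion_eq
    (J.mkContinuous _ (hΦ.norm_le_sqrt_traceNorm_mul hρ J hJ))
  refine ⟨σ, hσ, fun r s => ContinuousLinearMap.ext fun c => ext_inner_left ℂ fun b => ?_⟩
  rw [comp_apply, adjoint_inner_right]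
  exact (inner_eq (b ⊗ₜ r) (c ⊗ₜ s)).trans (hJ _ _)

variable (R) in
theorem diamondNorm_le (hΦ : IsChannel Φ) : diamondNorm R Φ ≤ 1 := by
  refine iSup₂_le fun ρ hρ => ?_
  obtain ⟨ρ_pos, ρ_norm⟩ := isState_iff.1 hρ
  obtain ⟨σ, hσ, block_eq⟩ := hΦ.exists_isPositive_block_eq ρ_pos
  have σ_norm : traceNorm σ = 1 := by
    rw [traceNorm_eq_tsum_block hσ (stdBasis R), ← ρ_norm,
      traceNorm_eq_tsum_block ρ_pos (stdBasis R)]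
    refine tsum_congr fun j => ?_
    rw [block_eq, hΦ.traceNorm_map (isPositive_entry ρ_pos _)]
    rfl
  have σ_lt_top : traceNorm σ < ⊤ := σ_norm ▸ ENNReal.one_lt_top
  exact (iInf₂_le (⟨σ, σ_lt_top⟩ : TraceClass (HilbertTensor B R))
    fun r s => Subtype.ext (block_eq r s)).trans_eq σ_norm

end IsChannel

end Channel

section SeminormTopology

variable {V κ : Type*} [AddCommGroup V]

/-- The topology defined by the gauges `v ↦ q k v`, generated by their open balls. -/
abbrev seminormTopology (q : κ → V → ℝ≥0∞) : TopologicalSpace V :=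
  .generateFrom {U | ∃ (k : κ) (v₀ : V) (ε : ℝ≥0∞), 0 < ε ∧ U = {v | q k (v - v₀) < ε}}

variable [Module ℂ V] {q : κ → V → ℝ≥0∞}

theorem tendsto_nhds_seminormTopology (hq : ∀ k, IsExtSeminorm (q k)) {α : Type*} {l : Filter α}
    {f : α → V} {v : V} :
    Tendsto f l (@nhds V (seminormTopology q) v) ↔
      ∀ k, Tendsto (fun a => q k (f a - v)) l (𝓝 0) := by
  rw [TopologicalSpace.tendsto_nhds_generateFrom_iff]
  constructor
  · refine fun h k => ENNReal.tendsto_nhds_zero.2 fun ε hε => ?_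
    have self_mem : q k (v - v) < ε := by rwa [sub_self, (hq k).map_zero]
    filter_upwards [h _ ⟨k, v, ε, hε, rfl⟩ self_mem] with a ha using le_of_lt ha
  · rintro h _ ⟨k, v₀, ε, -, rfl⟩ (hv : q k (v - v₀) < ε)
    filter_upwards [(h k).eventually_lt_const (tsub_pos_of_lt hv)] with a ha
    calc q k (f a - v₀) = q k ((f a - v) + (v - v₀)) := by rw [sub_add_sub_cancel]
      _ ≤ q k (f a - v) + q k (v - v₀) := (hq k).add_le _ _
      _ < ε := lt_tsub_iff_right.1 ha

theorem induced_seminormTopology_le {κ' : Type*} {p : κ' → V → ℝ≥0∞}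
    (hp : ∀ k, IsExtSeminorm (p k)) (hq : ∀ k, IsExtSeminorm (q k)) {D 𝓢 : Set V}
    (h𝓢 : ∀ v ∈ 𝓢, ∀ w ∈ 𝓢, v - w ∈ D) (hqp : ∀ k, Tendsto (p k) (nullFilter D q) (𝓝 0)) :
    (seminormTopology q).induced ((↑) : 𝓢 → V) ≤ (seminormTopology p).induced (↑) := by
  refine le_of_nhds_le_nhds fun v => ?_
  rw [@nhds_induced _ _ (seminormTopology q), @nhds_induced _ _ (seminormTopology p),
    ← tendsto_iff_comap, tendsto_nhds_seminormTopology hp]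
  exact fun k => (hqp k).comp <| tendsto_nullFilter.2
    ⟨.of_forall fun w => h𝓢 w w.2 v v.2, (tendsto_nhds_seminormTopology hq).1 tendsto_comap⟩

end SeminormTopology

section Main

variable {A B R : Type*} [NormedAddCommGroup A] [InnerProductSpace ℂ A] [CompleteSpace A]
  [NormedAddCommGroup B] [InnerProductSpace ℂ B] [CompleteSpace B]

theorem OpNormLE.sub {Φ Ψ : Superoperator A B} {C D : ℝ≥0∞} (hΦ : OpNormLE Φ C)
    (hΨ : OpNormLE Ψ D) : OpNormLE (Φ - Ψ) (C + D) := fun T =>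
  ((isExtSeminorm_traceNorm_eval T).sub_le Φ Ψ).trans
    ((add_le_add (hΦ T) (hΨ T)).trans_eq (add_mul _ _ _).symm)

/-- The seminorms `Φ ↦ ‖Φ(ρ)‖₁`, `ρ` a state, which define the strong convergence topology. -/
def strongSeminorm (ρ : {ρ : TraceClass A // IsState ρ}) (Φ : Superoperator A B) : ℝ≥0∞ :=
  traceNorm (Φ ρ : B →L[ℂ] B)

theorem isExtSeminorm_strongSeminorm (ρ : {ρ : TraceClass A // IsState ρ}) :
    IsExtSeminorm (strongSeminorm (B := B) ρ) :=
  isExtSeminorm_traceNorm_eval ρ.1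

variable (A B) in
theorem strongTopology_eq_seminormTopology :
    strongTopology A B = seminormTopology strongSeminorm := by
  refine congrArg _ (Set.ext fun U => ⟨?_, ?_⟩)
  · rintro ⟨ρ, Φ₀, ε, hρ, hε, rfl⟩
    exact ⟨⟨ρ, hρ⟩, Φ₀, ε, hε, rfl⟩
  · rintro ⟨⟨ρ, hρ⟩, Φ₀, ε, hε, rfl⟩
    exact ⟨ρ, Φ₀, ε, hρ, hε, rfl⟩

variable [NormedAddCommGroup R] [InnerProductSpace ℂ R] [CompleteSpace R]
  {H : A →ₗ.[ℂ] A} {E : ℝ}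

theorem diamondNorm_sub_le (Φ Ψ : Superoperator A B) :
    diamondNorm R (Φ - Ψ) ≤ diamondNorm R Φ + diamondNorm R Ψ :=
  isExtSeminorm_diamondNorm.sub_le Φ Ψ

variable (B R H E) in
theorem ecdTopology_eq_seminormTopology :
    ecdTopology B R H E = seminormTopology fun _ : Unit => ecdNorm R H E :=
  congrArg _ (Set.ext fun U => by simp)

namespace IsHamiltonian

theorem tendsto_traceNorm_map [Nontrivial R] (hH : IsHamiltonian H)
    (hE : groundEnergy H < (E : EReal)) {C : ℝ≥0∞} (hC : C ≠ ⊤) (T : TraceClass A) :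
    Tendsto (fun Φ : Superoperator A B => traceNorm (Φ T : B →L[ℂ] B))
      (nullFilter {Φ | OpNormLE Φ C} fun _ : Unit => ecdNorm R H E) (𝓝 0) := by
  set 𝓕 := nullFilter {Φ : Superoperator A B | OpNormLE Φ C} fun _ : Unit => ecdNorm R H E
  have eventually_opNormLE : ∀ᶠ Φ in 𝓕, OpNormLE Φ C := eventually_mem_nullFilter
  have ecdNorm_tendsto : Tendsto (ecdNorm R H E) 𝓕 (𝓝 0) :=
    tendsto_gauge_nullFilter (q := fun _ : Unit => ecdNorm R H E) ()
  have T_mem : T ∈ nullSubmodule 𝓕 :=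
    hH.nullSubmodule_eq_top hE hC eventually_opNormLE ecdNorm_tendsto ▸ Submodule.mem_top
  exact mem_nullSubmodule.1 T_mem

theorem eq_zero_of_ecdNorm_eq_zero [Nontrivial R] (hH : IsHamiltonian H)
    (hE : groundEnergy H < (E : EReal)) {C : ℝ≥0∞} (hC : C ≠ ⊤) {Φ : Superoperator A B}
    (hΦ : OpNormLE Φ C) (h : ecdNorm R H E Φ = 0) : Φ = 0 :=
  LinearMap.ext fun T => Subtype.ext <| eq_zero_of_traceNorm_eq_zero <|
    eq_zero_of_tendsto_nullFilter (hH.tendsto_traceNorm_map hE hC T) hΦ fun _ => h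

theorem strongConvergence_of_ecdConvergence [Nontrivial R] (hH : IsHamiltonian H)
    (hE : groundEnergy H < (E : EReal)) {C : ℝ≥0∞} (hC : C ≠ ⊤) {Φ : ℕ → Superoperator A B}
    {Φ₀ : Superoperator A B} (hΦ : ∀ n, OpNormLE (Φ n) C) (hΦ₀ : OpNormLE Φ₀ C)
    (h : EcdConvergence R H E Φ Φ₀) : StrongConvergence Φ Φ₀ := by
  intro ρ _
  have sub_tendsto : Tendsto (fun n => Φ n - Φ₀) atTop
      (nullFilter {Ψ | OpNormLE Ψ (C + C)} fun _ : Unit => ecdNorm R H E) :=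
    tendsto_nullFilter.2 ⟨.of_forall fun n => (hΦ n).sub hΦ₀, fun _ => h⟩
  simpa only [Function.comp_def, LinearMap.sub_apply] using
    (hH.tendsto_traceNorm_map hE (ENNReal.add_ne_top.2 ⟨hC, hC⟩) ρ).comp sub_tendsto

variable {ι : Type*} {τ : HilbertBasis ι ℂ A} {e : ι → ℝ}

theorem tendsto_ecdNorm (hH : IsHamiltonian H) (hτ : ∀ k, (τ k, (e k : ℂ) • τ k) ∈ H.graph)
    (he : Tendsto e cofinite atTop) {C : ℝ≥0∞} (hC : C ≠ ⊤) :
    Tendsto (ecdNorm R H E)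
      (nullFilter {Φ : Superoperator A B | diamondNorm R Φ ≤ C} strongSeminorm) (𝓝 0) := by
  set 𝓕 := nullFilter {Φ : Superoperator A B | diamondNorm R Φ ≤ C} strongSeminorm
  have mem_nullSubmodule_all (T : TraceClass A) : T ∈ nullSubmodule 𝓕 := by
    have le_nullSubmodule : Submodule.span ℂ {ρ : TraceClass A | IsState ρ} ≤ nullSubmodule 𝓕 :=
      Submodule.span_le.2 fun ρ hρ => mem_nullSubmodule.2
        (tendsto_gauge_nullFilter (q := strongSeminorm) ⟨ρ, hρ⟩)
    exact le_nullSubmodule (by rw [span_isState_eq_top]; exact Submodule.mem_top)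
  refine tendsto_zero_of_forall_eventually_le_add (ENNReal.mul_ne_top ENNReal.ofNat_ne_top hC)
    (K := 4 * C) fun δ hδ => ?_
  have div_tendsto : Tendsto (fun N => ENNReal.ofReal (E / N)) atTop (𝓝 0) := by
    simpa using ENNReal.tendsto_ofReal (tendsto_const_nhds (x := E).div_atTop tendsto_id)
  obtain ⟨N, hN, hδN⟩ := ((eventually_gt_atTop 0).and
    (ENNReal.tendsto_nhds_zero.1 div_tendsto _ (ENNReal.pow_pos (pos_iff_ne_zero.2 hδ) 2))).exists
  obtain ⟨F, hF⟩ := exists_finset_le he N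
  refine ⟨fun Φ => ∑ k ∈ F, ∑ l ∈ F,
    traceNorm (Φ (TraceClass.rankOne (τ k) (τ l)) : B →L[ℂ] B), ?_, ?_⟩
  · simpa only [Finset.sum_const_zero] using tendsto_finsetSum F fun k _ =>
      tendsto_finsetSum F fun l _ =>
        mem_nullSubmodule.1 (mem_nullSubmodule_all (TraceClass.rankOne (τ k) (τ l)))
  · filter_upwards [eventually_mem_nullFilter] with Φ (hΦ : diamondNorm R Φ ≤ C)
    refine (hH.ecdNorm_le_sum_matrixUnit_add hτ he hN
      (fun k hk => (not_le.1 (mt (hF k).2 hk)).le) hδN Φ).trans ?_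
    gcongr

theorem ecdConvergence_of_strongConvergence (hH : IsHamiltonian H)
    (hτ : ∀ k, (τ k, (e k : ℂ) • τ k) ∈ H.graph) (he : Tendsto e cofinite atTop)
    {C : ℝ≥0∞} (hC : C ≠ ⊤) {Φ : ℕ → Superoperator A B} {Φ₀ : Superoperator A B}
    (hΦ : ∀ n, diamondNorm R (Φ n) ≤ C) (hΦ₀ : diamondNorm R Φ₀ ≤ C)
    (h : StrongConvergence Φ Φ₀) : EcdConvergence R H E Φ Φ₀ := by
  have sub_tendsto : Tendsto (fun n => Φ n - Φ₀) atTop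
      (nullFilter {Ψ | diamondNorm R Ψ ≤ C + C} strongSeminorm) :=
    tendsto_nullFilter.2 ⟨.of_forall fun n =>
      (diamondNorm_sub_le (Φ n) Φ₀).trans (add_le_add (hΦ n) hΦ₀), fun ρ => h ρ ρ.2⟩
  exact (hH.tendsto_ecdNorm hτ he (ENNReal.add_ne_top.2 ⟨hC, hC⟩)).comp sub_tendsto

theorem sameTopologyOn [Nontrivial R] (hH : IsHamiltonian H) (hE : groundEnergy H < (E : EReal))
    (hτ : ∀ k, (τ k, (e k : ℂ) • τ k) ∈ H.graph) (he : Tendsto e cofinite atTop)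
    {C : ℝ≥0∞} (hC : C ≠ ⊤) {𝓢 : Set (Superoperator A B)} (h𝓢 : ∀ Φ ∈ 𝓢, diamondNorm R Φ ≤ C) :
    SameTopologyOn R H E 𝓢 := by
  have diamondNorm_sub_mem : ∀ Φ ∈ 𝓢, ∀ Ψ ∈ 𝓢, diamondNorm R (Φ - Ψ) ≤ C + C :=
    fun Φ hΦ Ψ hΨ => (diamondNorm_sub_le Φ Ψ).trans (add_le_add (h𝓢 Φ hΦ) (h𝓢 Ψ hΨ))
  have opNormLE_sub : ∀ Φ ∈ 𝓢, ∀ Ψ ∈ 𝓢, OpNormLE (Φ - Ψ) (2 * (C + C)) :=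
    fun Φ hΦ Ψ hΨ T => (opNormLE_two_mul_diamondNorm (R := R) (Φ - Ψ) T).trans
      (by gcongr; exact diamondNorm_sub_mem Φ hΦ Ψ hΨ)
  have add_ne_top : C + C ≠ ⊤ := ENNReal.add_ne_top.2 ⟨hC, hC⟩
  have mul_ne_top : 2 * (C + C) ≠ ⊤ := ENNReal.mul_ne_top ENNReal.ofNat_ne_top add_ne_top
  rw [SameTopologyOn, ecdTopology_eq_seminormTopology, strongTopology_eq_seminormTopology]
  apply le_antisymm
  · exact induced_seminormTopology_le (D := {Φ | OpNormLE Φ (2 * (C + C))})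
      isExtSeminorm_strongSeminorm (fun _ => isExtSeminorm_ecdNorm H E) opNormLE_sub
      fun ρ => hH.tendsto_traceNorm_map hE mul_ne_top ρ.1
  · exact induced_seminormTopology_le (D := {Φ | diamondNorm R Φ ≤ C + C})
      (fun _ => isExtSeminorm_ecdNorm H E) isExtSeminorm_strongSeminorm diamondNorm_sub_mem
      fun _ => hH.tendsto_ecdNorm hτ he add_ne_top

theorem ecdConvergence_iff_and_sameTopologyOn [Nontrivial R] (hH : IsHamiltonian H)
    (hE : groundEnergy H < (E : EReal)) (hτ : ∀ k, (τ k, (e k : ℂ) • τ k) ∈ H.graph)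
    (he : Tendsto e cofinite atTop) {C : ℝ≥0∞} (hC : C ≠ ⊤) {𝓢 : Set (Superoperator A B)}
    (h𝓢 : ∀ Φ ∈ 𝓢, diamondNorm R Φ ≤ C) :
    (∀ (Φ : ℕ → Superoperator A B) (Φ₀ : Superoperator A B), (∀ n, Φ n ∈ 𝓢) → Φ₀ ∈ 𝓢 →
      (EcdConvergence R H E Φ Φ₀ ↔ StrongConvergence Φ Φ₀)) ∧ SameTopologyOn R H E 𝓢 := by
  refine ⟨fun Φ Φ₀ hΦ hΦ₀ => ⟨?_, ?_⟩, hH.sameTopologyOn hE hτ he hC h𝓢⟩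
  · have opNormLE : ∀ Φ ∈ 𝓢, OpNormLE Φ (2 * C) := fun Φ hΦ T =>
      (opNormLE_two_mul_diamondNorm (R := R) Φ T).trans (by gcongr; exact h𝓢 Φ hΦ)
    exact hH.strongConvergence_of_ecdConvergence hE (ENNReal.mul_ne_top ENNReal.ofNat_ne_top hC)
      (fun n => opNormLE _ (hΦ n)) (opNormLE _ hΦ₀)
  · exact hH.ecdConvergence_of_strongConvergence hτ he hC (fun n => h𝓢 _ (hΦ n)) (h𝓢 _ hΦ₀)

end IsHamiltonian

end Main

end ECD

end

theorem proposition4_general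
    {A : Type*} [NormedAddCommGroup A] [InnerProductSpace ℂ A] [CompleteSpace A]
    {B : Type*} [NormedAddCommGroup B] [InnerProductSpace ℂ B] [CompleteSpace B]
    (R : Type*) [NormedAddCommGroup R] [InnerProductSpace ℂ R] [CompleteSpace R] [Nontrivial R]
    {H : A →ₗ.[ℂ] A} (hH : ECD.IsHamiltonian H) {E : ℝ} (hE : ECD.groundEnergy H < (E : EReal)) :
    ((∀ Φ Ψ : ECD.Superoperator A B,
        ECD.ecdNorm R H E (Φ + Ψ) ≤ ECD.ecdNorm R H E Φ + ECD.ecdNorm R H E Ψ) ∧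
      (∀ (c : ℂ) (Φ : ECD.Superoperator A B),
        ECD.ecdNorm R H E (c • Φ) = ‖c‖ₑ * ECD.ecdNorm R H E Φ) ∧
      (∀ Φ : ECD.Superoperator A B, ECD.diamondNorm R Φ < ⊤ → ECD.ecdNorm R H E Φ < ⊤) ∧
      (∀ Φ : ECD.Superoperator A B,
        (∃ C : NNReal, ECD.OpNormLE Φ C) → ECD.ecdNorm R H E Φ = 0 → Φ = 0)) ∧
    (∀ (Φ : ℕ → ECD.Superoperator A B) (Φ₀ : ECD.Superoperator A B),
      (∀ n, ECD.IsChannel (Φ n)) → ECD.IsChannel Φ₀ →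
        ECD.EcdConvergence R H E Φ Φ₀ → ECD.StrongConvergence Φ Φ₀) ∧
    (∀ {ι : Type*} (τ : HilbertBasis ι ℂ A) (e : ι → ℝ),
      (∀ k, (τ k, (e k : ℂ) • τ k) ∈ H.graph) → Filter.Tendsto e Filter.cofinite Filter.atTop →
      (∀ (Φ : ℕ → ECD.Superoperator A B) (Φ₀ : ECD.Superoperator A B),
        (∀ n, ECD.IsChannel (Φ n)) → ECD.IsChannel Φ₀ →
          (ECD.EcdConvergence R H E Φ Φ₀ ↔ ECD.StrongConvergence Φ Φ₀)) ∧
      ECD.SameTopologyOn R H E {Φ : ECD.Superoperator A B | ECD.IsChannel Φ}) ∧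
    (∀ (C : NNReal) (Φ : ℕ → ECD.Superoperator A B) (Φ₀ : ECD.Superoperator A B),
      (∀ n, ECD.OpNormLE (Φ n) C) → ECD.OpNormLE Φ₀ C →
        ECD.EcdConvergence R H E Φ Φ₀ → ECD.StrongConvergence Φ Φ₀) ∧
    (∀ {ι : Type*} (τ : HilbertBasis ι ℂ A) (e : ι → ℝ),
      (∀ k, (τ k, (e k : ℂ) • τ k) ∈ H.graph) → Filter.Tendsto e Filter.cofinite Filter.atTop →
      ∀ (C : NNReal) (𝓢 : Set (ECD.Superoperator A B)), (∀ Φ ∈ 𝓢, ECD.diamondNorm R Φ ≤ C) →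
      (∀ (Φ : ℕ → ECD.Superoperator A B) (Φ₀ : ECD.Superoperator A B),
        (∀ n, Φ n ∈ 𝓢) → Φ₀ ∈ 𝓢 →
          (ECD.EcdConvergence R H E Φ Φ₀ ↔ ECD.StrongConvergence Φ Φ₀)) ∧
      ECD.SameTopologyOn R H E 𝓢) := by
  have channel_opNormLE {Φ : ECD.Superoperator A B} (hΦ : ECD.IsChannel Φ) :
      ECD.OpNormLE Φ (2 * 1) := fun T =>
    (ECD.opNormLE_two_mul_diamondNorm (R := R) Φ T).trans (by gcongr; exact hΦ.diamondNorm_le R)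
  refine ⟨⟨?_, ?_, ?_, ?_⟩, ?_, ?_, ?_, ?_⟩
  · exact (ECD.isExtSeminorm_ecdNorm H E).add_le
  · exact (ECD.isExtSeminorm_ecdNorm H E).map_smul
  · exact fun Φ => (ECD.ecdNorm_le_diamondNorm H E Φ).trans_lt
  · exact fun Φ ⟨C, hC⟩ => hH.eq_zero_of_ecdNorm_eq_zero hE ENNReal.coe_ne_top hC
  · exact fun Φ Φ₀ hΦ hΦ₀ => hH.strongConvergence_of_ecdConvergence hE (by norm_num)
      (fun n => channel_opNormLE (hΦ n)) (channel_opNormLE hΦ₀)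
  · exact fun τ e hτ he => hH.ecdConvergence_iff_and_sameTopologyOn hE hτ he ENNReal.one_ne_top
      fun Φ hΦ => ECD.IsChannel.diamondNorm_le R hΦ
  · exact fun C Φ Φ₀ => hH.strongConvergence_of_ecdConvergence hE ENNReal.coe_ne_top
  · exact fun τ e hτ he C 𝓢 =>
      hH.ecdConvergence_iff_and_sameTopologyOn hE hτ he ENNReal.coe_ne_top

theorem proposition4
    {A : Type*} [NormedAddCommGroup A] [InnerProductSpace ℂ A] [CompleteSpace A]
    [TopologicalSpace.SeparableSpace A]
    {B : Type*} [NormedAddCommGroup B] [InnerProductSpace ℂ B] [CompleteSpace B]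
    [TopologicalSpace.SeparableSpace B]
    {R : Type*} [NormedAddCommGroup R] [InnerProductSpace ℂ R] [CompleteSpace R]
    [TopologicalSpace.SeparableSpace R] (hR : ¬ FiniteDimensional ℂ R)
    (H : A →ₗ.[ℂ] A) (hH : ECD.IsHamiltonian H)
    (E : ℝ) (hE : ECD.groundEnergy H < (E : EReal)) :
    -- the ECD-norm is a norm on the bounded Hermitian-preserving superoperators
    -- (finite wherever the diamond norm is finite)
    ((∀ Φ Ψ : ECD.Superoperator A B, ECD.HermitianPreserving Φ → ECD.HermitianPreserving Ψ →
        ECD.ecdNorm R H E (Φ + Ψ) ≤ ECD.ecdNorm R H E Φ + ECD.ecdNorm R H E Ψ) ∧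
      (∀ (c : ℝ) (Φ : ECD.Superoperator A B), ECD.HermitianPreserving Φ →
        ECD.ecdNorm R H E ((c : ℂ) • Φ) = ENNReal.ofReal |c| * ECD.ecdNorm R H E Φ) ∧
      (∀ Φ : ECD.Superoperator A B, ECD.HermitianPreserving Φ → ECD.diamondNorm R Φ < ⊤ →
        ECD.ecdNorm R H E Φ < ⊤) ∧
      (∀ Φ : ECD.Superoperator A B, ECD.HermitianPreserving Φ →
        (∃ C : NNReal, ECD.OpNormLE Φ C) → ECD.ecdNorm R H E Φ = 0 → Φ = 0)) ∧
    -- part A, for channels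
    (∀ (Φ : ℕ → ECD.Superoperator A B) (Φ₀ : ECD.Superoperator A B),
      (∀ n, ECD.IsChannel (Φ n)) → ECD.IsChannel Φ₀ →
        ECD.EcdConvergence R H E Φ Φ₀ → ECD.StrongConvergence Φ Φ₀) ∧
    -- part B, for channels: sequences and topologies
    (ECD.HasDiscreteSpectrum H →
      (∀ (Φ : ℕ → ECD.Superoperator A B) (Φ₀ : ECD.Superoperator A B),
        (∀ n, ECD.IsChannel (Φ n)) → ECD.IsChannel Φ₀ →
          (ECD.EcdConvergence R H E Φ Φ₀ ↔ ECD.StrongConvergence Φ Φ₀)) ∧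
      ECD.SameTopologyOn R H E {Φ : ECD.Superoperator A B | ECD.IsChannel Φ}) ∧
    -- part A, for operator-norm bounded sets of Hermitian-preserving superoperators
    (∀ (C : NNReal) (Φ : ℕ → ECD.Superoperator A B) (Φ₀ : ECD.Superoperator A B),
      (∀ n, ECD.HermitianPreserving (Φ n) ∧ ECD.OpNormLE (Φ n) C) →
      ECD.HermitianPreserving Φ₀ → ECD.OpNormLE Φ₀ C →
        ECD.EcdConvergence R H E Φ Φ₀ → ECD.StrongConvergence Φ Φ₀) ∧
    -- part B, for diamond-norm bounded sets of Hermitian-preserving superoperators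
    (ECD.HasDiscreteSpectrum H → ∀ (C : NNReal) (𝓢 : Set (ECD.Superoperator A B)),
      (∀ Φ ∈ 𝓢, ECD.HermitianPreserving Φ ∧ ECD.diamondNorm R Φ ≤ C) →
      (∀ (Φ : ℕ → ECD.Superoperator A B) (Φ₀ : ECD.Superoperator A B),
        (∀ n, Φ n ∈ 𝓢) → Φ₀ ∈ 𝓢 →
          (ECD.EcdConvergence R H E Φ Φ₀ ↔ ECD.StrongConvergence Φ Φ₀)) ∧
      ECD.SameTopologyOn R H E 𝓢) := by
  have : Nontrivial R := not_subsingleton_iff_nontrivial.1 fun _ => hR inferInstance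
  obtain ⟨⟨add_le, smul_eq, lt_top, eq_zero⟩, tendsto_channel, discrete_channel, tendsto_bounded,
    discrete_bounded⟩ := proposition4_general (B := B) R hH hE
  refine ⟨⟨fun Φ Ψ _ _ => add_le Φ Ψ, fun c Φ _ => ?_, fun Φ _ => lt_top Φ,
    fun Φ _ => eq_zero Φ⟩, tendsto_channel, ?_, ?_, ?_⟩
  · rw [smul_eq, enorm_eq_nnnorm, Complex.nnnorm_real, ← enorm_eq_nnnorm, Real.enorm_eq_ofReal_abs]
  · exact fun ⟨τ, e, hτ, he⟩ => discrete_channel τ e hτ (Nat.cofinite_eq_atTop ▸ he)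
  · exact fun C Φ Φ₀ hΦ _ => tendsto_bounded C Φ Φ₀ fun n => (hΦ n).2
  · exact fun ⟨τ, e, hτ, he⟩ C 𝓢 h𝓢 =>
      discrete_bounded τ e hτ (Nat.cofinite_eq_atTop ▸ he) C 𝓢 fun Φ hΦ => (h𝓢 Φ hΦ).2
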